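/- **Setting.** Let $z=(z(t))_{t\ge 0}$ be a one-dimensional purely jumping càdlàg Lévy process with Lévy measure $\nu$, i.e. $\mathbb E e^{i\xi z(t)}=e^{t\psi(\xi)}$ with $\psi(\xi)=\int(e^{i\xi y}-1-i\xi y1_{\{|y|\le1\}})\,\nu(dy)$. For $K>0$ put $\Gamma_K=(-\infty,-K]\cup[K,\infty)$, $\gamma_K=\nu(\Gamma_K)$, $\nu_K=\gamma_K^{-1}\nu|_{\Gamma_K}$. Let $F:\mathbb R^2\to\mathbb R^2$ be bounded and Lipschitz, $\|F\|_0=\sup|F|$, $\lambda_1,\lambda_2>0$, and let $X^x$ be the solution, started at $x\in\mathbb R^2$, of $$dX_1=[-\lambda_1X_1+F_1(X)]\,dt+dz,\qquad dX_2=[-\lambda_2X_2+F_2(X)]\,dt .$$ **Assumptions on the noise**, with constants $\alpha\in(0,2)$, $K>0$, $M>0$, $\beta_0\in(0,2)$, $\beta_1,\beta_2>0$: (A1) $\sup_{t\ge0}\mathbb E\big|\int_0^te^{-\lambda(t-s)}dz(s)\big|^p<\infty$ for all $\lambda>0$, $p\in(0,\alpha)$; (A2) $\gamma_K>0$ and $\nu_K$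 has a density $p_K$ with $\int|p_K(u-z_1)-p_K(u-z_2)|\,du\le\beta_1|z_1-z_2|^{\beta_2}$ for all $z_1,z_2\in\mathbb R$; (A3) $\int|p_K(u-z_1)-p_K(u-z_2)|\,du\le\beta_0$ whenever $|z_1|+|z_2|\le M$; (A4) $\gamma_K\ge2\beta_2\|F\|_{\rm Lip}$. **The coupling chain.** Fix $T>0$ and let $\tau=\inf\{t>T:|\Delta z(t)|\ge K\}$. Let $P^{(1)}_{(x,y)}$ be the law of $(X^x(\tau-),X^y(\tau-))$. Let $\eta$ have law $\nu_K$ and, for $a,b\in\mathbb R$, let $(\xi_x(a,b),\xi_y(a,b))$ be a maximal coupling of the laws of $a+\eta$ and $b+\eta$ (a coupling for which the probability that the components differ equals the total variation distance), whose law depends measurably on $(a,b)$. Let $P^{(2)}_{(\hat x,\hat y)}$ be the law of $\big((\xi_x(\hat x_1,\hat y_1),\hat x_2),(\xi_y(\hat x_1,\hat y_1),\hat y_2)\big)$, and let $S=(S^x(k),S^y(k))_{k\ge0}$ be a Markov chain in $\mathbb R^2\times\mathbb R^2$ started at $(x,y)$ with transition probabilities $P_{(x,y)}(A)=\int P^{(2)}_{v}(A)\,P^{(1)}_{(x,y)}(dv)$.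 For $d>0$ put $$\sigma=\sigma(x,y,d)=\inf\{k>0:\ |S^x(k)-S^y(k)|\le d\}\in\mathbb N\cup\{\infty\}.$$ **Theorem 4.2.** There is $M_0>0$, depending only on $z$, $\alpha$, $K$, $\lambda_1$, $T$ and an upper bound for $\|F\|_0$, such that if (A1)-(A4) hold with some $M\ge M_0$, then for every $d>0$ there is $\lambda_0\ge\lambda_1$, depending in addition only on $M,\beta_0,\beta_1,\beta_2,d$ and an upper bound $L\le \gamma_K/(2\beta_2)$ for $\|F\|_{\rm Lip}$, with the following property. For all $\lambda_2>\lambda_0$ and all $p\in(0,\alpha)$ there are $\vartheta,C>0$, depending in addition only on $\lambda_2$ and $p$ (in particular on $F$ only through the bounds for its norms), such that for all $x,y\in\mathbb R^2$ $$\mathbb E_{(x,y)}\big[e^{\vartheta\sigma(x,y,d)}\big]\le C\,(1+|x|^p+|y|^p),$$ where $e^{\vartheta\cdot\infty}=\infty$; in particular $\sigma<\infty$ almost surely. -/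

import Mathlib

open MeasureTheory ProbabilityTheory Set Filter Topology
open scoped NNReal ENNReal

noncomputable section

namespace LevyCoupling

/-- The plane `ℝ²` with the Euclidean norm; its coordinates are indexed by `0` and `1`. -/
abbrev Plane : Type := EuclideanSpace ℝ (Fin 2)

/-! ### Lévy processes -/

/-- A path on `[0, ∞)` that is right-continuous and has left limits. -/
def IsCadlag {E : Type*} [TopologicalSpace E] (f : ℝ≥0 → E) : Prop :=
  ∀ t, ContinuousWithinAt f (Ici t) t ∧ ∃ l, Tendsto f (𝓝[<] t) (𝓝 l)

/-- `ν` is a Lévy measure on `ℝ`. -/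
structure IsLevyMeasure (ν : Measure ℝ) : Prop where
  zero : ν {0} = 0
  lintegral_lt_top : (∫⁻ y, ENNReal.ofReal (min 1 (y ^ 2)) ∂ν) < ∞

/-- The symbol `ψ(ξ) = ∫ (e^{iξy} - 1 - iξy 1_{|y| ≤ 1}) ν(dy)`. -/
def levySymbol (ν : Measure ℝ) (ξ : ℝ) : ℂ :=
  ∫ y, (Complex.exp (ξ * y * Complex.I) - 1
    - (if |y| ≤ 1 then (ξ * y * Complex.I : ℂ) else 0)) ∂ν

/-- `z` is a one-dimensional purely jumping Lévy process on `(Ω, P)` with Lévy measure `ν`: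
it starts at `0`, has càdlàg paths, independent and stationary increments, and
`E e^{iξ z(t)} = e^{t ψ(ξ)}`. -/
structure IsPureJumpLevy {Ω : Type*} [MeasurableSpace Ω] (P : Measure Ω) (z : ℝ≥0 → Ω → ℝ)
    (ν : Measure ℝ) : Prop where
  levyMeasure : IsLevyMeasure ν
  measurable : ∀ t, Measurable (z t)
  zero : ∀ ω, z 0 ω = 0
  cadlag : ∀ ω, IsCadlag fun t ↦ z t ω
  indep : HasIndepIncrements z P
  stationary : ∀ s h, P.map (fun ω ↦ z (s + h) ω - z s ω) = P.map (z h)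
  charFun_eq : ∀ (t : ℝ≥0) (ξ : ℝ), charFun (P.map (z t)) ξ = Complex.exp (t * levySymbol ν ξ)

/-- The jump `Δf(t) = f(t) - f(t-)` of a path. -/
def jump (f : ℝ≥0 → ℝ) (t : ℝ≥0) : ℝ := f t - Function.leftLim f t

/-- `Γ_K = (-∞, -K] ∪ [K, ∞)`. -/
def bigJumps (K : ℝ) : Set ℝ := Iic (-K) ∪ Ici K

/-- `γ_K = ν(Γ_K)`. -/
def bigJumpRate (ν : Measure ℝ) (K : ℝ) : ℝ := ν.real (bigJumps K)

/-- `ν_K = ν|_{Γ_K} / γ_K`, the law of a jump of size at least `K`. -/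
def bigJumpLaw (ν : Measure ℝ) (K : ℝ) : Measure ℝ :=
  (ν (bigJumps K))⁻¹ • ν.restrict (bigJumps K)

/-- The stochastic convolution `∫₀ᵗ e^{-l(t-s)} dz(s)`. As the integrand is deterministic and `C¹`,
this is a pathwise Riemann-Stieltjes integral, here written out by integration by parts
(with `z(0) = 0`). -/
def stochConv {Ω : Type*} (z : ℝ≥0 → Ω → ℝ) (l : ℝ) (t : ℝ≥0) (ω : Ω) : ℝ :=
  z t ω - l * ∫ s in (0 : ℝ)..t, Real.exp (-l * (t - s)) * z s.toNNReal ω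

/-- The assumptions on the noise; `L` stands for the Lipschitz constant of the drift `F`. -/
structure NoiseAssumption {Ω : Type*} [MeasurableSpace Ω] (P : Measure Ω) (z : ℝ≥0 → Ω → ℝ)
    (ν : Measure ℝ) (α K : ℝ) (pK : ℝ → ℝ) (M β₀ β₁ β₂ : ℝ) (L : ℝ≥0) : Prop where
  /-- `sup_t E |∫₀ᵗ e^{-l(t-s)} dz(s)|^p < ∞` for all `l > 0` and `p ∈ (0, α)`. -/
  moments : ∀ l > 0, ∀ p ∈ Ioo 0 α,
    (⨆ t : ℝ≥0, ∫⁻ ω, ENNReal.ofReal (|stochConv z l t ω| ^ p) ∂P) < ∞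
  /-- `ν_K` is well defined and has the density `p_K`. -/
  rate_pos : 0 < bigJumpRate ν K
  density_measurable : Measurable pK
  density_nonneg : ∀ u, 0 ≤ pK u
  density : bigJumpLaw ν K = volume.withDensity fun u ↦ ENNReal.ofReal (pK u)
  /-- Hölder continuity of the translations of `p_K` in `L¹`. -/
  β₁_pos : 0 < β₁
  β₂_pos : 0 < β₂
  holder : ∀ z₁ z₂ : ℝ, ∫ u, |pK (u - z₁) - pK (u - z₂)| ≤ β₁ * |z₁ - z₂| ^ β₂
  /-- Translates of `p_K` by a bounded amount overlap. -/
  β₀_mem : β₀ ∈ Ioo 0 2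
  overlap : ∀ z₁ z₂ : ℝ, |z₁| + |z₂| ≤ M → ∫ u, |pK (u - z₁) - pK (u - z₂)| ≤ β₀
  /-- There are sufficiently many jumps of size at least `K`. -/
  rate_ge : 2 * β₂ * L ≤ bigJumpRate ν K

/-! ### The stochastic differential equation -/

/-- `X x` is a càdlàg strong solution, started at `x`, of
`dX₁ = (-l₁ X₁ + F₁(X)) dt + dz`, `dX₂ = (-l₂ X₂ + F₂(X)) dt`, for every `x`. -/
def IsSolution {Ω : Type*} [MeasurableSpace Ω] (P : Measure Ω) (z : ℝ≥0 → Ω → ℝ)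
    (l₁ l₂ : ℝ) (F : Plane → Plane) (X : Plane → ℝ≥0 → Ω → Plane) : Prop :=
  ∀ x, ∀ᵐ ω ∂P, IsCadlag (fun t ↦ X x t ω) ∧ ∀ t : ℝ≥0,
    X x t ω 0 = x 0 + (∫ s in (0 : ℝ)..t,
      (-l₁ * X x s.toNNReal ω 0 + F (X x s.toNNReal ω) 0)) + z t ω ∧
    X x t ω 1 = x 1 + ∫ s in (0 : ℝ)..t,
      (-l₂ * X x s.toNNReal ω 1 + F (X x s.toNNReal ω) 1)

/-! ### The coupling chain -/

/-- `τ = inf {t > T : |Δz(t)| ≥ K}`. -/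
def waitTime {Ω : Type*} (z : ℝ≥0 → Ω → ℝ) (T : ℝ≥0) (K : ℝ) (ω : Ω) : ℝ≥0 :=
  sInf {t | T < t ∧ K ≤ |jump (fun s ↦ z s ω) t|}

/-- The law `P⁽¹⁾_{(x,y)}` of `(X^x(τ-), X^y(τ-))`, where both solutions are driven by `z`. -/
def preJumpLaw {Ω : Type*} [MeasurableSpace Ω] (P : Measure Ω) (z : ℝ≥0 → Ω → ℝ)
    (T : ℝ≥0) (K : ℝ) (X : Plane → ℝ≥0 → Ω → Plane) (u : Plane × Plane) :
    Measure (Plane × Plane) :=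
  P.map fun ω ↦ (Function.leftLim (fun t ↦ X u.1 t ω) (waitTime z T K ω),
    Function.leftLim (fun t ↦ X u.2 t ω) (waitTime z T K ω))

/-- The total variation distance `sup_A |μ(A) - μ'(A)|`. -/
def tvDist {E : Type*} [MeasurableSpace E] (μ μ' : Measure E) : ℝ :=
  ⨆ A : {A : Set E // MeasurableSet A}, |μ.real A - μ'.real A|

/-- `π` is the law of a maximal coupling of `μ` and `μ'`: it has these marginals, and the
probability that its two components differ is the total variation distance. -/
structure IsMaximalCoupling (π : Measure (ℝ × ℝ)) (μ μ' : Measure ℝ) : Prop where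
  fst : π.map Prod.fst = μ
  snd : π.map Prod.snd = μ'
  maximal : π.real {ξ | ξ.1 ≠ ξ.2} = tvDist μ μ'

/-- `Q` is a measurable choice, for all `a, b ∈ ℝ`, of (the law of) a maximal coupling of the laws
of `a + η` and `b + η`, where `η` has the law `ν_K`. -/
def IsMaximalCouplingKernel (ν : Measure ℝ) (K : ℝ) (Q : Kernel (ℝ × ℝ) (ℝ × ℝ)) : Prop :=
  ∀ a b, IsMaximalCoupling (Q (a, b)) ((bigJumpLaw ν K).map fun η ↦ a + η)
    ((bigJumpLaw ν K).map fun η ↦ b + η)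

/-- The law `P⁽²⁾_v` for `v = (x̂, ŷ)`: the first coordinates are replaced by the maximal coupling,
the second coordinates are kept. -/
def postJumpLaw (Q : Kernel (ℝ × ℝ) (ℝ × ℝ)) (v : Plane × Plane) : Measure (Plane × Plane) :=
  (Q (v.1 0, v.2 0)).map fun ξ ↦ (!₂[ξ.1, v.1 1], !₂[ξ.2, v.2 1])

/-- The transition probabilities `P_u(A) = ∫ P⁽²⁾_v(A) P⁽¹⁾_u(dv)` of the coupling chain. -/
def couplingTransition {Ω : Type*} [MeasurableSpace Ω] (P : Measure Ω) (z : ℝ≥0 → Ω → ℝ)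
    (T : ℝ≥0) (K : ℝ) (X : Plane → ℝ≥0 → Ω → Plane) (Q : Kernel (ℝ × ℝ) (ℝ × ℝ))
    (u : Plane × Plane) : Measure (Plane × Plane) :=
  (preJumpLaw P z T K X u).bind (postJumpLaw Q)

/-- `S` is a Markov chain on `(Ω', P')` with transition probabilities `κ` and initial state `u`. -/
structure IsMarkovChain {Ω' G : Type*} [MeasurableSpace Ω'] [MeasurableSpace G] (P' : Measure Ω')
    (S : ℕ → Ω' → G) (κ : G → Measure G) (u : G) : Prop where
  measurable : ∀ n, Measurable (S n)
  init : ∀ᵐ ω ∂P', S 0 ω = u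
  step : ∀ (n : ℕ) (A : Set G) (D : Set Ω'), MeasurableSet A →
    MeasurableSet[⨆ (i : ℕ) (_ : i ≤ n), MeasurableSpace.comap (S i) inferInstance] D →
    P' (D ∩ S (n + 1) ⁻¹' A) = ∫⁻ ω in D, κ (S n ω) A ∂P'

/-- `σ = inf {k > 0 : |S^x(k) - S^y(k)| ≤ d}`, equal to `∞` if there is no such `k`. -/
def meetTime {Ω' : Type*} (S : ℕ → Ω' → Plane × Plane) (d : ℝ) (ω : Ω') : ℕ∞ :=
  ⨅ (k : ℕ) (_ : 0 < k ∧ ‖(S k ω).1 - (S k ω).2‖ ≤ d), (k : ℕ∞)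

/-- `e^{θ k}` for `k ∈ ℕ ∪ {∞}` and `θ > 0`, with `e^{θ ∞} = ∞`. -/
def expENat (θ : ℝ) (k : ℕ∞) : ℝ≥0∞ :=
  if k = ⊤ then ∞ else ENNReal.ofReal (Real.exp (θ * k.toNat))

end LevyCoupling

end

namespace LevyCoupling

/-! ### Càdlàg paths -/

/-! Let `V(u)` be the sum of the `q`-th powers of the moduli of the four coordinates of a pair, with
`q = α / 2 ≤ 1` (`lyapunov`). Up to `τ-` the linear drift damps every coordinate for a time at least
`T`, so the first coordinate is at most `e^{-λ₁T}|x₁| + ‖F‖/λ₁ + 2 sup_{s ≤ τ}|z(s)|`, and the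
second satisfies the same kind of bound at rate `λ₂`, without noise. As `t ↦ t^q` is subadditive,
one step of the chain gives `E V ≤ ρ V + C` with `ρ = e^{-qλ₁T} < 1`, once the supremum and the jump
have finite `q`-th moments.

If `V ≤ R`, then with probability at least `1/2` the noise up to `τ` stays below a fixed level. Both
first coordinates before the jump then satisfy the size condition of (A3), where `M₀` enters, and
the maximal coupling makes them equal with probability at least `1 - β₀/2`. What remains is the
difference of the second coordinates, at most `2(e^{-λ₂T}R^{1/q} + ‖F‖/λ₂) ≤ d` for large `λ₂`. If
`V > R`, the drift of `V` suffices. Both cases combine (`exists_contraction`,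
`exists_uniform_contraction`): for a suitable `A`, the function `A + V`, integrated over pairs that
are not close, contracts by a factor `r < 1` in one step. Iteration gives `P(σ > n) ≤ r^n (A +
V)/A`. Raising this bound to a power `s ≤ 1` yields the growth `|x|^p`.

The probabilistic work is to get the two moments from those of the stochastic convolution.
Ottaviani's inequality for exponentially weighted increments on dyadic grids, with two summations by
parts, bounds the oscillation of `z` over `[0, T]` (`measure_blockOsc_tail_le`). Fourier inversion
gives `E f(z(t)) / t → ∫ f dν` for Schwartz functions vanishing to second order at `0`, hence `ν` is
controlled by the small-time tails of `z` (`measure_tail_le`). This has two uses: the jump law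
inherits the tails of the oscillation, and each block of length `T` without an increment larger than
`K` costs a factor `ρ < 1`. By independence of past and future, the oscillations of all blocks up to
`τ` sum to an integrable variable (`exists_control`). -/

theorem IsCadlag.comp {E F : Type*} [TopologicalSpace E] [TopologicalSpace F] {f : ℝ≥0 → E}
    (hf : IsCadlag f) {g : E → F} (hg : Continuous g) : IsCadlag fun t ↦ g (f t) := fun t ↦
  ⟨hg.continuousAt.comp_continuousWithinAt (hf t).1,
    let ⟨l, hl⟩ := (hf t).2
    ⟨g l, (hg.tendsto l).comp hl⟩⟩

/-- The one-sided limits bound the path near each point, and compactness of `[0, T]` does the rest.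
-/
theorem IsCadlag.exists_abs_le {f : ℝ≥0 → ℝ} (hf : IsCadlag f) (T : ℝ≥0) :
    ∃ C, 0 ≤ C ∧ ∀ s ≤ T, |f s| ≤ C := by
  have key : ∃ C, ∀ s ∈ Icc 0 T, |f s| ≤ C := by
    refine isCompact_Icc.induction_on (p := fun A ↦ ∃ C, ∀ s ∈ A, |f s| ≤ C) ⟨0, by simp⟩ ?_ ?_ ?_
    · rintro s t hst ⟨C, hC⟩
      exact ⟨C, fun x hx ↦ hC x (hst hx)⟩
    · rintro s t ⟨C, hC⟩ ⟨C', hC'⟩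
      refine ⟨max C C', ?_⟩
      rintro x (hx | hx)
      · exact (hC x hx).trans (le_max_left _ _)
      · exact (hC' x hx).trans (le_max_right _ _)
    · intro x _
      obtain ⟨hr, l, hl⟩ := hf x
      have h1 : ∀ᶠ y in 𝓝[≥] x, |f y| ≤ max (|f x| + 1) (|l| + 1) := by
        filter_upwards [(hr.abs).eventually (gt_mem_nhds (lt_add_one |f x|))] with y hy
        exact hy.le.trans (le_max_left _ _)
      have h2 : ∀ᶠ y in 𝓝[<] x, |f y| ≤ max (|f x| + 1) (|l| + 1) := by
        filter_upwards [(hl.abs).eventually (gt_mem_nhds (lt_add_one |l|))] with y hy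
        exact hy.le.trans (le_max_right _ _)
      have h3 : ∀ᶠ y in 𝓝 x, |f y| ≤ max (|f x| + 1) (|l| + 1) := by
        rw [← nhdsLT_sup_nhdsGE]
        exact eventually_sup.2 ⟨h2, h1⟩
      exact ⟨_, mem_nhdsWithin_of_mem_nhds h3, _, fun y hy ↦ hy⟩
  obtain ⟨C, hC⟩ := key
  exact ⟨C, (abs_nonneg _).trans (hC 0 (by simp)), fun s hs ↦ hC s ⟨by simp, hs⟩⟩

/-- The smallest point of the grid of mesh `h` to the right of `s`. -/
noncomputable def gridCeil (h : ℝ≥0) (s : ℝ) : ℝ≥0 := ⌈s / h⌉₊ * h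

theorem toNNReal_le_gridCeil {h : ℝ≥0} (hh : 0 < h) (s : ℝ) : s.toNNReal ≤ gridCeil h s := by
  rw [Real.toNNReal_le_iff_le_coe, gridCeil]
  have h0 : (0 : ℝ) < h := hh
  push_cast
  rw [← div_le_iff₀ h0]
  exact Nat.le_ceil _

theorem gridCeil_le {h : ℝ≥0} (hh : 0 < h) {s : ℝ} (hs : 0 ≤ s) :
    (gridCeil h s : ℝ) ≤ s + h := by
  have h0 : (0 : ℝ) < h := hh
  have := (Nat.ceil_lt_add_one (div_nonneg hs h0.le)).le
  rw [gridCeil]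
  push_cast
  calc (⌈s / h⌉₊ : ℝ) * h ≤ (s / h + 1) * h := by gcongr
    _ = s + h := by field_simp

/-- The grid points approach from the right, so right-continuity alone carries values of a path to
the limit. For negative `s` both sides are `0`. -/
theorem tendsto_gridCeil {h : ℕ → ℝ≥0} (hh : ∀ n, 0 < h n) (h0 : Tendsto h atTop (𝓝 0)) (s : ℝ) :
    Tendsto (fun n ↦ gridCeil (h n) s) atTop (𝓝[≥] s.toNNReal) := by
  refine tendsto_nhdsWithin_iff.2 ⟨?_, Eventually.of_forall fun n ↦ toNNReal_le_gridCeil (hh n) s⟩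
  rcases le_or_gt 0 s with hs | hs
  · rw [← NNReal.tendsto_coe, Real.coe_toNNReal _ hs]
    refine tendsto_of_tendsto_of_tendsto_of_le_of_le tendsto_const_nhds
      (h := fun n ↦ s + h n) ?_ (fun n ↦ ?_) (fun n ↦ gridCeil_le (hh n) hs)
    · simpa using tendsto_const_nhds.add (NNReal.tendsto_coe.2 h0)
    · exact Real.toNNReal_le_iff_le_coe.1 (toNNReal_le_gridCeil (hh n) s)
  · have : ∀ n, gridCeil (h n) s = 0 := fun n ↦ by
      have : ⌈s / h n⌉₊ = 0 := Nat.ceil_eq_zero.2 (div_nonpos_of_nonpos_of_nonneg hs.le (by simp))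
      simp [gridCeil, this]
    simp [this, Real.toNNReal_of_nonpos hs.le]

theorem measurable_comp_gridCeil (f : ℝ≥0 → ℝ) (h : ℝ≥0) :
    Measurable fun s : ℝ ↦ f (gridCeil h s) :=
  (measurable_from_nat (f := fun k : ℕ ↦ f (k * h))).comp
    (Nat.measurable_ceil.comp (measurable_id.div_const _))

theorem IsCadlag.tendsto_gridCeil {f : ℝ≥0 → ℝ} (hf : IsCadlag f) {h : ℕ → ℝ≥0}
    (hh : ∀ n, 0 < h n) (h0 : Tendsto h atTop (𝓝 0)) (s : ℝ) :
    Tendsto (fun n ↦ f (gridCeil (h n) s)) atTop (𝓝 (f s.toNNReal)) :=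
  (hf s.toNNReal).1.tendsto.comp (LevyCoupling.tendsto_gridCeil hh h0 s)

theorem IsCadlag.measurable {f : ℝ≥0 → ℝ} (hf : IsCadlag f) :
    Measurable fun s : ℝ ↦ f s.toNNReal := by
  refine measurable_of_tendsto_metrizable
    (fun n : ℕ ↦ measurable_comp_gridCeil f (1 / ((n : ℝ≥0) + 1)))
    (tendsto_pi_nhds.2 fun s ↦ hf.tendsto_gridCeil (fun n ↦ by positivity) ?_ s)
  exact tendsto_one_div_add_atTop_nhds_zero_nat

theorem IsCadlag.intervalIntegrable {f : ℝ≥0 → ℝ} (hf : IsCadlag f) {a b : ℝ} :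
    IntervalIntegrable (fun s ↦ f s.toNNReal) volume a b := by
  obtain ⟨C, -, hC⟩ := hf.exists_abs_le (max a b).toNNReal
  refine (intervalIntegrable_const (c := C)).mono_fun' hf.measurable.aestronglyMeasurable ?_
  refine (ae_restrict_iff' measurableSet_uIoc).2 (Eventually.of_forall fun s hs ↦ ?_)
  exact hC _ (Real.toNNReal_le_toNNReal hs.2)

theorem IsCadlag.continuousWithinAt_toNNReal {f : ℝ≥0 → ℝ} (hf : IsCadlag f) (s : ℝ) :
    ContinuousWithinAt (fun r : ℝ ↦ f r.toNNReal) (Ici s) s :=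
  ContinuousWithinAt.comp (t := Ici s.toNNReal) (hf _).1
    continuous_real_toNNReal.continuousWithinAt fun _ h ↦ Real.toNNReal_le_toNNReal h

theorem IsCadlag.tendsto_leftLim {E : Type*} [TopologicalSpace E] [T2Space E] {f : ℝ≥0 → E}
    (hf : IsCadlag f) {t : ℝ≥0} (ht : 0 < t) :
    Tendsto f (𝓝[<] t) (𝓝 (Function.leftLim f t)) := by
  have : (𝓝[<] t).NeBot := nhdsLT_neBot_of_exists_lt ⟨0, ht⟩
  obtain ⟨l, hl⟩ := (hf t).2
  rwa [leftLim_eq_of_tendsto hl]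

/-- A càdlàg path whose increments over arbitrarily short intervals in `[a, b]` exceed `K` has a
jump of size at least `K` in `(a, b]`. -/
theorem IsCadlag.exists_jump {f : ℝ≥0 → ℝ} (hf : IsCadlag f) {a b : ℝ≥0} {K : ℝ} (hK : 0 < K)
    {s t : ℕ → ℝ≥0} (hs : ∀ n, a ≤ s n) (hst : ∀ n, s n ≤ t n) (ht : ∀ n, t n ≤ b)
    (hlim : Tendsto (fun n ↦ ((t n : ℝ) - s n)) atTop (𝓝 0)) (hbig : ∀ n, K < |f (t n) - f (s n)|) :
    ∃ r, a < r ∧ r ≤ b ∧ K ≤ |jump f r| := by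
  -- Along a subsequence both endpoints tend to one point `r`. If `r = a`, they lie to the right of
  -- `r` and right-continuity makes the increment small. If `r > a`, each value is close to `f r` or
  -- to the left limit at `r`, so the increment exceeds the jump by arbitrarily little.
  obtain ⟨r, hr, φ, hφ, hsr⟩ := (isCompact_Icc (a := a) (b := b)).tendsto_subseq
    (x := s) fun n ↦ ⟨hs n, (hst n).trans (ht n)⟩
  have htr : Tendsto (t ∘ φ) atTop (𝓝 r) := by
    rw [← NNReal.tendsto_coe] at hsr ⊢
    simpa using (hlim.comp hφ.tendsto_atTop).add hsr
  by_contra! hcon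
  have hclose : ∀ ε > 0, ∀ᶠ y in 𝓝 r, r ≤ y → |f y - f r| < ε := fun ε hε ↦ by
    have := (hf r).1.tendsto.eventually (Metric.ball_mem_nhds (f r) hε)
    rw [eventually_nhdsWithin_iff] at this
    simpa [Real.dist_eq] using this
  rcases eq_or_lt_of_le hr.1 with rfl | har
  · have hc := hclose (K / 2) (by positivity)
    obtain ⟨n, h1, h2⟩ := ((hsr.eventually hc).and (htr.eventually hc)).exists
    have h1 := abs_lt.1 (h1 (hs _))
    have h2 := abs_lt.1 (h2 ((hs _).trans (hst _)))
    have h3 := hbig (φ n)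
    simp only [Function.comp_apply] at h1 h2
    exact absurd h3 (not_lt.2 (abs_le.2 ⟨by linarith, by linarith⟩))
  · have hj := hcon r har hr.2
    set ε := (K - |jump f r|) / 2 with hε
    have hε0 : 0 < ε := by simp only [hε]; linarith
    have hKε : |jump f r| + 2 * ε = K := by simp only [hε]; ring
    have hc := hclose ε hε0
    have hd : ∀ᶠ y in 𝓝 r, y < r → |f y - Function.leftLim f r| < ε := by
      have := (hf.tendsto_leftLim (a.2.trans_lt har)).eventually (Metric.ball_mem_nhds _ hε0)
      rw [eventually_nhdsWithin_iff] at this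
      simpa [Real.dist_eq] using this
    obtain ⟨n, ⟨h1, h2⟩, h3, h4⟩ := (((hsr.eventually hc).and (htr.eventually hc)).and
      ((hsr.eventually hd).and (htr.eventually hd))).exists
    have h5 := hbig (φ n)
    have hJ0 := abs_le.1 (le_refl |jump f r|)
    have hJ1 := abs_nonneg (jump f r)
    simp only [Function.comp_apply] at h1 h2 h3 h4
    refine absurd h5 (not_lt.2 ?_)
    simp only [jump] at hJ0 hJ1 hKε
    rcases lt_or_ge (s (φ n)) r with hsr' | hsr'
    · have h3 := abs_lt.1 (h3 hsr')
      rcases lt_or_ge (t (φ n)) r with htr' | htr'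
      · have h4 := abs_lt.1 (h4 htr')
        exact abs_le.2 ⟨by linarith, by linarith⟩
      · have h2 := abs_lt.1 (h2 htr')
        exact abs_le.2 ⟨by linarith, by linarith⟩
    · have h1 := abs_lt.1 (h1 hsr')
      have h2 := abs_lt.1 (h2 (hsr'.trans (hst _)))
      exact abs_le.2 ⟨by linarith, by linarith⟩

/-- A solution of `dy = (-l y + g) dt + dζ` is bounded by its initial value, damped at rate `l`,
and the bounds for `g` and `ζ`. -/
theorem abs_le_of_linear_equation {l B m x : ℝ} (hl : 0 < l) {y g ζ : ℝ≥0 → ℝ} (hy : IsCadlag y)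
    (hg : IsCadlag g) (hgB : ∀ s, |g s| ≤ B) {t : ℝ≥0}
    (hζm : ∀ s ≤ t, |ζ s| ≤ m)
    (heq : ∀ s : ℝ≥0, y s = x + (∫ r in (0 : ℝ)..s, (-l * y r.toNNReal + g r.toNNReal)) + ζ s) :
    |y t| ≤ Real.exp (-l * t) * |x| + B / l + 2 * m := by
  set A : ℝ → ℝ := fun s ↦ x + ∫ r in (0 : ℝ)..s, (-l * y r.toNNReal + g r.toNNReal) with hA
  have hii : ∀ a b : ℝ, IntervalIntegrable (fun r : ℝ ↦ -l * y r.toNNReal + g r.toNNReal)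
      volume a b := fun a b ↦ (hy.intervalIntegrable.const_mul _).add hg.intervalIntegrable
  have hAc : Continuous A := continuous_const.add
    (intervalIntegral.continuous_primitive (fun a b ↦ hii a b) 0)
  have hAd : ∀ s, HasDerivWithinAt A (-l * y s.toNNReal + g s.toNNReal) (Ici s) s := fun s ↦ by
    refine (intervalIntegral.integral_hasDerivWithinAt_right (hii 0 s) ?_ ?_).const_add x
    · exact ((hy.measurable.const_mul _).add hg.measurable).stronglyMeasurable
        |>.stronglyMeasurableAtFilter
    · exact ((continuousWithinAt_const.mul (hy.continuousWithinAt_toNNReal s)).add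
        (hg.continuousWithinAt_toNNReal s)).mono Ioi_subset_Ici_self
  have hAy : ∀ s : ℝ, 0 ≤ s → A s = y s.toNNReal - ζ s.toNNReal := fun s hs ↦ by
    have := heq s.toNNReal
    rw [Real.coe_toNNReal _ hs] at this
    rw [this, hA]
    ring
  have hexp : ∀ s : ℝ, HasDerivAt (fun s ↦ Real.exp (l * s)) (l * Real.exp (l * s)) s := fun s ↦ by
    have := ((hasDerivAt_id s).const_mul l).exp
    simpa [mul_comm] using this
  -- As `A = y - ζ`, the right derivative of `e^{ls} A(s)` is `e^{ls}(g - lζ)`, which involves `ζ`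
  -- only through its bound. One `m` of the final `2 * m` arises here, the other from adding `ζ`
  -- back.
  have key := image_norm_le_of_norm_deriv_right_le_deriv_boundary (a := 0) (b := (t : ℝ))
    (f := fun s ↦ Real.exp (l * s) * A s)
    (f' := fun s ↦ Real.exp (l * s) * (g s.toNNReal - l * ζ s.toNNReal))
    (B := fun s ↦ |x| + (B / l + m) * (Real.exp (l * s) - 1))
    (B' := fun s ↦ (B / l + m) * (l * Real.exp (l * s)))
    (by fun_prop)
    (fun s hs ↦ by
      refine ((hexp s).hasDerivWithinAt.mul (hAd s)).congr_deriv ?_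
      rw [hAy s hs.1]; ring)
    (by simp [hA])
    (fun s ↦ (((hexp s).sub_const 1).const_mul _).const_add _)
    (fun s hs ↦ by
      have h1 := hgB s.toNNReal
      have h2 := hζm s.toNNReal (Real.toNNReal_le_iff_le_coe.2 hs.2.le)
      rw [norm_mul, Real.norm_eq_abs, Real.norm_eq_abs, abs_of_pos (Real.exp_pos _)]
      calc Real.exp (l * s) * |g s.toNNReal - l * ζ s.toNNReal|
          ≤ Real.exp (l * s) * (B + l * m) := by
            gcongr
            refine (abs_sub _ _).trans (add_le_add h1 ?_)
            rw [abs_mul, abs_of_pos hl]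
            gcongr
        _ = (B / l + m) * (l * Real.exp (l * s)) := by field_simp)
    (right_mem_Icc.2 t.2)
  simp only [norm_mul, Real.norm_eq_abs, abs_of_pos (Real.exp_pos _)] at key
  have hB0 : 0 ≤ B := (abs_nonneg _).trans (hgB 0)
  have hm0 : 0 ≤ m := (abs_nonneg _).trans (hζm t le_rfl)
  have hAt := hAy t t.2
  rw [Real.toNNReal_coe] at hAt
  have h1 : |A t| ≤ Real.exp (-l * t) * |x| + (B / l + m) := by
    have he : Real.exp (-l * t) * Real.exp (l * t) = 1 := by
      rw [← Real.exp_add]; simp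
    calc |A t| = Real.exp (-l * t) * (Real.exp (l * t) * |A t|) := by rw [← mul_assoc, he, one_mul]
      _ ≤ Real.exp (-l * t) * (|x| + (B / l + m) * (Real.exp (l * t) - 1)) := by gcongr
      _ = Real.exp (-l * t) * |x| + (B / l + m) * (1 - Real.exp (-l * t)) := by
        linear_combination (B / l + m) * he
      _ ≤ Real.exp (-l * t) * |x| + (B / l + m) * 1 := by
        gcongr
        linarith [Real.exp_pos (-l * t)]
      _ = _ := by ring
  have h2 : y t = A t + ζ t := by rw [hAt]; ring
  rw [h2]
  have := abs_add_le (A t) (ζ t)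
  linarith [hζm t le_rfl]


/-! ### Summation by parts and Riemann-Stieltjes sums -/

theorem sum_mul_sub_eq (w a : ℕ → ℝ) (n : ℕ) :
    ∑ k ∈ Finset.range n, w k * (a (k + 1) - a k)
      = w n * a n - w 0 * a 0 - ∑ k ∈ Finset.range n, a (k + 1) * (w (k + 1) - w k) := by
  induction n with
  | zero => simp
  | succ n ih => rw [Finset.sum_range_succ, Finset.sum_range_succ, ih]; ring

/-- After summation by parts, the boundary term costs `w n * m` and the monotone weights telescope
to at most as much again. -/
theorem abs_sum_mul_sub_le {w a : ℕ → ℝ} (hw : Monotone w) (hw0 : 0 ≤ w 0) {m : ℝ} {n : ℕ}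
    (ha0 : a 0 = 0) (ha : ∀ k ≤ n, |a k| ≤ m) :
    |∑ k ∈ Finset.range n, w k * (a (k + 1) - a k)| ≤ 2 * w n * m := by
  rw [sum_mul_sub_eq, ha0, mul_zero, sub_zero]
  have hwn : 0 ≤ w n := hw0.trans (hw (Nat.zero_le n))
  have hm : 0 ≤ m := (abs_nonneg _).trans (ha 0 (Nat.zero_le n))
  refine (abs_sub _ _).trans ?_
  have h1 : |w n * a n| ≤ w n * m := by
    rw [abs_mul, abs_of_nonneg hwn]
    gcongr
    exact ha n le_rfl
  have h2 : |∑ k ∈ Finset.range n, a (k + 1) * (w (k + 1) - w k)| ≤ m * (w n - w 0) := by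
    refine (Finset.abs_sum_le_sum_abs _ _).trans ?_
    rw [← Finset.sum_range_sub w n, Finset.mul_sum]
    refine Finset.sum_le_sum fun k hk ↦ ?_
    rw [abs_mul, abs_of_nonneg (sub_nonneg.2 (hw (Nat.le_succ k)))]
    exact mul_le_mul_of_nonneg_right (ha _ (Finset.mem_range.1 hk))
      (sub_nonneg.2 (hw (Nat.le_succ k)))
  nlinarith [mul_nonneg hm hw0]

/-- A sequence is bounded by the sums of its increments with increasing weights. -/
theorem abs_le_of_abs_sum_mul_sub_le {w a : ℕ → ℝ} (hw : Monotone w) (hw0 : w 0 = 1) {m : ℝ} {n : ℕ}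
    (ha0 : a 0 = 0)
    (h : ∀ j ≤ n, |∑ k ∈ Finset.range j, w k * (a (k + 1) - a k)| ≤ m) : |a n| ≤ m := by
  set S : ℕ → ℝ := fun j ↦ ∑ k ∈ Finset.range j, w k * (a (k + 1) - a k) with hS
  have hwpos : ∀ k, 0 < w k := fun k ↦ by linarith [hw (Nat.zero_le k)]
  have hm : 0 ≤ m := (abs_nonneg _).trans (h 0 (Nat.zero_le n))
  have hv : ∀ k, 0 ≤ (w k)⁻¹ - (w (k + 1))⁻¹ := fun k ↦
    sub_nonneg.2 (inv_anti₀ (hwpos k) (hw (Nat.le_succ k)))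
  -- The increments of `a` are those of `S` with the decreasing weights `1 / w`. In the second
  -- summation by parts the boundary term `m / w n` and the variation `m * (1 - 1 / w n)` add up to
  -- exactly `m`.
  have ha : a n = ∑ k ∈ Finset.range n, (w k)⁻¹ * (S (k + 1) - S k) := by
    have : ∀ k, (w k)⁻¹ * (S (k + 1) - S k) = a (k + 1) - a k := fun k ↦ by
      have : S (k + 1) - S k = w k * (a (k + 1) - a k) := by
        simp only [hS, Finset.sum_range_succ]; ring
      rw [this, inv_mul_cancel_left₀ (hwpos k).ne']
    simp only [this]
    rw [Finset.sum_range_sub, ha0, sub_zero]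
  rw [ha, sum_mul_sub_eq (fun k ↦ (w k)⁻¹)]
  have hS0 : S 0 = 0 := by simp [hS]
  rw [hS0, mul_zero, sub_zero]
  refine (abs_sub _ _).trans ?_
  have h1 : |(w n)⁻¹ * S n| ≤ (w n)⁻¹ * m := by
    rw [abs_mul, abs_of_pos (inv_pos.2 (hwpos n))]
    exact mul_le_mul_of_nonneg_left (h n le_rfl) (inv_pos.2 (hwpos n)).le
  have h2 : |∑ k ∈ Finset.range n, S (k + 1) * ((w (k + 1))⁻¹ - (w k)⁻¹)|
      ≤ m * ((w 0)⁻¹ - (w n)⁻¹) := by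
    refine (Finset.abs_sum_le_sum_abs _ _).trans ?_
    rw [← Finset.sum_range_sub' (fun k ↦ (w k)⁻¹) n, Finset.mul_sum]
    refine Finset.sum_le_sum fun k hk ↦ ?_
    rw [abs_mul, abs_sub_comm, abs_of_nonneg (hv k)]
    exact mul_le_mul_of_nonneg_right (h _ (Finset.mem_range.1 hk)) (hv k)
  rw [hw0, inv_one] at h2
  linarith

theorem gridCeil_eq {h : ℝ≥0} (hh : 0 < h) {k : ℕ} {s : ℝ} (hs : s ∈ Ioc ((k : ℝ) * h)
    (((k + 1 : ℕ) : ℝ) * h)) : gridCeil h s = ((k + 1 : ℕ) : ℝ≥0) * h := by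
  have h0 : (0 : ℝ) < h := hh
  have : ⌈s / h⌉₊ = k + 1 := by
    rw [Nat.ceil_eq_iff (by simp)]
    refine ⟨?_, (div_le_iff₀ h0).2 hs.2⟩
    rw [lt_div_iff₀ h0]
    simpa using hs.1
  rw [gridCeil, this]

/-- On each grid interval `gridCeil` is the right endpoint, so the sum left by summation by parts is
exactly the integral of a step function. -/
theorem sum_exp_mul_sub_eq {f : ℝ≥0 → ℝ} (hf0 : f 0 = 0) (l : ℝ) {h : ℝ≥0} (hh : 0 < h) (n : ℕ) :
    ∑ k ∈ Finset.range n, Real.exp (l * (k * h)) * (f ((k + 1 : ℕ) * h) - f (k * h))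
      = Real.exp (l * (n * h)) * f (n * h)
        - ∫ s in (0 : ℝ)..n * h, l * Real.exp (l * s) * f (gridCeil h s) := by
  have hInt : ∀ k : ℕ, EqOn (fun s ↦ l * Real.exp (l * s) * f (gridCeil h s))
      (fun s ↦ l * Real.exp (l * s) * f ((k + 1 : ℕ) * h))
      (Ioc ((k : ℝ) * h) (((k + 1 : ℕ) : ℝ) * h)) := fun k s hs ↦ by
    simp only [gridCeil_eq hh hs]
  have hle : ∀ k : ℕ, (k : ℝ) * h ≤ ((k + 1 : ℕ) : ℝ) * h := fun k ↦ by
    gcongr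
    exact Nat.le_succ k
  have hcont : ∀ c a b : ℝ, IntervalIntegrable (fun s ↦ l * Real.exp (l * s) * c) volume a b :=
    fun c a b ↦ Continuous.intervalIntegrable (by fun_prop) _ _
  have hval : ∀ a b : ℝ, ∫ s in a..b, l * Real.exp (l * s) = Real.exp (l * b) - Real.exp (l * a) :=
    fun a b ↦ by
      refine intervalIntegral.integral_eq_sub_of_hasDerivAt (f := fun s ↦ Real.exp (l * s))
        (fun s _ ↦ ?_) (Continuous.intervalIntegrable (by fun_prop) _ _)
      have := ((hasDerivAt_id s).const_mul l).exp
      simpa [mul_comm] using this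
  have hsum := intervalIntegral.sum_integral_adjacent_intervals (a := fun k : ℕ ↦ (k : ℝ) * h)
    (f := fun s ↦ l * Real.exp (l * s) * f (gridCeil h s)) (n := n) (μ := volume) (fun k _ ↦ by
      refine (hcont (f ((k + 1 : ℕ) * h)) _ _).congr ?_
      rw [uIoc_of_le (hle k)]
      exact fun s hs ↦ (hInt k hs).symm)
  simp only [Nat.cast_zero, zero_mul] at hsum
  rw [← hsum, sum_mul_sub_eq (fun k ↦ Real.exp (l * (k * h))) (fun k ↦ f (k * h))]
  have : ∀ k : ℕ, ∫ s in ((k : ℝ) * h)..(((k + 1 : ℕ) : ℝ) * h),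
      l * Real.exp (l * s) * f (gridCeil h s)
      = f ((k + 1 : ℕ) * h) * (Real.exp (l * ((k + 1 : ℕ) * h)) - Real.exp (l * (k * h))) :=
    fun k ↦ by
      rw [intervalIntegral.integral_congr_ae (g := fun s ↦ l * Real.exp (l * s)
        * f ((k + 1 : ℕ) * h)), intervalIntegral.integral_mul_const, hval, mul_comm]
      rw [uIoc_of_le (hle k)]
      exact Eventually.of_forall fun s hs ↦ hInt k hs
  simp only [this]
  simp [hf0]

theorem IsCadlag.tendsto_sum_exp_mul_sub {f : ℝ≥0 → ℝ} (hf : IsCadlag f) (hf0 : f 0 = 0) (l : ℝ)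
    {T : ℝ≥0} (hT : 0 < T) :
    Tendsto (fun N : ℕ ↦ ∑ k ∈ Finset.range (2 ^ N), Real.exp (l * (k * (T / 2 ^ N : ℝ≥0)))
        * (f ((k + 1 : ℕ) * (T / 2 ^ N)) - f (k * (T / 2 ^ N)))) atTop
      (𝓝 (Real.exp (l * T) * f T - ∫ s in (0 : ℝ)..T, l * Real.exp (l * s) * f s.toNNReal)) := by
  have hh : ∀ N : ℕ, 0 < T / 2 ^ N := fun N ↦ by positivity
  have hmul : ∀ N : ℕ, ((2 ^ N : ℕ) : ℝ≥0) * (T / 2 ^ N) = T := fun N ↦ by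
    push_cast
    field_simp
  have hmul' : ∀ N : ℕ, ((2 ^ N : ℕ) : ℝ) * (T / 2 ^ N : ℝ≥0) = T := fun N ↦ by
    exact_mod_cast congrArg NNReal.toReal (hmul N)
  have h0 : Tendsto (fun N : ℕ ↦ T / 2 ^ N) atTop (𝓝 0) := by
    rw [← NNReal.tendsto_coe]
    push_cast
    exact tendsto_const_nhds.div_atTop (tendsto_pow_atTop_atTop_of_one_lt one_lt_two)
  have hle : ∀ N : ℕ, T / 2 ^ N ≤ T := fun N ↦ div_le_self T.2 (one_le_pow₀ one_le_two)
  simp only [sum_exp_mul_sub_eq hf0 l (hh _), hmul, hmul']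
  refine tendsto_const_nhds.sub ?_
  -- The grid point to the right of `s ≤ T` may exceed `T` by one mesh, which is at most `T`.
  obtain ⟨C, hC0, hC⟩ := hf.exists_abs_le (2 * T)
  refine intervalIntegral.tendsto_integral_filter_of_dominated_convergence
    (fun s ↦ |l * Real.exp (l * s)| * C) ?_ ?_ ?_ ?_
  · refine Eventually.of_forall fun N ↦ Measurable.aestronglyMeasurable ?_
    exact Measurable.mul (by fun_prop) (measurable_comp_gridCeil f _)
  · refine Eventually.of_forall fun N ↦ Eventually.of_forall fun s hs ↦ ?_
    rw [uIoc_of_le (NNReal.coe_nonneg T)] at hs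
    rw [norm_mul, Real.norm_eq_abs, Real.norm_eq_abs]
    gcongr
    refine hC _ ?_
    rw [← NNReal.coe_le_coe]
    refine (gridCeil_le (hh N) hs.1.le).trans ?_
    have h1 := hs.2
    have h2 : ((T / 2 ^ N : ℝ≥0) : ℝ) ≤ T := hle N
    push_cast at h2 ⊢
    linarith
  · exact Continuous.intervalIntegrable (by fun_prop) _ _
  · exact Eventually.of_forall fun s _ ↦ tendsto_const_nhds.mul (hf.tendsto_gridCeil hh h0 s)

/-- The factor `e^{lt}` turns the weights `e^{-l(t-s)}` into `e^{ls}`, which do not depend on `t`,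
increase, and start at `1`, as the summation bounds require. -/
theorem exp_mul_stochConv {Ω : Type*} (z : ℝ≥0 → Ω → ℝ) (l : ℝ) (t : ℝ≥0) (ω : Ω) :
    Real.exp (l * t) * stochConv z l t ω
      = Real.exp (l * t) * z t ω - ∫ s in (0 : ℝ)..t, l * Real.exp (l * s) * z s.toNNReal ω := by
  rw [stochConv, mul_sub, ← intervalIntegral.integral_const_mul,
    ← intervalIntegral.integral_const_mul]
  congr 2
  ext s
  have : Real.exp (l * s) = Real.exp (l * t) * Real.exp (-l * (t - s)) := by
    rw [← Real.exp_add]; ring_nf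
  rw [this]; ring

/-! ### Maximal inequality and moments -/

theorem measure_inter_eq_mul_of_disjoint {Ω : Type*} [MeasurableSpace Ω] {P : Measure Ω}
    {ξ : ℕ → Ω → ℝ} (hξ : ∀ k, Measurable (ξ k)) (hind : iIndepFun ξ P) {I J : Set ℕ}
    (hIJ : Disjoint I J) {A D : Set Ω}
    (hA : MeasurableSet[⨆ i ∈ I, MeasurableSpace.comap (ξ i) inferInstance] A)
    (hD : MeasurableSet[⨆ i ∈ J, MeasurableSpace.comap (ξ i) inferInstance] D) :
    P (A ∩ D) = P A * P D :=
  (Indep_iff _ _ _).1 (indep_iSup_of_disjoint (fun i ↦ (hξ i).comap_le) hind hIJ) A D hA hD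

theorem measurable_biSup_comap {Ω : Type*} {ξ : ℕ → Ω → ℝ} {I : Set ℕ} {i : ℕ} (hi : i ∈ I) :
    Measurable[⨆ i ∈ I, MeasurableSpace.comap (ξ i) inferInstance] (ξ i) :=
  measurable_iff_comap_le.2 (le_iSup₂_of_le i hi le_rfl)

theorem measurable_sum_biSup_comap {Ω : Type*} {ξ : ℕ → Ω → ℝ} {I : Set ℕ} {s : Finset ℕ}
    (hs : ∀ i ∈ s, i ∈ I) :
    Measurable[⨆ i ∈ I, MeasurableSpace.comap (ξ i) inferInstance] (fun ω ↦ ∑ i ∈ s, ξ i ω) :=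
  Finset.measurable_fun_sum s fun _ hi ↦ measurable_biSup_comap (hs _ hi)

/-- Ottaviani's inequality. -/
theorem measure_exists_lt_abs_sum_le {Ω : Type*} [MeasurableSpace Ω] {P : Measure Ω}
    {ξ : ℕ → Ω → ℝ} (hξ : ∀ k, Measurable (ξ k)) (hind : iIndepFun ξ P) {n : ℕ} {a : ℝ}
    (h : ∀ k ≤ n, 1 / 2 ≤ P {ω | |∑ i ∈ Finset.Ico k n, ξ i ω| ≤ a}) :
    P {ω | ∃ k ≤ n, 2 * a < |∑ i ∈ Finset.range k, ξ i ω|}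
      ≤ 2 * P {ω | a < |∑ i ∈ Finset.range n, ξ i ω|} := by
  set S : ℕ → Ω → ℝ := fun k ω ↦ ∑ i ∈ Finset.range k, ξ i ω with hS
  set R : ℕ → Ω → ℝ := fun k ω ↦ ∑ i ∈ Finset.Ico k n, ξ i ω with hR
  have hSm : ∀ k, Measurable (S k) := fun k ↦ Finset.measurable_fun_sum _ fun i _ ↦ hξ i
  have hRm : ∀ k, Measurable (R k) := fun k ↦ Finset.measurable_fun_sum _ fun i _ ↦ hξ i
  have hgt : MeasurableSet {x : ℝ | 2 * a < |x|} := measurableSet_lt measurable_const measurable_abs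
  have hlem : ∀ b, MeasurableSet {x : ℝ | |x| ≤ b} := fun b ↦
    measurableSet_le measurable_abs measurable_const
  -- `A k` is the event that the partial sums first exceed `2 * a` at index `k`. It is independent
  -- of the remainder `R k`, which is at most `a` with probability at least `1/2`; when both occur,
  -- the total sum exceeds `a`.
  set A : ℕ → Set Ω := fun k ↦ {ω | 2 * a < |S k ω|} ∩ ⋂ j ∈ Finset.range k, {ω | |S j ω| ≤ 2 * a}
    with hA
  have hAm : ∀ k, MeasurableSet[⨆ i ∈ Iio k, MeasurableSpace.comap (ξ i) inferInstance] (A k) := by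
    intro k
    have hSk : ∀ j ≤ k, Measurable[⨆ i ∈ Iio k, MeasurableSpace.comap (ξ i) inferInstance] (S j) :=
      fun j hj ↦ measurable_sum_biSup_comap fun i hi ↦ (Finset.mem_range.1 hi).trans_le hj
    refine MeasurableSet.inter (hSk k le_rfl hgt) ?_
    exact Finset.measurableSet_biInter _ fun j hj ↦ hSk j (Finset.mem_range.1 hj).le (hlem _)
  have hle : ∀ k : ℕ, (⨆ i ∈ Iio k, MeasurableSpace.comap (ξ i) inferInstance)
      ≤ (inferInstance : MeasurableSpace Ω) := fun k ↦ iSup₂_le fun i _ ↦ (hξ i).comap_le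
  have hdisj : ∀ i j, i < j → Disjoint (A i) (A j) := fun i j hij ↦ by
    refine Set.disjoint_left.2 fun ω h1 h2 ↦ ?_
    have := mem_iInter₂.1 h2.2 i (Finset.mem_range.2 hij)
    exact absurd (show 2 * a < |S i ω| from h1.1) (not_lt.2 this)
  have hpair : Pairwise (Function.onFun Disjoint A) := fun i j hij ↦ by
    rcases lt_or_gt_of_ne hij with h1 | h1
    · exact hdisj i j h1
    · exact (hdisj j i h1).symm
  have hsub : {ω | ∃ k ≤ n, 2 * a < |S k ω|} ⊆ ⋃ k ∈ Finset.range (n + 1), A k := by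
    rintro ω ⟨k, hk, hω⟩
    classical
    have hex : ∃ k, 2 * a < |S k ω| := ⟨k, hω⟩
    refine mem_iUnion₂.2 ⟨Nat.find hex, ?_, Nat.find_spec hex, ?_⟩
    · exact Finset.mem_range.2 (Nat.lt_succ_of_le ((Nat.find_min' hex hω).trans hk))
    · exact mem_iInter₂.2 fun j hj ↦ not_lt.1 (Nat.find_min hex (Finset.mem_range.1 hj))
  have hprod : ∀ k ≤ n, P (A k) ≤ 2 * P (A k ∩ {ω | |R k ω| ≤ a}) := fun k hk ↦ by
    rw [measure_inter_eq_mul_of_disjoint hξ hind (I := Iio k) (J := Ici k)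
      (D := {ω | |R k ω| ≤ a})
      (Set.disjoint_left.2 fun i h1 h2 ↦ absurd (mem_Iio.1 h1) (not_lt.2 h2)) (hAm k)
      ((measurable_sum_biSup_comap fun i hi ↦ (Finset.mem_Ico.1 hi).1) (hlem a))]
    calc P (A k) = 2 * (P (A k) * (1 / 2)) := by
          rw [mul_left_comm, one_div, ENNReal.mul_inv_cancel two_ne_zero ENNReal.ofNat_ne_top,
            mul_one]
      _ ≤ _ := by gcongr; exact h k hk
  calc P {ω | ∃ k ≤ n, 2 * a < |S k ω|} ≤ P (⋃ k ∈ Finset.range (n + 1), A k) := measure_mono hsub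
    _ ≤ ∑ k ∈ Finset.range (n + 1), P (A k) := measure_biUnion_finset_le _ _
    _ ≤ ∑ k ∈ Finset.range (n + 1), 2 * P (A k ∩ {ω | |R k ω| ≤ a}) :=
      Finset.sum_le_sum fun k hk ↦ hprod k (Nat.lt_succ_iff.1 (Finset.mem_range.1 hk))
    _ = 2 * P (⋃ k ∈ Finset.range (n + 1), (A k ∩ {ω | |R k ω| ≤ a})) := by
      rw [measure_biUnion_finset, Finset.mul_sum]
      · exact fun i _ j _ hij ↦ (hpair hij).mono inter_subset_left inter_subset_left
      · exact fun k _ ↦ (hle k _ (hAm k)).inter (measurableSet_le (hRm k).abs measurable_const)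
    _ ≤ 2 * P {ω | a < |S n ω|} := by
      gcongr
      refine iUnion₂_subset fun k hk ω hω ↦ ?_
      have hsum : S n ω = S k ω + R k ω :=
        (Finset.sum_range_add_sum_Ico _ (Nat.lt_succ_iff.1 (Finset.mem_range.1 hk))).symm
      have h1 : 2 * a < |S k ω| := hω.1.1
      have h2 : |R k ω| ≤ a := hω.2
      have h3 : |S k ω| ≤ |S n ω| + |R k ω| := by
        have : S k ω = S n ω - R k ω := by rw [hsum]; ring
        rw [this]
        exact abs_sub _ _
      show a < |S n ω|
      linarith

/-- Layer cake formula for both functions. Below `a₀`, where no comparison is assumed, the tail is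
at most the total mass, and this part is controlled by the `q`-th moment of the constant `a₀`. -/
theorem lintegral_rpow_lt_top_of_tail {α β : Type*} [MeasurableSpace α] [MeasurableSpace β]
    {μ : Measure α} [IsFiniteMeasure μ] {μ' : Measure β} {f : α → ℝ≥0∞} {g : β → ℝ≥0∞}
    (hf : Measurable f) (hg : Measurable g) (hf' : ∀ x, f x ≠ ∞) (hg' : ∀ x, g x ≠ ∞) {c a₀ q : ℝ}
    (hc : 0 < c) (ha₀ : 0 ≤ a₀) (hq : 0 < q) {C : ℝ≥0∞} (hC : C ≠ ∞)
    (h : ∀ a, 0 < a → a₀ ≤ a → μ {x | ENNReal.ofReal (c * a) < f x} ≤ C * μ' {x | ENNReal.ofReal a ≤ g x})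
    (hInt : ∫⁻ x, g x ^ q ∂μ' < ∞) : ∫⁻ x, f x ^ q ∂μ < ∞ := by
  have hrw : ∀ x, f x ^ q = ENNReal.ofReal (c ^ q) * ENNReal.ofReal (((f x).toReal / c) ^ q) :=
    fun x ↦ by
      rw [← ENNReal.ofReal_mul (by positivity), ← Real.mul_rpow hc.le (by positivity),
        mul_div_cancel₀ _ hc.ne', ← ENNReal.ofReal_rpow_of_nonneg (by positivity) hq.le,
        ENNReal.ofReal_toReal (hf' x)]
  have hrwg : ∀ x, g x ^ q = ENNReal.ofReal ((g x).toReal ^ q) := fun x ↦ by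
    rw [← ENNReal.ofReal_rpow_of_nonneg (by positivity) hq.le, ENNReal.ofReal_toReal (hg' x)]
  simp only [hrw]
  simp only [hrwg] at hInt
  rw [lintegral_const_mul _ (by fun_prop)]
  refine ENNReal.mul_lt_top ENNReal.ofReal_lt_top ?_
  have hconst : ∫⁻ _, ENNReal.ofReal (a₀ ^ q) ∂μ < ∞ := by
    rw [lintegral_const]
    exact ENNReal.mul_lt_top ENNReal.ofReal_lt_top (measure_lt_top _ _)
  rw [lintegral_rpow_eq_lintegral_meas_lt_mul μ (Eventually.of_forall fun _ ↦ ha₀)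
    aemeasurable_const hq] at hconst
  rw [lintegral_rpow_eq_lintegral_meas_le_mul μ' (Eventually.of_forall fun _ ↦ by positivity)
    (by fun_prop) hq] at hInt
  rw [lintegral_rpow_eq_lintegral_meas_lt_mul μ (Eventually.of_forall fun _ ↦ by positivity)
    (by fun_prop) hq]
  have hq0 : ENNReal.ofReal q ≠ 0 := by simpa using hq
  refine ENNReal.mul_lt_top ENNReal.ofReal_lt_top ?_
  replace hconst := ENNReal.lt_top_of_mul_ne_top_right hconst.ne hq0
  replace hInt := ENNReal.lt_top_of_mul_ne_top_right hInt.ne hq0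
  calc ∫⁻ t in Ioi 0, μ {x | t < (f x).toReal / c} * ENNReal.ofReal (t ^ (q - 1))
      ≤ ∫⁻ t in Ioi 0, (C * (μ' {x | t ≤ (g x).toReal} * ENNReal.ofReal (t ^ (q - 1)))
        + μ {_x | t < a₀} * ENNReal.ofReal (t ^ (q - 1))) := by
        refine setLIntegral_mono' measurableSet_Ioi fun t ht ↦ ?_
        rw [← mul_assoc, ← add_mul]
        gcongr
        rcases lt_or_ge t a₀ with hta | hta
        · simp only [hta, ofPred_true]
          exact (measure_mono (subset_univ _)).trans le_add_self
        · refine le_add_right (le_trans (le_of_eq ?_) ((h t ht hta).trans (le_of_eq ?_)))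
          · congr 1
            ext x
            simp only [mem_ofPred_eq]
            rw [ENNReal.ofReal_lt_iff_lt_toReal (by have := mem_Ioi.1 ht; positivity) (hf' x),
              lt_div_iff₀ hc, mul_comm]
          · congr 2
            ext x
            simp only [mem_ofPred_eq]
            rw [ENNReal.ofReal_le_iff_le_toReal (hg' x)]
    _ = C * (∫⁻ t in Ioi 0, μ' {x | t ≤ (g x).toReal} * ENNReal.ofReal (t ^ (q - 1)))
        + ∫⁻ t in Ioi 0, μ {_x | t < a₀} * ENNReal.ofReal (t ^ (q - 1)) := by
        rw [lintegral_add_right, lintegral_const_mul' _ _ hC]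
        refine Measurable.mul (Antitone.measurable fun s t hst ↦ measure_mono fun x hx ↦ ?_)
          (by fun_prop)
        exact lt_of_le_of_lt hst hx
    _ < ∞ := ENNReal.add_lt_top.2 ⟨ENNReal.mul_lt_top hC.lt_top hInt, hconst⟩


/-! ### Small-time asymptotics of a Lévy process -/

theorem IsLevyMeasure.measure_lt_top {ν : Measure ℝ} (hν : IsLevyMeasure ν) {a : ℝ} (ha : 0 < a) :
    ν {y | a ≤ |y|} < ∞ := by
  have hsub : {y : ℝ | a ≤ |y|} ⊆
      {y | ENNReal.ofReal (min 1 (a ^ 2)) ≤ ENNReal.ofReal (min 1 (y ^ 2))} := fun y hy ↦ by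
    refine ENNReal.ofReal_le_ofReal (min_le_min le_rfl ?_)
    rw [← sq_abs y]
    exact pow_le_pow_left₀ ha.le hy 2
  refine (measure_mono hsub).trans_lt ?_
  refine (meas_ge_le_lintegral_div (by fun_prop) ?_ ENNReal.ofReal_ne_top).trans_lt
    (ENNReal.div_lt_top hν.lintegral_lt_top.ne ?_)
  all_goals
    simp only [ne_eq, ENNReal.ofReal_eq_zero, not_le]
    positivity

/-- Required by Fubini's theorem, as `ν` may be infinite near `0`. -/
theorem IsLevyMeasure.sigmaFinite {ν : Measure ℝ} (hν : IsLevyMeasure ν) : SigmaFinite ν := by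
  refine ⟨⟨fun n : ℕ ↦ {0} ∪ {y : ℝ | 1 / ((n : ℝ) + 1) ≤ |y|}, fun _ ↦ trivial, fun n ↦ ?_, ?_⟩⟩
  · refine (measure_union_le _ _).trans_lt ?_
    rw [hν.zero, zero_add]
    exact hν.measure_lt_top (by positivity)
  · refine eq_univ_of_forall fun y ↦ mem_iUnion.2 ?_
    rcases eq_or_ne y 0 with rfl | hy
    · exact ⟨0, Or.inl rfl⟩
    · obtain ⟨n, hn⟩ := exists_nat_one_div_lt (abs_pos.2 hy)
      exact ⟨n, Or.inr hn.le⟩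

theorem IsLevyMeasure.integrable {ν : Measure ℝ} (hν : IsLevyMeasure ν) :
    Integrable (fun y : ℝ ↦ min 1 (y ^ 2)) ν := by
  refine ⟨by fun_prop, ?_⟩
  rw [hasFiniteIntegral_iff_ofReal (Eventually.of_forall fun y ↦ by positivity)]
  exact hν.lintegral_lt_top

/-- The integrand of the symbol of a Lévy process. -/
noncomputable def symbolKernel (ξ y : ℝ) : ℂ :=
  Complex.exp (ξ * y * Complex.I) - 1 - (if |y| ≤ 1 then (ξ * y * Complex.I : ℂ) else 0)

theorem levySymbol_eq (ν : Measure ℝ) (ξ : ℝ) : levySymbol ν ξ = ∫ y, symbolKernel ξ y ∂ν := rfl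

/-- For `|y| ≤ 1` this is a second-order Taylor bound if `|ξ y| ≤ 1`, and `2 + |ξ y| ≤ 3 |ξ y|²`
otherwise; for `|y| > 1` the kernel is at most `2`. The product form makes the kernel, multiplied by
a rapidly decreasing function of `ξ`, integrable in both variables. -/
theorem norm_symbolKernel_le (ξ y : ℝ) : ‖symbolKernel ξ y‖ ≤ (2 + 3 * ξ ^ 2) * min 1 (y ^ 2) := by
  have hexp : ‖Complex.exp (ξ * y * Complex.I)‖ = 1 := by
    have := Complex.norm_exp_ofReal_mul_I (ξ * y)
    push_cast at this
    exact this
  have htwo : ‖Complex.exp (ξ * y * Complex.I) - 1‖ ≤ 2 := by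
    refine (norm_sub_le _ _).trans ?_
    rw [hexp, norm_one]; norm_num
  rw [symbolKernel]
  split_ifs with hy
  · have hmin : min 1 (y ^ 2) = y ^ 2 := by
      refine min_eq_right ?_
      rw [← sq_abs]
      exact pow_le_one₀ (abs_nonneg _) hy
    have hn : ‖(ξ * y * Complex.I : ℂ)‖ = |ξ * y| := by simp [abs_mul]
    rw [hmin]
    rcases le_or_gt |ξ * y| 1 with h1 | h1
    · refine (Complex.norm_exp_sub_one_sub_id_le (by rwa [hn])).trans ?_
      rw [hn, sq_abs]
      nlinarith [mul_nonneg (sq_nonneg ξ) (sq_nonneg y), sq_nonneg y]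
    · refine (norm_sub_le _ _).trans ?_
      rw [hn]
      have h2 : |ξ * y| ^ 2 = ξ ^ 2 * y ^ 2 := by rw [sq_abs]; ring
      nlinarith [sq_nonneg y]
  · have hmin : min 1 (y ^ 2) = 1 := by
      refine min_eq_left ?_
      rw [← sq_abs]
      exact one_le_pow₀ (not_le.1 hy).le
    rw [hmin, sub_zero]
    nlinarith [sq_nonneg ξ]

theorem measurable_symbolKernel (c : ℝ) :
    Measurable fun v : ℝ × ℝ ↦ symbolKernel (c * v.1) v.2 := by
  unfold symbolKernel
  refine Measurable.sub (by fun_prop) (Measurable.ite ?_ (by fun_prop) measurable_const)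
  exact measurableSet_le (by fun_prop) measurable_const

theorem norm_levySymbol_le {ν : Measure ℝ} (hν : IsLevyMeasure ν) (ξ : ℝ) :
    ‖levySymbol ν ξ‖ ≤ (2 + 3 * ξ ^ 2) * ∫ y, min 1 (y ^ 2) ∂ν := by
  rw [← integral_const_mul]
  exact norm_integral_le_of_norm_le (hν.integrable.const_mul _)
    (Eventually.of_forall (norm_symbolKernel_le ξ))

/-- Mean value inequality on the left half-plane, which is convex and on which the derivative of
`exp` has modulus at most `1`. -/
theorem norm_exp_sub_one_le_of_re_nonpos {w : ℂ} (hw : w.re ≤ 0) : ‖Complex.exp w - 1‖ ≤ ‖w‖ := by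
  have hconv : Convex ℝ {w : ℂ | w.re ≤ 0} := convex_halfSpace_re_le 0
  have := hconv.norm_image_sub_le_of_norm_hasDerivWithin_le (f := Complex.exp) (f' := Complex.exp)
    (C := 1) (x := 0) (y := w) (fun x _ ↦ (Complex.hasDerivAt_exp x).hasDerivWithinAt)
    (fun x hx ↦ by
      rw [Complex.norm_exp]
      exact Real.exp_le_one_iff.2 hx) (by simp) hw
  simpa using this

/-! ### Small-time limits by Fourier inversion -/

section Fourier

open scoped FourierTransform SchwartzMap

theorem schwartz_eq_integral (f : 𝓢(ℝ, ℂ)) (y : ℝ) :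
    f y = ∫ ξ : ℝ, Complex.exp ((2 * Real.pi * ξ : ℝ) * y * Complex.I) * (𝓕 f) ξ := by
  have h : (𝓕⁻ (𝓕 f)) y = f y := by rw [FourierTransform.fourierInv_fourier_eq]
  rw [← h, SchwartzMap.fourierInv_coe, Real.fourierInv_eq']
  congr 1
  ext ξ
  simp only [smul_eq_mul]
  congr 3
  simp
  ring

theorem schwartz_deriv_zero_eq_integral (f : 𝓢(ℝ, ℂ)) :
    deriv f 0 = ∫ ξ : ℝ, ((2 * Real.pi * ξ : ℝ) * Complex.I) * (𝓕 f) ξ := by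
  have h := schwartz_eq_integral (SchwartzMap.derivCLM ℝ ℂ f) 0
  rw [SchwartzMap.derivCLM_apply] at h
  rw [h]
  congr 1
  ext ξ
  have h1 : (𝓕 (SchwartzMap.derivCLM ℝ ℂ f)) ξ = 𝓕 (deriv f) ξ := by
    rw [SchwartzMap.fourier_coe]
    congr 1
  have h2 := Real.fourier_deriv f.integrable f.differentiable
    (SchwartzMap.derivCLM ℝ ℂ f).integrable
  rw [h1, h2, SchwartzMap.fourier_coe]
  simp
  left
  ring

theorem integrable_schwartz_mul_sq (g : 𝓢(ℝ, ℂ)) :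
    Integrable fun ξ : ℝ ↦ (2 + 3 * (2 * Real.pi * ξ) ^ 2) * ‖g ξ‖ := by
  have h0 := (g.integrable_pow_mul volume 0).const_mul 2
  have h2 := (g.integrable_pow_mul volume 2).const_mul (3 * (2 * Real.pi) ^ 2)
  refine (h0.add h2).congr (Eventually.of_forall fun ξ ↦ ?_)
  simp
  ring

/-- Inversion applied to the three terms of the kernel gives `f y`, `f 0` and a multiple of `deriv f
0`; the last two vanish. -/
theorem integral_schwartz_mul_symbolKernel (f : 𝓢(ℝ, ℂ)) (hf0 : f 0 = 0) (hf1 : deriv f 0 = 0)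
    (y : ℝ) : ∫ ξ : ℝ, symbolKernel (2 * Real.pi * ξ) y * (𝓕 f) ξ = f y := by
  have hg := (𝓕 f).integrable (μ := volume)
  have he : Integrable fun ξ : ℝ ↦
      Complex.exp ((2 * Real.pi * ξ : ℝ) * y * Complex.I) * (𝓕 f) ξ := by
    refine hg.bdd_mul (c := 1) (by fun_prop) (Eventually.of_forall fun ξ ↦ ?_)
    have := Complex.norm_exp_ofReal_mul_I (2 * Real.pi * ξ * y)
    push_cast at this ⊢
    exact this.le
  have h1 : ∫ ξ : ℝ, (𝓕 f) ξ = 0 := by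
    have := schwartz_eq_integral f 0
    rw [hf0] at this
    simpa using this.symm
  have h2 := schwartz_deriv_zero_eq_integral f
  rw [hf1] at h2
  have hlin : Integrable fun ξ : ℝ ↦ ((2 * Real.pi * ξ : ℝ) * Complex.I) * (𝓕 f) ξ := by
    refine (((𝓕 f).integrable_pow_mul volume 1).const_mul (2 * Real.pi)).mono' (by fun_prop)
      (Eventually.of_forall fun ξ ↦ le_of_eq ?_)
    simp [abs_of_pos Real.pi_pos]
    ring
  have hsplit : ∀ ξ : ℝ, symbolKernel (2 * Real.pi * ξ) y * (𝓕 f) ξ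
      = Complex.exp ((2 * Real.pi * ξ : ℝ) * y * Complex.I) * (𝓕 f) ξ - (𝓕 f) ξ
        - (if |y| ≤ 1 then (y : ℂ) else 0) * (((2 * Real.pi * ξ : ℝ) * Complex.I) * (𝓕 f) ξ) :=
    fun ξ ↦ by
      rw [symbolKernel]
      split_ifs <;> ring
  simp only [hsplit]
  have heg : Integrable fun ξ : ℝ ↦
      Complex.exp ((2 * Real.pi * ξ : ℝ) * y * Complex.I) * (𝓕 f) ξ - (𝓕 f) ξ := he.sub hg
  rw [integral_sub heg (hlin.const_mul _), integral_sub he hg, integral_const_mul, ← h2, h1,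
    ← schwartz_eq_integral]
  simp

theorem integral_levySymbol_mul {ν : Measure ℝ} (hν : IsLevyMeasure ν) {g : ℝ → ℂ}
    (hg : Measurable g)
    (hgi : Integrable fun ξ : ℝ ↦ (2 + 3 * (2 * Real.pi * ξ) ^ 2) * ‖g ξ‖) :
    ∫ ξ : ℝ, levySymbol ν (2 * Real.pi * ξ) * g ξ
      = ∫ y, (∫ ξ : ℝ, symbolKernel (2 * Real.pi * ξ) y * g ξ) ∂ν := by
  have := hν.sigmaFinite
  have hk := measurable_symbolKernel (2 * Real.pi)
  have hInt : Integrable (Function.uncurry fun ξ y : ℝ ↦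
      symbolKernel (2 * Real.pi * ξ) y * g ξ) (volume.prod ν) := by
    refine (hgi.mul_prod hν.integrable).mono'
      (hk.mul (hg.comp measurable_fst)).aestronglyMeasurable (Eventually.of_forall fun v ↦ ?_)
    simp only [Function.uncurry, norm_mul]
    refine (mul_le_mul_of_nonneg_right (norm_symbolKernel_le _ _) (norm_nonneg _)).trans
      (le_of_eq (by ring))
  rw [← integral_integral_swap hInt]
  simp only [integral_mul_const, levySymbol_eq]

theorem integral_schwartz_mul_levySymbol {ν : Measure ℝ} (hν : IsLevyMeasure ν) (f : 𝓢(ℝ, ℂ))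
    (hf0 : f 0 = 0) (hf1 : deriv f 0 = 0) :
    ∫ ξ : ℝ, levySymbol ν (2 * Real.pi * ξ) * (𝓕 f) ξ = ∫ y, f y ∂ν := by
  rw [integral_levySymbol_mul hν (𝓕 f).continuous.measurable (integrable_schwartz_mul_sq (𝓕 f))]
  simp only [integral_schwartz_mul_symbolKernel f hf0 hf1]

variable {Ω : Type*} [MeasurableSpace Ω] {P : Measure Ω} [IsProbabilityMeasure P]
  {z : ℝ≥0 → Ω → ℝ} {ν : Measure ℝ}

theorem IsPureJumpLevy.re_mul_levySymbol_nonpos (hz : IsPureJumpLevy P z ν) (t : ℝ≥0) (ξ : ℝ) :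
    (t * levySymbol ν ξ).re ≤ 0 := by
  have : IsProbabilityMeasure (P.map (z t)) :=
    Measure.isProbabilityMeasure_map (hz.measurable t).aemeasurable
  have h := norm_charFun_le_one (μ := P.map (z t)) ξ
  rw [hz.charFun_eq, Complex.norm_exp] at h
  exact Real.exp_le_one_iff.1 h

theorem IsPureJumpLevy.integral_schwartz_eq (hz : IsPureJumpLevy P z ν) (f : 𝓢(ℝ, ℂ)) (t : ℝ≥0) :
    ∫ ω, f (z t ω) ∂P
      = ∫ ξ : ℝ, Complex.exp (t * levySymbol ν (2 * Real.pi * ξ)) * (𝓕 f) ξ := by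
  have hprob : IsProbabilityMeasure (P.map (z t)) :=
    Measure.isProbabilityMeasure_map (hz.measurable t).aemeasurable
  rw [← integral_map (hz.measurable t).aemeasurable (f := f) f.continuous.aestronglyMeasurable]
  have hInt : Integrable (Function.uncurry fun y ξ : ℝ ↦
      Complex.exp ((2 * Real.pi * ξ : ℝ) * y * Complex.I) * (𝓕 f) ξ)
      ((P.map (z t)).prod volume) := by
    have hg := (integrable_const (μ := P.map (z t)) (1 : ℝ)).mul_prod
      ((𝓕 f).integrable (μ := volume)).norm
    refine hg.mono' (Continuous.aestronglyMeasurable (by fun_prop))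
      (Eventually.of_forall fun v ↦ le_of_eq ?_)
    simp only [Function.uncurry, norm_mul, one_mul]
    have := Complex.norm_exp_ofReal_mul_I (2 * Real.pi * v.2 * v.1)
    push_cast at this ⊢
    rw [this, one_mul]
  simp_rw [schwartz_eq_integral f]
  rw [integral_integral_swap hInt]
  congr 1
  ext ξ
  rw [integral_mul_const, ← charFun_apply_real, hz.charFun_eq]

/-- The expectation is `∫ e^{tψ} 𝓕 f`, and `∫ 𝓕 f = f 0 = 0` allows replacing `e^{tψ}` by `e^{tψ} -
1`. After division by `t` this tends to `ψ`, dominated by `|ψ|`, which grows at most quadratically.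
-/
theorem IsPureJumpLevy.tendsto_integral_schwartz (hz : IsPureJumpLevy P z ν) (f : 𝓢(ℝ, ℂ))
    (hf0 : f 0 = 0) (hf1 : deriv f 0 = 0) {t : ℕ → ℝ≥0} (ht : ∀ n, 0 < t n)
    (ht0 : Tendsto t atTop (𝓝 0)) :
    Tendsto (fun n ↦ ((t n : ℝ) : ℂ)⁻¹ * ∫ ω, f (z (t n) ω) ∂P) atTop (𝓝 (∫ y, f y ∂ν)) := by
  set ψ : ℝ → ℂ := fun ξ ↦ levySymbol ν (2 * Real.pi * ξ) with hψ
  have hmeas : ∀ s : ℝ≥0, Measurable fun ξ ↦ Complex.exp (s * ψ ξ) := fun s ↦ by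
    have hprob : IsProbabilityMeasure (P.map (z s)) :=
      Measure.isProbabilityMeasure_map (hz.measurable s).aemeasurable
    simp only [hψ, ← hz.charFun_eq]
    exact measurable_charFun.comp (by fun_prop)
  have hbd : ∀ (s : ℝ≥0) ξ, ‖Complex.exp (s * ψ ξ) - 1‖ ≤ s * ‖ψ ξ‖ := fun s ξ ↦ by
    refine (norm_exp_sub_one_le_of_re_nonpos (hz.re_mul_levySymbol_nonpos s _)).trans (le_of_eq ?_)
    simp [hψ]
  set C := ∫ y, min 1 (y ^ 2) ∂ν with hC
  have hg := (𝓕 f).integrable (μ := volume)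
  have h1 : ∫ ξ : ℝ, (𝓕 f) ξ = 0 := by
    have := schwartz_eq_integral f 0
    rw [hf0] at this
    simpa using this.symm
  have heq : ∀ n, ((t n : ℝ) : ℂ)⁻¹ * ∫ ω, f (z (t n) ω) ∂P
      = ∫ ξ, ((t n : ℝ) : ℂ)⁻¹ * (Complex.exp (t n * ψ ξ) - 1) * (𝓕 f) ξ := fun n ↦ by
    have he : Integrable fun ξ : ℝ ↦ Complex.exp (t n * ψ ξ) * (𝓕 f) ξ := by
      refine hg.bdd_mul (c := 1) (hmeas _).aestronglyMeasurable (Eventually.of_forall fun ξ ↦ ?_)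
      rw [Complex.norm_exp]
      exact Real.exp_le_one_iff.2 (hz.re_mul_levySymbol_nonpos _ _)
    have hsplit : ∀ ξ, ((t n : ℝ) : ℂ)⁻¹ * (Complex.exp (t n * ψ ξ) - 1) * (𝓕 f) ξ
        = ((t n : ℝ) : ℂ)⁻¹ * (Complex.exp (t n * ψ ξ) * (𝓕 f) ξ - (𝓕 f) ξ) := fun ξ ↦ by ring
    simp only [hsplit]
    rw [integral_const_mul, integral_sub he hg, h1, sub_zero, hz.integral_schwartz_eq]
  simp only [heq]
  rw [← integral_schwartz_mul_levySymbol hz.levyMeasure f hf0 hf1]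
  refine tendsto_integral_of_dominated_convergence
    (fun ξ ↦ C * ((2 + 3 * (2 * Real.pi * ξ) ^ 2) * ‖(𝓕 f) ξ‖)) ?_ ?_ ?_ ?_
  · intro n
    exact ((((hmeas _).sub_const _).const_mul _).mul (𝓕 f).continuous.measurable)
      |>.aestronglyMeasurable
  · exact (integrable_schwartz_mul_sq (𝓕 f)).const_mul C
  · intro n
    refine Eventually.of_forall fun ξ ↦ ?_
    rw [norm_mul, norm_mul, ← mul_assoc]
    refine mul_le_mul_of_nonneg_right ?_ (norm_nonneg _)
    have h0 : (0 : ℝ) < t n := ht n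
    have hn : ‖((t n : ℝ) : ℂ)⁻¹‖ = (t n : ℝ)⁻¹ := by simp
    rw [hn, inv_mul_le_iff₀ h0]
    refine (hbd _ _).trans ?_
    gcongr
    rw [mul_comm C]
    exact norm_levySymbol_le hz.levyMeasure _
  · refine Eventually.of_forall fun ξ ↦ Tendsto.mul ?_ tendsto_const_nhds
    have hd : HasDerivAt (fun s : ℂ ↦ Complex.exp (s * ψ ξ)) (ψ ξ) 0 := by
      have := ((hasDerivAt_id (0 : ℂ)).mul_const (ψ ξ)).cexp
      simpa using this
    have hs := hasDerivAt_iff_tendsto_slope_zero.1 hd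
    have htc : Tendsto (fun n ↦ ((t n : ℝ) : ℂ)) atTop (𝓝[≠] 0) := by
      refine tendsto_nhdsWithin_iff.2 ⟨?_, Eventually.of_forall fun n ↦ ?_⟩
      · have := (Complex.continuous_ofReal.tendsto 0).comp (NNReal.tendsto_coe.2 ht0)
        simpa [Function.comp_def] using this
      · simpa using (ht n).ne'
    have := hs.comp htc
    simpa [Function.comp_def] using this

/-- The bump function is `1` on the ball and vanishes on `[-a, a]`, so it lies between the two
indicators. Since its small-time limit exists, a bound that holds infinitely often suffices. -/
theorem IsPureJumpLevy.measure_closedBall_le (hz : IsPureJumpLevy P z ν) {a : ℝ} (ha : 0 < a)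
    {c : ℝ} (b : ContDiffBump c) (hb : a + b.rOut < |c|) {t : ℕ → ℝ≥0} (ht : ∀ n, 0 < t n)
    (ht0 : Tendsto t atTop (𝓝 0)) {C : ℝ}
    (h : ∃ᶠ n in atTop, P.real {ω | a < |z (t n) ω|} ≤ C * t n) :
    ν (Metric.closedBall c b.rIn) ≤ ENNReal.ofReal C := by
  have hzero : ∀ y, |y| ≤ a → b y = 0 := fun y hy ↦ b.zero_of_le_dist (by
    rw [Real.dist_eq]
    have := abs_sub_abs_le_abs_sub c y
    rw [abs_sub_comm]
    linarith)
  set f : 𝓢(ℝ, ℂ) := (b.hasCompactSupport.comp_left (g := ((↑) : ℝ → ℂ))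
    Complex.ofReal_zero).toSchwartzMap (Complex.ofRealCLM.contDiff.comp b.contDiff) with hf
  have hfb : ∀ y, f y = (b y : ℂ) := fun y ↦ rfl
  have hf0 : f 0 = 0 := by rw [hfb, hzero 0 (by simpa using ha.le), Complex.ofReal_zero]
  have hf1 : deriv f 0 = 0 := by
    have : f =ᶠ[𝓝 0] fun _ ↦ (0 : ℂ) := by
      filter_upwards [Metric.closedBall_mem_nhds (0 : ℝ) ha] with y hy
      rw [hfb, hzero y (by simpa [Real.dist_eq] using hy), Complex.ofReal_zero]
    rw [this.deriv_eq, deriv_const]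
  have hlim := hz.tendsto_integral_schwartz f hf0 hf1 ht ht0
  simp only [hfb, integral_complex_ofReal] at hlim
  have hlim' := (Complex.continuous_re.tendsto _).comp hlim
  have hre : ∀ n, (((t n : ℝ) : ℂ)⁻¹ * ((∫ ω, b (z (t n) ω) ∂P : ℝ) : ℂ)).re
      = (t n : ℝ)⁻¹ * ∫ ω, b (z (t n) ω) ∂P := fun n ↦ by
    rw [← Complex.ofReal_inv, ← Complex.ofReal_mul, Complex.ofReal_re]
  simp only [Function.comp_def, hre, Complex.ofReal_re] at hlim'
  have hle : ∫ y, b y ∂ν ≤ C := by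
    refine le_of_tendsto_of_frequently hlim' (h.mono fun n hn ↦ ?_)
    have h0 : (0 : ℝ) < t n := ht n
    rw [inv_mul_le_iff₀ h0, mul_comm]
    refine le_trans ?_ hn
    have hms : MeasurableSet {ω | a < |z (t n) ω|} :=
      measurableSet_lt measurable_const (hz.measurable _).abs
    rw [← integral_indicator_one hms]
    refine integral_mono_of_nonneg (Eventually.of_forall fun ω ↦ b.nonneg)
      ((integrable_const (1 : ℝ)).indicator hms) (Eventually.of_forall fun ω ↦ ?_)
    by_cases hω : a < |z (t n) ω|
    · simp only [indicator_of_mem (show ω ∈ {ω | a < |z (t n) ω|} from hω)]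
      exact b.le_one
    · simp only [hzero _ (not_lt.1 hω)]
      exact indicator_nonneg (fun _ _ ↦ zero_le_one) _
  have hInt : Integrable b ν := by
    have hfin := hz.levyMeasure.measure_lt_top ha
    have hi : Integrable ({y : ℝ | a ≤ |y|}.indicator fun _ ↦ (1 : ℝ)) ν :=
      (integrable_indicator_iff (measurableSet_le measurable_const measurable_abs)).2
        (integrableOn_const hfin.ne)
    refine hi.mono' b.continuous.aestronglyMeasurable (Eventually.of_forall fun y ↦ ?_)
    rw [Real.norm_eq_abs, abs_of_nonneg b.nonneg]
    by_cases hy : a ≤ |y|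
    · rw [indicator_of_mem (show y ∈ {y | a ≤ |y|} from hy)]
      exact b.le_one
    · rw [hzero y (not_le.1 hy).le]
      exact indicator_nonneg (fun _ _ ↦ zero_le_one) _
  calc ν (Metric.closedBall c b.rIn)
      = ∫⁻ y, (Metric.closedBall c b.rIn).indicator 1 y ∂ν := by
        rw [lintegral_indicator_one Metric.isClosed_closedBall.measurableSet]
    _ ≤ ∫⁻ y, ENNReal.ofReal (b y) ∂ν := by
        refine lintegral_mono fun y ↦ ?_
        by_cases hy : y ∈ Metric.closedBall c b.rIn
        · rw [indicator_of_mem hy, b.one_of_mem_closedBall hy]; simp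
        · rw [indicator_of_notMem hy]; exact zero_le
    _ = ENNReal.ofReal (∫ y, b y ∂ν) :=
        (ofReal_integral_eq_lintegral_ofReal hInt (Eventually.of_forall fun _ ↦ b.nonneg)).symm
    _ ≤ ENNReal.ofReal C := ENNReal.ofReal_le_ofReal hle

/-- The tail of the Lévy measure is bounded through the small-time tails of the process. -/
theorem IsPureJumpLevy.measure_tail_le (hz : IsPureJumpLevy P z ν) {a : ℝ} (ha : 0 < a)
    {t : ℕ → ℝ≥0} (ht : ∀ n, 0 < t n) (ht0 : Tendsto t atTop (𝓝 0)) {C : ℝ}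
    (h : ∃ᶠ n in atTop, P.real {ω | a < |z (t n) ω|} ≤ C * t n) :
    ν {y | a < |y|} ≤ 2 * ENNReal.ofReal C := by
  have key : ∀ u r : ℝ, 0 < r → a < u → ν (Metric.closedBall (u + r) r) ≤ ENNReal.ofReal C ∧
      ν (Metric.closedBall (-(u + r)) r) ≤ ENNReal.ofReal C := fun u r hr hu ↦ by
    have hout : r < r + (u - a) / 2 := by linarith
    have hpos : 0 < u + r := by linarith
    refine ⟨hz.measure_closedBall_le ha (c := u + r) ⟨r, r + (u - a) / 2, hr, hout⟩ ?_ ht ht0 h,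
      hz.measure_closedBall_le ha (c := -(u + r)) ⟨r, r + (u - a) / 2, hr, hout⟩ ?_ ht ht0 h⟩
    · simp only [abs_of_pos hpos]; linarith
    · simp only [abs_neg, abs_of_pos hpos]; linarith
  -- These shells exhaust the tail, and each is covered by two balls, one on either side of `0`;
  -- this is the factor `2`.
  set s : ℕ → Set ℝ := fun n ↦ {y | a + 1 / ((n : ℝ) + 1) ≤ |y| ∧ |y| ≤ n} with hs
  have hmono : Monotone s := fun m n hmn y hy ↦ by
    refine ⟨le_trans ?_ hy.1, hy.2.trans (by exact_mod_cast hmn)⟩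
    have : (m : ℝ) ≤ n := by exact_mod_cast hmn
    gcongr
  have hunion : {y : ℝ | a < |y|} = ⋃ n, s n := by
    ext y
    simp only [mem_iUnion]
    refine ⟨fun hy ↦ ?_, fun ⟨n, hn⟩ ↦ lt_of_lt_of_le ?_ hn.1⟩
    · obtain ⟨n, hn⟩ := exists_nat_one_div_lt (show 0 < |y| - a from sub_pos.2 hy)
      obtain ⟨m, hm⟩ := exists_nat_ge |y|
      refine ⟨max n m, ?_, hm.trans (by exact_mod_cast le_max_right n m)⟩
      have : (n : ℝ) ≤ (max n m : ℕ) := by exact_mod_cast le_max_left n m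
      have h2 : 1 / (((max n m : ℕ) : ℝ) + 1) ≤ 1 / ((n : ℝ) + 1) := by gcongr
      linarith
    · have : 0 < 1 / ((n : ℝ) + 1) := by positivity
      linarith
  rw [hunion, hmono.measure_iUnion]
  refine iSup_le fun n ↦ ?_
  have hn0 : (0 : ℝ) ≤ n := n.cast_nonneg
  have hu : a < a + 1 / ((n : ℝ) + 1) := by
    have : 0 < 1 / ((n : ℝ) + 1) := by positivity
    linarith
  obtain ⟨h1, h2⟩ := key (a + 1 / ((n : ℝ) + 1)) (n + 1) (by positivity) hu
  refine (measure_mono (t := Metric.closedBall (a + 1 / ((n : ℝ) + 1) + (n + 1)) (n + 1) ∪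
    Metric.closedBall (-(a + 1 / ((n : ℝ) + 1) + (n + 1))) (n + 1)) fun y hy ↦ ?_).trans
    ((measure_union_le _ _).trans ?_)
  · obtain ⟨hy1, hy2⟩ := hy
    simp only [mem_union, Metric.mem_closedBall, Real.dist_eq]
    rcases le_total 0 y with h0 | h0
    · rw [abs_of_nonneg h0] at hy1 hy2
      left
      rw [abs_le]
      constructor <;> linarith
    · rw [abs_of_nonpos h0] at hy1 hy2
      right
      rw [abs_le]
      constructor <;> linarith
  · rw [two_mul]
    exact add_le_add h1 h2

end Fourier


/-! ### Increments over a grid -/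

variable {Ω : Type*}

/-- The increment of `z` over the `k`-th interval of the grid of mesh `h`. -/
def gridIncr (z : ℝ≥0 → Ω → ℝ) (h : ℝ≥0) (k : ℕ) (ω : Ω) : ℝ :=
  z ((k + 1 : ℕ) * h) ω - z (k * h) ω

/-- The largest modulus of one of the first `n` partial sums of a sequence. -/
noncomputable def maxSum (n : ℕ) (v : ℕ → ℝ) : ℝ≥0∞ := ⨆ k ∈ Finset.range (n + 1), ‖∑ i ∈ Finset.range k, v i‖ₑ

/-- The oscillation of `z` over the grid points of mesh `h` with indices `a, …, a + n`. -/
noncomputable def gridOsc (z : ℝ≥0 → Ω → ℝ) (h : ℝ≥0) (a n : ℕ) (ω : Ω) : ℝ≥0∞ :=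
  maxSum n fun i ↦ gridIncr z h (a + i) ω

/-- The oscillation of `z` over the dyadic points of `[j T, (j + 1) T]`. -/
noncomputable def blockOsc (z : ℝ≥0 → Ω → ℝ) (T : ℝ≥0) (j : ℕ) (ω : Ω) : ℝ≥0∞ :=
  ⨆ N : ℕ, gridOsc z (T / 2 ^ N) (j * 2 ^ N) (2 ^ N) ω

theorem sum_gridIncr (z : ℝ≥0 → Ω → ℝ) (h : ℝ≥0) (a k : ℕ) (ω : Ω) :
    ∑ i ∈ Finset.range k, gridIncr z h (a + i) ω = z ((a + k : ℕ) * h) ω - z (a * h) ω := by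
  simp only [gridIncr]
  have := Finset.sum_range_sub (fun i : ℕ ↦ z ((a + i : ℕ) * h) ω) k
  simpa [add_assoc] using this

theorem enorm_le_maxSum {n k : ℕ} (v : ℕ → ℝ) (hk : k ≤ n) :
    ‖∑ i ∈ Finset.range k, v i‖ₑ ≤ maxSum n v :=
  le_iSup₂_of_le (f := fun k (_ : k ∈ Finset.range (n + 1)) ↦ ‖∑ i ∈ Finset.range k, v i‖ₑ) k
    (Finset.mem_range.2 (Nat.lt_succ_of_le hk)) le_rfl

theorem maxSum_le {n : ℕ} {v : ℕ → ℝ} {c : ℝ≥0∞}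
    (h : ∀ k ≤ n, ‖∑ i ∈ Finset.range k, v i‖ₑ ≤ c) : maxSum n v ≤ c :=
  iSup₂_le fun k hk ↦ h k (Nat.lt_succ_iff.1 (Finset.mem_range.1 hk))

theorem enorm_sub_le_gridOsc (z : ℝ≥0 → Ω → ℝ) (h : ℝ≥0) {a n k : ℕ} (hk : k ≤ n) (ω : Ω) :
    ‖z ((a + k : ℕ) * h) ω - z (a * h) ω‖ₑ ≤ gridOsc z h a n ω := by
  rw [← sum_gridIncr]
  exact enorm_le_maxSum _ hk

theorem natCast_mul_two_pow_mul_div (T : ℝ≥0) (j N : ℕ) :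
    ((j * 2 ^ N : ℕ) : ℝ≥0) * (T / 2 ^ N) = j * T := by
  push_cast
  field_simp

theorem gridOsc_mono (z : ℝ≥0 → Ω → ℝ) (T : ℝ≥0) (j : ℕ) (ω : Ω) :
    Monotone fun N : ℕ ↦ gridOsc z (T / 2 ^ N) (j * 2 ^ N) (2 ^ N) ω := by
  refine monotone_nat_of_le_succ fun N ↦ maxSum_le fun k hk ↦ ?_
  rw [sum_gridIncr]
  have h1 : ((j * 2 ^ N + k : ℕ) : ℝ≥0) * (T / 2 ^ N)
      = ((j * 2 ^ (N + 1) + 2 * k : ℕ) : ℝ≥0) * (T / 2 ^ (N + 1)) := by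
    push_cast
    field_simp
    ring
  rw [natCast_mul_two_pow_mul_div, ← natCast_mul_two_pow_mul_div T j (N + 1), h1]
  exact enorm_sub_le_gridOsc z _ (by rw [pow_succ]; omega) ω

/-- By right-continuity it suffices to bound the values at the grid points just to the right of `s`.
They stay in the block because its endpoints belong to every grid. -/
theorem enorm_sub_le_blockOsc {z : ℝ≥0 → Ω → ℝ} {T : ℝ≥0} (hT : 0 < T) {ω : Ω}
    (hz : IsCadlag fun t ↦ z t ω) {j : ℕ} {s : ℝ≥0} (h1 : j * T ≤ s) (h2 : s ≤ (j + 1 : ℕ) * T) :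
    ‖z s ω - z (j * T) ω‖ₑ ≤ blockOsc z T j ω := by
  have hh : ∀ N : ℕ, 0 < T / 2 ^ N := fun N ↦ by positivity
  have h0 : Tendsto (fun N : ℕ ↦ T / 2 ^ N) atTop (𝓝 0) := by
    rw [← NNReal.tendsto_coe]
    push_cast
    exact tendsto_const_nhds.div_atTop (tendsto_pow_atTop_atTop_of_one_lt one_lt_two)
  have hlim := hz.tendsto_gridCeil hh h0 s
  rw [Real.toNNReal_coe] at hlim
  refine le_of_tendsto ((hlim.sub_const (z (j * T) ω)).enorm) (Eventually.of_forall fun N ↦ ?_)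
  refine le_trans ?_ (le_iSup (fun N : ℕ ↦ gridOsc z (T / 2 ^ N) (j * 2 ^ N) (2 ^ N) ω) N)
  have hp : (0 : ℝ) < (T / 2 ^ N : ℝ≥0) := hh N
  have e1 := congrArg NNReal.toReal (natCast_mul_two_pow_mul_div T j N)
  have e2 := congrArg NNReal.toReal (natCast_mul_two_pow_mul_div T (j + 1) N)
  have h1' : ((j * T : ℝ≥0) : ℝ) ≤ s := h1
  have h2' : (s : ℝ) ≤ (((j + 1 : ℕ) * T : ℝ≥0) : ℝ) := h2
  have hlow : j * 2 ^ N ≤ ⌈(s : ℝ) / (T / 2 ^ N : ℝ≥0)⌉₊ := by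
    have : ((j * 2 ^ N : ℕ) : ℝ) ≤ (s : ℝ) / (T / 2 ^ N : ℝ≥0) := by
      rw [le_div_iff₀ hp]
      refine le_trans (le_of_eq ?_) h1'
      rw [← e1]; simp
    exact_mod_cast this.trans (Nat.le_ceil _)
  have hup : ⌈(s : ℝ) / (T / 2 ^ N : ℝ≥0)⌉₊ ≤ (j + 1) * 2 ^ N := by
    refine Nat.ceil_le.2 ?_
    rw [div_le_iff₀ hp]
    refine h2'.trans (le_of_eq ?_)
    rw [← e2]; simp
  obtain ⟨k, hk⟩ := Nat.exists_eq_add_of_le hlow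
  simp only [gridCeil, hk]
  rw [← natCast_mul_two_pow_mul_div T j N]
  exact enorm_sub_le_gridOsc z _ (by rw [hk, add_mul, one_mul] at hup; omega) ω

theorem blockOsc_ne_top {z : ℝ≥0 → Ω → ℝ} (T : ℝ≥0) {ω : Ω}
    (hz : IsCadlag fun t ↦ z t ω) (j : ℕ) : blockOsc z T j ω ≠ ∞ := by
  obtain ⟨C, hC0, hC⟩ := hz.exists_abs_le ((j + 1 : ℕ) * T)
  refine ne_top_of_le_ne_top (ENNReal.ofReal_ne_top (r := C + C)) (iSup_le fun N ↦
    maxSum_le fun k hk ↦ ?_)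
  rw [sum_gridIncr, Real.enorm_eq_ofReal_abs]
  refine ENNReal.ofReal_le_ofReal ((abs_sub _ _).trans (add_le_add (hC _ ?_) (hC _ ?_)))
  · rw [← natCast_mul_two_pow_mul_div T (j + 1) N]
    gcongr
    rw [add_mul, one_mul]
    omega
  · rw [natCast_mul_two_pow_mul_div]
    gcongr
    omega

theorem enorm_le_sum_blockOsc {z : ℝ≥0 → Ω → ℝ} {T : ℝ≥0} (hT : 0 < T) {ω : Ω}
    (hz : IsCadlag fun t ↦ z t ω) (hz0 : z 0 ω = 0) (j : ℕ) {s : ℝ≥0} (hs : s ≤ j * T) :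
    ‖z s ω‖ₑ ≤ ∑ i ∈ Finset.range j, blockOsc z T i ω := by
  induction j generalizing s with
  | zero =>
    have : s = 0 := by simpa using hs
    simp [this, hz0]
  | succ j ih =>
    rw [Finset.sum_range_succ]
    rcases le_total s (j * T) with h | h
    · exact (ih h).trans le_self_add
    · calc ‖z s ω‖ₑ = ‖z (j * T) ω + (z s ω - z (j * T) ω)‖ₑ := by rw [add_sub_cancel]
        _ ≤ ‖z (j * T) ω‖ₑ + ‖z s ω - z (j * T) ω‖ₑ := enorm_add_le _ _
        _ ≤ _ := add_le_add (ih le_rfl) (enorm_sub_le_blockOsc hT hz h hs)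

variable [MeasurableSpace Ω] {P : Measure Ω} {z : ℝ≥0 → Ω → ℝ} {ν : Measure ℝ}

theorem measurable_maxSum (n : ℕ) : Measurable (maxSum n) := by
  unfold maxSum
  fun_prop

theorem IsPureJumpLevy.measurable_gridIncr (hz : IsPureJumpLevy P z ν) (h : ℝ≥0) (k : ℕ) :
    Measurable (gridIncr z h k) := (hz.measurable _).sub (hz.measurable _)

theorem IsPureJumpLevy.measurable_gridOsc (hz : IsPureJumpLevy P z ν) (h : ℝ≥0) (a n : ℕ) :
    Measurable (gridOsc z h a n) :=
  (measurable_maxSum n).comp (measurable_pi_lambda _ fun _ ↦ hz.measurable_gridIncr _ _)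

theorem IsPureJumpLevy.measurable_blockOsc (hz : IsPureJumpLevy P z ν) (T : ℝ≥0) (j : ℕ) :
    Measurable (blockOsc z T j) :=
  Measurable.iSup fun _ ↦ hz.measurable_gridOsc _ _ _

theorem IsPureJumpLevy.iIndepFun_gridIncr (hz : IsPureJumpLevy P z ν) (h : ℝ≥0) :
    iIndepFun (gridIncr z h) P :=
  hz.indep.nat (t := fun k : ℕ ↦ k * h) fun m n hmn ↦ by
    show (m : ℝ≥0) * h ≤ n * h
    gcongr

theorem IsPureJumpLevy.map_gridIncr (hz : IsPureJumpLevy P z ν) (h : ℝ≥0) (k : ℕ) :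
    P.map (gridIncr z h k) = P.map (z h) := by
  rw [← hz.stationary (k * h) h]
  congr 1
  ext ω
  rw [gridIncr]
  congr 2
  push_cast
  ring

theorem IsPureJumpLevy.measure_gridIncr_preimage (hz : IsPureJumpLevy P z ν) (h : ℝ≥0) (k : ℕ)
    {A : Set ℝ} (hA : MeasurableSet A) : P (gridIncr z h k ⁻¹' A) = P (z h ⁻¹' A) := by
  rw [← Measure.map_apply (hz.measurable_gridIncr h k) hA, hz.map_gridIncr,
    Measure.map_apply (hz.measurable h) hA]

/-- By independence and stationarity, any `n` consecutive increments have the same joint law, a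
product measure. -/
theorem IsPureJumpLevy.lintegral_gridOsc_rpow (hz : IsPureJumpLevy P z ν) (h : ℝ≥0) (a n : ℕ)
    (q : ℝ) : ∫⁻ ω, gridOsc z h a n ω ^ q ∂P = ∫⁻ ω, gridOsc z h 0 n ω ^ q ∂P := by
  have := (hz.iIndepFun_gridIncr h).isProbabilityMeasure
  have hm : ∀ b : ℕ, ∀ i : Fin n, AEMeasurable (gridIncr z h (b + i)) P := fun b i ↦
    (hz.measurable_gridIncr h _).aemeasurable
  have hlaw : ∀ b : ℕ, P.map (fun ω (i : Fin n) ↦ gridIncr z h (b + i) ω)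
      = Measure.pi fun _ ↦ P.map (z h) := fun b ↦ by
    have hind : iIndepFun (fun (i : Fin n) ↦ gridIncr z h (b + i)) P :=
      (hz.iIndepFun_gridIncr h).precomp (g := fun i : Fin n ↦ b + i)
        fun i j hij ↦ Fin.ext (by simpa using hij)
    rw [(iIndepFun_iff_map_fun_eq_pi_map (hm b)).1 hind]
    simp only [hz.map_gridIncr]
  -- `maxSum n` reads only the first `n` entries, so extension by zero makes it a function of the
  -- finite vector.
  set ext : (Fin n → ℝ) → ℕ → ℝ := fun v i ↦ if hi : i < n then v ⟨i, hi⟩ else 0 with hext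
  have hextm : Measurable ext := measurable_pi_lambda _ fun i ↦ by
    by_cases hi : i < n
    · simp only [hext, hi, dite_true]; fun_prop
    · simp only [hext, hi, dite_false]; fun_prop
  have hφ : Measurable fun v ↦ maxSum n (ext v) ^ q :=
    ((measurable_maxSum n).comp hextm).pow_const q
  have heq : ∀ b : ℕ, ∫⁻ ω, gridOsc z h b n ω ^ q ∂P
      = ∫⁻ v, maxSum n (ext v) ^ q ∂(Measure.pi fun _ ↦ P.map (z h)) := fun b ↦ by
    rw [← hlaw b, lintegral_map hφ (measurable_pi_lambda _ fun i ↦ hz.measurable_gridIncr h _)]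
    refine lintegral_congr fun ω ↦ ?_
    congr 1
    refine iSup_congr fun k ↦ iSup_congr fun hk ↦ ?_
    congr 1
    refine Finset.sum_congr rfl fun i hi ↦ ?_
    have : i < n := (Finset.mem_range.1 hi).trans_le (Nat.lt_succ_iff.1 (Finset.mem_range.1 hk))
    simp [hext, this]
  rw [heq a, heq 0]

/-- Continuity from above for the limsup of events. It transfers probability bounds from
approximating sums to their pointwise limit: where the sums exceed a level infinitely often, the
limit is at least that level. -/
theorem measure_frequently_ge {A : ℕ → Set Ω} [IsFiniteMeasure P] (hA : ∀ n, MeasurableSet (A n))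
    {c : ℝ≥0∞} {N : ℕ} (h : ∀ n ≥ N, c ≤ P (A n)) : c ≤ P {ω | ∃ᶠ n in atTop, ω ∈ A n} := by
  set B : ℕ → Set Ω := fun M ↦ ⋃ n ≥ M, A n with hB
  have hBm : ∀ M, MeasurableSet (B M) := fun M ↦
    MeasurableSet.iUnion fun n ↦ MeasurableSet.iUnion fun _ ↦ hA n
  have hanti : Antitone B := fun M M' hMM ↦ by
    refine iUnion₂_subset fun n hn ↦ ?_
    exact subset_iUnion₂_of_subset n (hMM.trans hn) le_rfl
  have hlim := tendsto_measure_iInter_atTop (μ := P) (fun M ↦ (hBm M).nullMeasurableSet) hanti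
    ⟨0, measure_ne_top _ _⟩
  have hset : ⋂ M, B M = {ω | ∃ᶠ n in atTop, ω ∈ A n} := by
    ext ω
    simp [hB, frequently_atTop]
  rw [hset] at hlim
  refine ge_of_tendsto hlim ((eventually_ge_atTop N).mono fun M hM ↦ (h M hM).trans ?_)
  exact measure_mono (subset_iUnion₂_of_subset M le_rfl le_rfl)

theorem exists_nat_half_le [IsProbabilityMeasure P] {X : Ω → ℝ≥0∞} (hX : ∀ ω, X ω ≠ ∞) :
    ∃ n : ℕ, ∀ c : ℝ≥0∞, n ≤ c → 1 / 2 ≤ P {ω | X ω ≤ c} := by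
  have hmono : Monotone fun n : ℕ ↦ {ω | X ω ≤ n} := fun m n hmn ω hω ↦
    le_trans (show X ω ≤ m from hω) (by exact_mod_cast hmn)
  have hU : ⋃ n : ℕ, {ω | X ω ≤ n} = univ := eq_univ_of_forall fun ω ↦ by
    obtain ⟨n, hn⟩ := ENNReal.exists_nat_gt (hX ω)
    exact mem_iUnion.2 ⟨n, hn.le⟩
  have h := hmono.measure_iUnion (μ := P)
  rw [hU, measure_univ] at h
  obtain ⟨n, hn⟩ := lt_iSup_iff.1 (show (1 / 2 : ℝ≥0∞) < ⨆ n : ℕ, P {ω | X ω ≤ n} by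
    rw [← h, one_div]; exact ENNReal.one_half_lt_one)
  exact ⟨n, fun c hc ↦ hn.le.trans (measure_mono fun ω hω ↦ le_trans hω hc)⟩

theorem IsPureJumpLevy.tendsto_sum_exp_mul_gridIncr (hz : IsPureJumpLevy P z ν) (l : ℝ) {T : ℝ≥0}
    (hT : 0 < T) (ω : Ω) :
    Tendsto (fun N : ℕ ↦ ∑ k ∈ Finset.range (2 ^ N), Real.exp (l * (k * (T / 2 ^ N : ℝ≥0)))
      * gridIncr z (T / 2 ^ N) k ω) atTop (𝓝 (Real.exp (l * T) * stochConv z l T ω)) := by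
  rw [exp_mul_stochConv]
  exact (hz.cadlag ω).tendsto_sum_exp_mul_sub (hz.zero ω) l hT

theorem IsPureJumpLevy.measurable_exp_mul_stochConv (hz : IsPureJumpLevy P z ν) (l : ℝ) {T : ℝ≥0}
    (hT : 0 < T) : Measurable fun ω ↦ Real.exp (l * T) * stochConv z l T ω :=
  measurable_of_tendsto_metrizable
    (fun _ ↦ Finset.measurable_fun_sum _ fun k _ ↦ (hz.measurable_gridIncr _ k).const_mul _)
    (tendsto_pi_nhds.2 fun ω ↦ hz.tendsto_sum_exp_mul_gridIncr l hT ω)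

theorem ofReal_lt_iff_enorm {a x : ℝ} (ha : 0 ≤ a) : ENNReal.ofReal a < ‖x‖ₑ ↔ a < |x| := by
  rw [Real.enorm_eq_ofReal_abs, ENNReal.ofReal_lt_ofReal_iff_of_nonneg ha]

theorem enorm_le_ofReal_iff {a x : ℝ} (ha : 0 ≤ a) : ‖x‖ₑ ≤ ENNReal.ofReal a ↔ |x| ≤ a := by
  rw [Real.enorm_eq_ofReal_abs, ENNReal.ofReal_le_ofReal_iff ha]

/-- The oscillation over a block has the tails of the stochastic convolution. -/
theorem IsPureJumpLevy.measure_blockOsc_tail_le [IsProbabilityMeasure P]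
    (hz : IsPureJumpLevy P z ν) {l : ℝ} (hl : 0 < l) {T : ℝ≥0} (hT : 0 < T) :
    ∃ a₀, 0 ≤ a₀ ∧ ∀ a, 0 < a → a₀ ≤ a → P {ω | ENNReal.ofReal (2 * a) < blockOsc z T 0 ω}
      ≤ 2 * P {ω | ENNReal.ofReal a ≤ ‖Real.exp (l * T) * stochConv z l T ω‖ₑ} := by
  obtain ⟨n₀, hn₀⟩ := exists_nat_half_le (P := P) fun ω ↦ blockOsc_ne_top T (hz.cadlag ω) 0
  -- For `a` beyond this value, `c = a / (4 e^{lT})` is at least `n₀`, so the oscillation is at most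
  -- `c` with probability at least `1/2`. Each weighted partial sum is then at most `2 e^{lT} c = a
  -- / 2`, and every remainder, a difference of two of them, at most `a`, as Ottaviani's inequality
  -- demands.
  refine ⟨4 * Real.exp (l * T) * n₀, by positivity, fun a ha ha₀ ↦ ?_⟩
  set w : ℕ → ℕ → ℝ := fun N k ↦ Real.exp (l * (k * (T / 2 ^ N : ℝ≥0))) with hw
  set ξ : ℕ → ℕ → Ω → ℝ := fun N k ω ↦ w N k * gridIncr z (T / 2 ^ N) k ω with hξ
  have hwm : ∀ N, Monotone (w N) := fun N m n hmn ↦ by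
    simp only [hw]
    gcongr
  have hw0 : ∀ N, w N 0 = 1 := fun N ↦ by simp [hw]
  have hwT : ∀ N, ∀ k ≤ 2 ^ N, w N k ≤ Real.exp (l * T) := fun N k hk ↦ by
    refine (hwm N hk).trans (le_of_eq ?_)
    have := congrArg NNReal.toReal (natCast_mul_two_pow_mul_div T 1 N)
    simp only [one_mul, Nat.cast_one, NNReal.coe_mul, NNReal.coe_natCast] at this
    simp only [hw, this]
  have hξm : ∀ N k, Measurable (ξ N k) := fun N k ↦ (hz.measurable_gridIncr _ k).const_mul _
  have hξi : ∀ N, iIndepFun (ξ N) P := fun N ↦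
    (hz.iIndepFun_gridIncr (T / 2 ^ N)).comp (fun k x ↦ w N k * x) fun k ↦ by fun_prop
  set c : ℝ := a / (4 * Real.exp (l * T)) with hc
  have hc0 : 0 < c := by positivity
  have hcn : (n₀ : ℝ) ≤ c := by
    rw [hc, le_div_iff₀ (by positivity)]
    linarith
  have hhalf : ∀ N, ∀ k ≤ 2 ^ N,
      1 / 2 ≤ P {ω | |∑ i ∈ Finset.Ico k (2 ^ N), ξ N i ω| ≤ a} := fun N k hk ↦ by
    refine (hn₀ (ENNReal.ofReal c) ?_).trans (measure_mono fun ω hω ↦ ?_)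
    · rw [← ENNReal.ofReal_natCast]
      exact ENNReal.ofReal_le_ofReal hcn
    · have hosc : ∀ j : ℕ, j ≤ 2 ^ N → |z (j * (T / 2 ^ N)) ω| ≤ c := fun j hj ↦ by
        rw [← enorm_le_ofReal_iff hc0.le]
        refine le_trans ?_ ((le_iSup _ N).trans hω)
        have := enorm_sub_le_gridOsc z (T / 2 ^ N) (a := 0 * 2 ^ N) hj ω
        simpa [hz.zero] using this
      have hbd : ∀ j ≤ 2 ^ N, |∑ i ∈ Finset.range j, ξ N i ω| ≤ 2 * Real.exp (l * T) * c :=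
        fun j hj ↦ by
          have := abs_sum_mul_sub_le (hwm N) (by rw [hw0]; exact zero_le_one)
            (a := fun i : ℕ ↦ z (i * (T / 2 ^ N)) ω) (m := c) (n := j) (by simp [hz.zero])
            fun k hk ↦ hosc k (hk.trans hj)
          refine this.trans ?_
          have := hwT N j hj
          gcongr
      have hsum : ∑ i ∈ Finset.Ico k (2 ^ N), ξ N i ω = ∑ i ∈ Finset.range (2 ^ N), ξ N i ω
          - ∑ i ∈ Finset.range k, ξ N i ω := Finset.sum_Ico_eq_sub _ hk
      show |_| ≤ a
      rw [hsum]
      refine (abs_sub _ _).trans ((add_le_add (hbd _ le_rfl) (hbd _ hk)).trans (le_of_eq ?_))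
      rw [hc]
      field_simp
      ring
  have hA : ∀ N, P {ω | ENNReal.ofReal (2 * a) < gridOsc z (T / 2 ^ N) (0 * 2 ^ N) (2 ^ N) ω}
      ≤ 2 * P {ω | a < |∑ i ∈ Finset.range (2 ^ N), ξ N i ω|} := fun N ↦ by
    refine le_trans (measure_mono fun ω hω ↦ ?_)
      (measure_exists_lt_abs_sum_le (hξm N) (hξi N) (hhalf N))
    -- If all weighted partial sums were at most `2 * a`, so would be the unweighted ones, since the
    -- weights increase from `1`.
    by_contra hcon
    simp only [mem_ofPred_eq, not_exists, not_and, not_lt] at hcon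
    refine absurd hω (not_lt.2 (maxSum_le fun k hk ↦ ?_))
    rw [sum_gridIncr, enorm_le_ofReal_iff (by positivity)]
    have := abs_le_of_abs_sum_mul_sub_le (hwm N) (hw0 N) (m := 2 * a)
      (a := fun i : ℕ ↦ z (i * (T / 2 ^ N)) ω) (n := k) (by simp [hz.zero])
      fun j hj ↦ hcon j (hj.trans hk)
    simpa [hz.zero] using this
  set D : ℕ → Set Ω := fun N ↦
    {ω | ENNReal.ofReal (2 * a) < gridOsc z (T / 2 ^ N) (0 * 2 ^ N) (2 ^ N) ω} with hD
  have hDmono : Monotone D := fun N M hNM ω hω ↦ lt_of_lt_of_le hω (gridOsc_mono z T 0 ω hNM)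
  have hDU : {ω | ENNReal.ofReal (2 * a) < blockOsc z T 0 ω} = ⋃ N, D N := by
    ext ω
    simp [hD, blockOsc, lt_iSup_iff]
  rw [hDU, hDmono.measure_iUnion]
  refine iSup_le fun N ↦ ?_
  -- The events `D M` increase, so the bound for `D N` holds with the weighted sums of every finer
  -- grid, and these converge to the stochastic convolution.
  have hfreq := measure_frequently_ge (P := P) (N := N) (c := P (D N) / 2)
    (A := fun M ↦ {ω | a < |∑ i ∈ Finset.range (2 ^ M), ξ M i ω|})
    (fun M ↦ measurableSet_lt measurable_const
      (Finset.measurable_fun_sum _ fun i _ ↦ hξm M i).abs)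
    (fun M hM ↦ by
      refine ENNReal.div_le_of_le_mul' ?_
      exact (measure_mono (hDmono hM)).trans (hA M))
  rw [ENNReal.div_le_iff_le_mul (Or.inl two_ne_zero) (Or.inl ENNReal.ofNat_ne_top),
    mul_comm] at hfreq
  refine hfreq.trans (mul_le_mul' le_rfl (measure_mono fun ω hω ↦ ?_))
  have hlim := (hz.tendsto_sum_exp_mul_gridIncr l hT ω).abs
  rw [mem_ofPred_eq, Real.enorm_eq_ofReal_abs]
  exact ENNReal.ofReal_le_ofReal (ge_of_tendsto_of_frequently hlim (hω.mono fun M hM ↦ le_of_lt hM))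

theorem IsPureJumpLevy.lintegral_blockOsc_lt_top [IsProbabilityMeasure P]
    (hz : IsPureJumpLevy P z ν) {l : ℝ} (hl : 0 < l) {T : ℝ≥0} (hT : 0 < T) {q : ℝ} (hq : 0 < q)
    (hmom : ∫⁻ ω, ENNReal.ofReal (|stochConv z l T ω| ^ q) ∂P < ∞) :
    ∫⁻ ω, blockOsc z T 0 ω ^ q ∂P < ∞ := by
  obtain ⟨a₀, ha₀, h⟩ := hz.measure_blockOsc_tail_le hl hT
  have hm := (hz.measurable_exp_mul_stochConv l hT).enorm
  refine lintegral_rpow_lt_top_of_tail (hz.measurable_blockOsc T 0) hm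
    (fun ω ↦ blockOsc_ne_top T (hz.cadlag ω) 0) (fun _ ↦ enorm_ne_top) two_pos ha₀ hq
    ENNReal.ofNat_ne_top h ?_
  have : ∀ ω, ‖Real.exp (l * T) * stochConv z l T ω‖ₑ ^ q
      = ENNReal.ofReal (Real.exp (l * T) ^ q) * ENNReal.ofReal (|stochConv z l T ω| ^ q) :=
    fun ω ↦ by
      rw [← ENNReal.ofReal_mul (by positivity), ← Real.mul_rpow (Real.exp_pos _).le (abs_nonneg _),
        Real.enorm_eq_ofReal_abs, abs_mul, abs_of_pos (Real.exp_pos _),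
        ENNReal.ofReal_rpow_of_nonneg (by positivity) hq.le]
  simp only [this]
  rw [lintegral_const_mul' _ _ ENNReal.ofReal_ne_top]
  exact ENNReal.mul_lt_top ENNReal.ofReal_lt_top hmom


/-! ### Large jumps -/

variable {Ω : Type*} {z : ℝ≥0 → Ω → ℝ}

theorem tendsto_div_two_pow (T : ℝ≥0) : Tendsto (fun N : ℕ ↦ T / 2 ^ N) atTop (𝓝 0) := by
  rw [← NNReal.tendsto_coe]
  push_cast
  exact tendsto_const_nhds.div_atTop (tendsto_pow_atTop_atTop_of_one_lt one_lt_two)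

/-- The event that the increments of `z` over the `N`-th dyadic grid of `[T, j T]` are at most
`K`. -/
def quietEvent (z : ℝ≥0 → Ω → ℝ) (T : ℝ≥0) (K : ℝ) (j N : ℕ) : Set Ω :=
  {ω | ∀ k ∈ Finset.Ico (2 ^ N) (j * 2 ^ N), |gridIncr z (T / 2 ^ N) k ω| ≤ K}

/-- The event that the increments of `z` over all fine dyadic grids of `[T, j T]` are at most
`K`. -/
def eventuallyQuiet (z : ℝ≥0 → Ω → ℝ) (T : ℝ≥0) (K : ℝ) (j : ℕ) : Set Ω :=
  {ω | ∀ᶠ N : ℕ in atTop, ω ∈ quietEvent z T K j N}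

theorem exists_jump_of_notMem_eventuallyQuiet {T : ℝ≥0} {K : ℝ} (hK : 0 < K) {j : ℕ} {ω : Ω}
    (hz : IsCadlag fun t ↦ z t ω) (hω : ω ∉ eventuallyQuiet z T K j) :
    ∃ r, T < r ∧ r ≤ j * T ∧ K ≤ |jump (fun s ↦ z s ω) r| := by
  have hfreq : ∃ᶠ N : ℕ in atTop, ω ∉ quietEvent z T K j N :=
    not_eventually.1 hω
  obtain ⟨φ, hφ, hbad⟩ := extraction_of_frequently_atTop hfreq
  have : ∀ n, ∃ k ∈ Finset.Ico (2 ^ φ n) (j * 2 ^ φ n), K < |gridIncr z (T / 2 ^ φ n) k ω| :=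
    fun n ↦ by
      have := hbad n
      simpa [quietEvent, and_assoc] using this
  choose k hk hbig using this
  refine hz.exists_jump (s := fun n ↦ k n * (T / 2 ^ φ n))
    (t := fun n ↦ (k n + 1 : ℕ) * (T / 2 ^ φ n)) hK (fun n ↦ ?_) (fun n ↦ ?_) (fun n ↦ ?_) ?_ hbig
  · calc T = ((1 * 2 ^ φ n : ℕ) : ℝ≥0) * (T / 2 ^ φ n) := by
          rw [natCast_mul_two_pow_mul_div, Nat.cast_one, one_mul]
      _ ≤ _ := by
          gcongr
          rw [one_mul]
          exact (Finset.mem_Ico.1 (hk n)).1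
  · gcongr
    exact Nat.le_succ _
  · rw [← natCast_mul_two_pow_mul_div T j (φ n)]
    gcongr
    exact (Finset.mem_Ico.1 (hk n)).2
  · have h0 := NNReal.tendsto_coe.2 ((tendsto_div_two_pow T).comp hφ.tendsto_atTop)
    refine h0.congr fun n ↦ ?_
    simp only [Function.comp_apply]
    push_cast
    ring

theorem waitTime_mem_of_notMem_eventuallyQuiet {T : ℝ≥0} {K : ℝ} (hK : 0 < K) {j : ℕ} {ω : Ω}
    (hz : IsCadlag fun t ↦ z t ω) (hω : ω ∉ eventuallyQuiet z T K j) :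
    T ≤ waitTime z T K ω ∧ waitTime z T K ω ≤ j * T := by
  obtain ⟨r, h1, h2, h3⟩ := exists_jump_of_notMem_eventuallyQuiet hK hz hω
  have hmem : r ∈ {t | T < t ∧ K ≤ |jump (fun s ↦ z s ω) t|} := ⟨h1, h3⟩
  exact ⟨le_csInf ⟨r, hmem⟩ fun t ht ↦ ht.1.le, (csInf_le (OrderBot.bddBelow _) hmem).trans h2⟩

variable [MeasurableSpace Ω] {P : Measure Ω} {ν : Measure ℝ}

theorem measurableSet_abs_le (b : ℝ) : MeasurableSet {x : ℝ | |x| ≤ b} :=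
  measurableSet_le measurable_abs measurable_const

theorem IsPureJumpLevy.measure_forall_abs_gridIncr_le (hz : IsPureJumpLevy P z ν) (h : ℝ≥0) (K : ℝ)
    (s : Finset ℕ) :
    P {ω | ∀ k ∈ s, |gridIncr z h k ω| ≤ K} = P {ω | |z h ω| ≤ K} ^ s.card := by
  have := (hz.iIndepFun_gridIncr h).measure_inter_preimage_eq_mul s
    (sets := fun _ ↦ {x : ℝ | |x| ≤ K}) fun _ _ ↦ measurableSet_abs_le K
  simp only [hz.measure_gridIncr_preimage h _ (measurableSet_abs_le K), Finset.prod_const] at this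
  have hset : {ω | ∀ k ∈ s, |gridIncr z h k ω| ≤ K}
      = ⋂ k ∈ s, gridIncr z h k ⁻¹' {x : ℝ | |x| ≤ K} := by
    ext ω
    simp
  rw [hset, this]
  rfl

theorem IsPureJumpLevy.measureReal_abs_le [IsProbabilityMeasure P] (hz : IsPureJumpLevy P z ν)
    (h : ℝ≥0) (K : ℝ) : P.real {ω | |z h ω| ≤ K} = 1 - P.real {ω | K < |z h ω|} := by
  rw [← probReal_compl_eq_one_sub (measurableSet_lt measurable_const (hz.measurable h).abs)]
  congr 1
  ext ω
  simp

/-- The tail of the Lévy measure is bounded by the tail of the oscillation over a block. -/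
theorem IsPureJumpLevy.measure_tail_le_blockOsc [IsProbabilityMeasure P]
    (hz : IsPureJumpLevy P z ν) {T : ℝ≥0} (hT : 0 < T) :
    ∃ a₀, 0 ≤ a₀ ∧ ∀ a, 0 < a → a₀ ≤ a → ν {y | 2 * a < |y|}
      ≤ ENNReal.ofReal (4 / T) * P {ω | ENNReal.ofReal a ≤ blockOsc z T 0 ω} := by
  obtain ⟨n₀, hn₀⟩ := exists_nat_half_le (P := P) fun ω ↦ blockOsc_ne_top T (hz.cadlag ω) 0
  refine ⟨n₀ + 1, by positivity, fun a ha ha₀ ↦ ?_⟩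
  have hT0 : (0 : ℝ) < T := hT
  set G : Set Ω := {ω | ENNReal.ofReal a ≤ blockOsc z T 0 ω} with hG
  have hGm : MeasurableSet G := measurableSet_le measurable_const (hz.measurable_blockOsc T 0)
  have hg : P.real G ≤ 1 / 2 := by
    have h1 : P G + P Gᶜ = 1 := by rw [measure_add_measure_compl hGm, measure_univ]
    have h2 : 1 / 2 ≤ P Gᶜ := by
      refine (hn₀ n₀ le_rfl).trans (measure_mono fun ω hω ↦ ?_)
      have h3 : (n₀ : ℝ≥0∞) < ENNReal.ofReal a := by
        rw [← ENNReal.ofReal_natCast]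
        exact (ENNReal.ofReal_lt_ofReal_iff ha).2 (by linarith)
      exact not_le.2 (lt_of_le_of_lt hω h3)
    have h3 : P.real G + P.real Gᶜ = 1 := by
      rw [measureReal_def, measureReal_def, ← ENNReal.toReal_add (measure_ne_top _ _)
        (measure_ne_top _ _), h1, ENNReal.toReal_one]
    have h4 : 1 / 2 ≤ P.real Gᶜ := by
      have := ENNReal.toReal_mono (measure_ne_top P Gᶜ) h2
      simpa [measureReal_def] using this
    linarith
  have hg0 : 0 ≤ P.real G := measureReal_nonneg
  -- Outside `G` all increments are at most `2 * a`, so `1 - P(G) ≤ (1 - p)^{2^N} ≤ e^{-x}` with `x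
  -- = 2^N p`. Then `(1 + x)(1 - P(G)) ≤ 1`, and `P(G) ≤ 1/2` yields `x ≤ 2 P(G)`.
  have key : ∀ N : ℕ, P.real {ω | 2 * a < |z (T / 2 ^ N) ω|}
      ≤ 2 * P.real G / T * (T / 2 ^ N : ℝ≥0) := fun N ↦ by
    set p := P.real {ω | 2 * a < |z (T / 2 ^ N) ω|} with hp
    set Q : Set Ω := {ω | ∀ k ∈ Finset.range (2 ^ N), |gridIncr z (T / 2 ^ N) k ω| ≤ 2 * a} with hQ
    have hQr : P.real Q = (1 - p) ^ (2 ^ N) := by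
      rw [measureReal_def, hz.measure_forall_abs_gridIncr_le, ENNReal.toReal_pow, Finset.card_range,
        ← measureReal_def, hz.measureReal_abs_le]
    have hsub : (univ : Set Ω) ⊆ Q ∪ G := fun ω _ ↦ by
      by_contra hcon
      simp only [mem_union, not_or] at hcon
      have hosc : ∀ j : ℕ, j ≤ 2 ^ N → |z (j * (T / 2 ^ N)) ω| ≤ a := fun j hj ↦ by
        rw [← enorm_le_ofReal_iff ha.le]
        refine le_trans ?_ (not_le.1 hcon.2).le
        refine le_trans ?_ (le_iSup _ N)
        have := enorm_sub_le_gridOsc z (T / 2 ^ N) (a := 0 * 2 ^ N) hj ω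
        simpa [hz.zero] using this
      refine hcon.1 fun k hk ↦ ?_
      have hk' := Finset.mem_range.1 hk
      refine (abs_sub _ _).trans ?_
      linarith [hosc (k + 1) hk', hosc k hk'.le]
    have h1 : 1 ≤ P.real Q + P.real G := by
      have := (measureReal_mono (μ := P) hsub).trans (measureReal_union_le _ _)
      simpa using this
    have hp1 : p ≤ 1 := measureReal_le_one
    have hp0 : 0 ≤ p := measureReal_nonneg
    have h2 : (1 - p) ^ (2 ^ N) ≤ Real.exp (-((2 : ℝ) ^ N * p)) := by
      have : 1 - p ≤ Real.exp (-p) := by linarith [Real.add_one_le_exp (-p)]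
      refine (pow_le_pow_left₀ (by linarith) this _).trans (le_of_eq ?_)
      rw [← Real.exp_nat_mul]
      push_cast
      ring_nf
    have h3 : (1 + (2 : ℝ) ^ N * p) * (1 - P.real G) ≤ 1 := by
      have h4 : 1 - P.real G ≤ Real.exp (-((2 : ℝ) ^ N * p)) := by linarith
      calc (1 + (2 : ℝ) ^ N * p) * (1 - P.real G)
          ≤ Real.exp ((2 : ℝ) ^ N * p) * Real.exp (-((2 : ℝ) ^ N * p)) := by
            refine mul_le_mul ?_ h4 (by linarith) (Real.exp_pos _).le
            linarith [Real.add_one_le_exp ((2 : ℝ) ^ N * p)]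
        _ = 1 := by rw [← Real.exp_add]; simp
    have h5 : (2 : ℝ) ^ N * p ≤ 2 * P.real G := by
      have : 0 ≤ (2 : ℝ) ^ N * p := by positivity
      nlinarith
    push_cast
    have h6 : 2 * P.real G / T * (T / 2 ^ N) = 2 * P.real G / 2 ^ N := by field_simp
    rw [h6, le_div_iff₀ (by positivity)]
    linarith
  refine (hz.measure_tail_le (a := 2 * a) (by positivity) (t := fun N : ℕ ↦ T / 2 ^ N)
    (fun N ↦ by positivity) (tendsto_div_two_pow T) (Frequently.of_forall key)).trans (le_of_eq ?_)
  have hPG : P G = ENNReal.ofReal (P.real G) := by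
    rw [measureReal_def, ENNReal.ofReal_toReal (measure_ne_top _ _)]
  rw [hPG, ← ENNReal.ofReal_mul (by positivity), ← ENNReal.ofReal_ofNat, ← ENNReal.ofReal_mul
    (by positivity)]
  congr 1
  ring

theorem mem_bigJumps {K y : ℝ} : y ∈ bigJumps K ↔ K ≤ |y| := by
  rw [bigJumps, mem_union, mem_Iic, mem_Ici, le_abs', le_neg]

theorem isProbabilityMeasure_bigJumpLaw {K : ℝ} (hK : 0 < bigJumpRate ν K) :
    IsProbabilityMeasure (bigJumpLaw ν K) := by
  have h := ENNReal.toReal_pos_iff.1 hK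
  refine ⟨?_⟩
  rw [bigJumpLaw, Measure.smul_apply, Measure.restrict_apply_univ, smul_eq_mul,
    ENNReal.inv_mul_cancel h.1.ne' h.2.ne]

theorem IsPureJumpLevy.lintegral_bigJumpLaw_lt_top [IsProbabilityMeasure P]
    (hz : IsPureJumpLevy P z ν) {T : ℝ≥0} (hT : 0 < T) {K q : ℝ} (hq : 0 < q)
    (hK : 0 < bigJumpRate ν K) (hosc : ∫⁻ ω, blockOsc z T 0 ω ^ q ∂P < ∞) :
    ∫⁻ y, ‖y‖ₑ ^ q ∂(bigJumpLaw ν K) < ∞ := by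
  have := isProbabilityMeasure_bigJumpLaw hK
  have h := ENNReal.toReal_pos_iff.1 hK
  obtain ⟨a₀, ha₀, htail⟩ := hz.measure_tail_le_blockOsc hT
  refine lintegral_rpow_lt_top_of_tail (f := fun y : ℝ ↦ ‖y‖ₑ) measurable_enorm
    (hz.measurable_blockOsc T 0) (fun _ ↦ enorm_ne_top)
    (fun ω ↦ blockOsc_ne_top T (hz.cadlag ω) 0) two_pos ha₀ hq
    (C := (ν (bigJumps K))⁻¹ * ENNReal.ofReal (4 / T))
    (ENNReal.mul_ne_top (ENNReal.inv_ne_top.2 h.1.ne') ENNReal.ofReal_ne_top)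
    (fun a ha haa ↦ ?_) hosc
  rw [bigJumpLaw, Measure.smul_apply, smul_eq_mul, mul_assoc]
  refine mul_le_mul' le_rfl ((Measure.restrict_apply_le _ _).trans (le_trans (le_of_eq ?_)
    (htail a ha haa)))
  congr 1
  ext y
  exact ofReal_lt_iff_enorm (by positivity)

/-- The small-time bounds concern the open tail `|y| > K`. Nothing is lost, as a law with a density
has no atoms at `±K`. -/
theorem measure_lt_abs_pos {K : ℝ} {pK : ℝ → ℝ} (hK : 0 < bigJumpRate ν K)
    (hd : bigJumpLaw ν K = volume.withDensity fun u ↦ ENNReal.ofReal (pK u)) :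
    0 < ν {y | K < |y|} := by
  have := isProbabilityMeasure_bigJumpLaw hK
  have h := ENNReal.toReal_pos_iff.1 hK
  by_contra hcon
  have h0 : ν {y | K < |y|} = 0 := by simpa using hcon
  have hpt : bigJumpLaw ν K {-K, K} = 0 := by
    rw [hd]
    exact withDensity_absolutelyContinuous _ _ ((Set.toFinite _).measure_zero _)
  have hle : bigJumpLaw ν K univ ≤ 0 := by
    have hsub : bigJumps K ⊆ {-K, K} ∩ bigJumps K ∪ {y | K < |y|} := fun y hy ↦ by
      rcases lt_or_eq_of_le (mem_bigJumps.1 hy) with h1 | h1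
      · exact Or.inr h1
      · refine Or.inl ⟨?_, hy⟩
        rcases abs_choice y with h2 | h2
        · right; rw [h1, h2]; rfl
        · left; rw [h1, h2, neg_neg]
    have hm : ν ({-K, K} ∩ bigJumps K) = 0 := by
      rw [bigJumpLaw, Measure.smul_apply, smul_eq_mul, Measure.restrict_apply (Set.toFinite
        _).measurableSet, mul_eq_zero] at hpt
      exact hpt.resolve_left (ENNReal.inv_ne_zero.2 h.2.ne)
    have h3 : ν (bigJumps K) = 0 := by
      refine le_antisymm ((measure_mono hsub).trans ((measure_union_le _ _).trans ?_)) zero_le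
      rw [hm, h0, add_zero]
    exact absurd h3 h.1.ne'
  rw [measure_univ] at hle
  exact absurd hle (by simp)

/-- Choose `C` with `2C < ν {|y| > K}`. By contraposition of `measure_tail_le`, an increment over
mesh `T / 2 ^ N` exceeds `K` with probability more than `C T / 2 ^ N` for all large `N`, so `ρ =
e^{-CT}` works. -/
theorem IsPureJumpLevy.exists_eventually_measure_pow_le [IsProbabilityMeasure P]
    (hz : IsPureJumpLevy P z ν) {T : ℝ≥0} (hT : 0 < T) {K : ℝ} (hK : 0 < K)
    (hν : 0 < ν {y | K < |y|}) :
    ∃ ρ < (1 : ℝ≥0∞), ∀ᶠ N : ℕ in atTop, P {ω | |z (T / 2 ^ N) ω| ≤ K} ^ (2 ^ N) ≤ ρ := by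
  have hT0 : (0 : ℝ) < T := hT
  obtain ⟨C, hC0, hC⟩ : ∃ C : ℝ, 0 < C ∧ 2 * ENNReal.ofReal C < ν {y | K < |y|} := by
    obtain ⟨e, he0, he⟩ := ENNReal.lt_iff_exists_nnreal_btwn.1 hν
    refine ⟨e / 2, by have : 0 < e := by exact_mod_cast he0
                      positivity, ?_⟩
    rw [← ENNReal.ofReal_ofNat, ← ENNReal.ofReal_mul (by positivity), mul_div_cancel₀ _ two_ne_zero]
    simpa using he
  refine ⟨ENNReal.ofReal (Real.exp (-(C * T))), ?_, ?_⟩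
  · rw [ENNReal.ofReal_lt_one, Real.exp_lt_one_iff]
    have := mul_pos hC0 hT0
    linarith
  · have hev : ∀ᶠ N : ℕ in atTop, C * (T / 2 ^ N : ℝ≥0) < P.real {ω | K < |z (T / 2 ^ N) ω|} := by
      by_contra hcon
      rw [not_eventually] at hcon
      refine absurd (hz.measure_tail_le hK (t := fun N : ℕ ↦ T / 2 ^ N)
        (fun N ↦ by positivity) (tendsto_div_two_pow T) (C := C)
        (hcon.mono fun N hN ↦ not_lt.1 hN)) (not_le.2 hC)
    filter_upwards [hev] with N hN
    have hfin := measure_ne_top P {ω | |z (T / 2 ^ N) ω| ≤ K}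
    rw [← ENNReal.ofReal_toReal hfin, ← ENNReal.ofReal_pow ENNReal.toReal_nonneg, ← measureReal_def,
      hz.measureReal_abs_le]
    set p := P.real {ω | K < |z (T / 2 ^ N) ω|} with hp
    have hp1 : p ≤ 1 := measureReal_le_one
    refine ENNReal.ofReal_le_ofReal ?_
    have : 1 - p ≤ Real.exp (-p) := by linarith [Real.add_one_le_exp (-p)]
    refine (pow_le_pow_left₀ (by linarith) this _).trans ?_
    rw [← Real.exp_nat_mul]
    refine Real.exp_le_exp.2 ?_
    push_cast at hN ⊢
    have h6 : C * (T / 2 ^ N) * 2 ^ N = C * T := by field_simp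
    have : 0 < (2 : ℝ) ^ N := by positivity
    nlinarith

/-! ### Waiting for a large jump: independence of quiet blocks and later oscillations -/

theorem IsPureJumpLevy.measurableSet_quietEvent (hz : IsPureJumpLevy P z ν) (T : ℝ≥0) (K : ℝ)
    (j N : ℕ) : MeasurableSet (quietEvent z T K j N) := by
  have : quietEvent z T K j N = ⋂ k ∈ Finset.Ico (2 ^ N) (j * 2 ^ N),
      gridIncr z (T / 2 ^ N) k ⁻¹' {x | |x| ≤ K} := by
    ext ω
    simp [quietEvent]
  rw [this]
  exact Finset.measurableSet_biInter _ fun k _ ↦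
    hz.measurable_gridIncr _ k (measurableSet_abs_le K)

theorem IsPureJumpLevy.measurableSet_eventuallyQuiet (hz : IsPureJumpLevy P z ν) (T : ℝ≥0) (K : ℝ)
    (j : ℕ) : MeasurableSet (eventuallyQuiet z T K j) := by
  have : eventuallyQuiet z T K j = ⋃ M : ℕ, ⋂ N ≥ M, quietEvent z T K j N := by
    ext ω
    simp [eventuallyQuiet, eventually_atTop]
  rw [this]
  exact MeasurableSet.iUnion fun M ↦ MeasurableSet.iInter fun N ↦ MeasurableSet.iInter fun _ ↦
    hz.measurableSet_quietEvent T K j N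

/-- One factor for each block of `[T, j T]`; for `j = 0` and `j = 1` there is none, in accordance
with truncated subtraction. -/
theorem IsPureJumpLevy.measure_quietEvent (hz : IsPureJumpLevy P z ν) (T : ℝ≥0) (K : ℝ) (j N : ℕ) :
    P (quietEvent z T K j N) = (P {ω | |z (T / 2 ^ N) ω| ≤ K} ^ (2 ^ N)) ^ (j - 1) := by
  rw [quietEvent, hz.measure_forall_abs_gridIncr_le, ← pow_mul, Nat.card_Ico, Nat.mul_sub, mul_comm,
    mul_one]

/-- The event depends on increments before index `j * 2 ^ N`, the oscillation on those from there
on. -/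
theorem IsPureJumpLevy.lintegral_indicator_quietEvent (hz : IsPureJumpLevy P z ν) (T : ℝ≥0) (K q : ℝ)
    (j N : ℕ) :
    ∫⁻ ω, (quietEvent z T K j N).indicator
        (fun ω ↦ gridOsc z (T / 2 ^ N) (j * 2 ^ N) (2 ^ N) ω ^ q) ω ∂P
      = P (quietEvent z T K j N) * ∫⁻ ω, gridOsc z (T / 2 ^ N) 0 (2 ^ N) ω ^ q ∂P := by
  set ξ := gridIncr z (T / 2 ^ N) with hξ
  have hind := indep_iSup_of_disjoint (fun i ↦ (hz.measurable_gridIncr (T / 2 ^ N) i).comap_le)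
    (hz.iIndepFun_gridIncr (T / 2 ^ N)) (S := Ici (j * 2 ^ N)) (T := Iio (j * 2 ^ N))
    (Set.disjoint_left.2 fun i h1 h2 ↦ absurd (mem_Iio.1 h2) (not_lt.2 h1))
  have hq : MeasurableSet[⨆ i ∈ Iio (j * 2 ^ N), MeasurableSpace.comap (ξ i) inferInstance]
      (quietEvent z T K j N) := by
    have : quietEvent z T K j N = ⋂ k ∈ Finset.Ico (2 ^ N) (j * 2 ^ N),
        ξ k ⁻¹' {x | |x| ≤ K} := by
      ext ω
      simp [quietEvent, hξ]
    rw [this]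
    exact Finset.measurableSet_biInter _ fun k hk ↦
      measurable_biSup_comap (I := Iio (j * 2 ^ N)) (Finset.mem_Ico.1 hk).2 (measurableSet_abs_le K)
  have hg : Measurable[⨆ i ∈ Ici (j * 2 ^ N), MeasurableSpace.comap (ξ i) inferInstance]
      fun ω ↦ gridOsc z (T / 2 ^ N) (j * 2 ^ N) (2 ^ N) ω ^ q := by
    refine Measurable.pow_const (Measurable.comp (measurable_maxSum (2 ^ N)) ?_) q
    exact @measurable_pi_lambda _ _ _ (_) _ _ fun i ↦
      measurable_biSup_comap (I := Ici (j * 2 ^ N)) (mem_Ici.2 (Nat.le_add_right _ i))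
  have hm := hz.measurable_gridOsc (T / 2 ^ N) (j * 2 ^ N) (2 ^ N)
  have hle : ∀ I : Set ℕ, (⨆ i ∈ I, MeasurableSpace.comap (ξ i) inferInstance)
      ≤ (inferInstance : MeasurableSpace Ω) := fun I ↦
    iSup₂_le fun i _ ↦ (hz.measurable_gridIncr _ i).comap_le
  have hmul := lintegral_mul_eq_lintegral_mul_lintegral_of_independent_measurableSpace
    (hle (Ici (j * 2 ^ N))) (hle (Iio (j * 2 ^ N))) hind hg
    (g := (quietEvent z T K j N).indicator fun _ ↦ 1) (Measurable.indicator measurable_const hq)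
  rw [← hz.lintegral_gridOsc_rpow _ (j * 2 ^ N), mul_comm (P _)]
  rw [lintegral_indicator_const (hz.measurableSet_quietEvent T K j N), one_mul] at hmul
  rw [← hmul]
  refine lintegral_congr fun ω ↦ ?_
  by_cases hω : ω ∈ quietEvent z T K j N <;> simp [hω]

/-- On the eventually quiet event the integrand is the limit of its versions on the dyadic grids, so
Fatou's lemma transfers the product formula. -/
theorem IsPureJumpLevy.lintegral_indicator_eventuallyQuiet_le [IsProbabilityMeasure P]
    (hz : IsPureJumpLevy P z ν) (T : ℝ≥0) (K : ℝ) {q : ℝ} (hq : 0 ≤ q) {ρ : ℝ≥0∞}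
    (hρ : ∀ᶠ N : ℕ in atTop, P {ω | |z (T / 2 ^ N) ω| ≤ K} ^ (2 ^ N) ≤ ρ) (j : ℕ) :
    ∫⁻ ω, (eventuallyQuiet z T K j).indicator (fun ω ↦ blockOsc z T j ω ^ q) ω ∂P
      ≤ ρ ^ (j - 1) * ∫⁻ ω, blockOsc z T 0 ω ^ q ∂P := by
  set f : ℕ → Ω → ℝ≥0∞ := fun N ↦ (quietEvent z T K j N).indicator
    (fun ω ↦ gridOsc z (T / 2 ^ N) (j * 2 ^ N) (2 ^ N) ω ^ q) with hf
  have hfm : ∀ N, Measurable (f N) := fun N ↦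
    ((hz.measurable_gridOsc _ _ _).pow_const q).indicator (hz.measurableSet_quietEvent T K j N)
  calc ∫⁻ ω, (eventuallyQuiet z T K j).indicator (fun ω ↦ blockOsc z T j ω ^ q) ω ∂P
      ≤ ∫⁻ ω, liminf (fun N ↦ f N ω) atTop ∂P := by
        refine lintegral_mono fun ω ↦ ?_
        by_cases hω : ω ∈ eventuallyQuiet z T K j
        · rw [indicator_of_mem hω]
          have hlim := tendsto_atTop_iSup (gridOsc_mono z T j ω)
          have hlim' : Tendsto (fun N ↦ f N ω) atTop (𝓝 (blockOsc z T j ω ^ q)) := by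
            refine Tendsto.congr' ?_ ((ENNReal.continuous_rpow_const.tendsto _).comp hlim)
            filter_upwards [hω] with N hN
            simp [hf, indicator_of_mem hN]
          exact hlim'.liminf_eq.ge
        · rw [indicator_of_notMem hω]
          exact zero_le
    _ ≤ liminf (fun N ↦ ∫⁻ ω, f N ω ∂P) atTop := lintegral_liminf_le hfm
    _ ≤ liminf (fun _ : ℕ ↦ ρ ^ (j - 1) * ∫⁻ ω, blockOsc z T 0 ω ^ q ∂P) atTop := by
        refine liminf_le_liminf ?_
        filter_upwards [hρ] with N hN
        rw [hz.lintegral_indicator_quietEvent, hz.measure_quietEvent]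
        refine mul_le_mul' (pow_le_pow_left₀ zero_le hN _) (lintegral_mono fun ω ↦ ?_)
        refine ENNReal.rpow_le_rpow ?_ hq
        have := le_iSup (fun N : ℕ ↦ gridOsc z (T / 2 ^ N) (0 * 2 ^ N) (2 ^ N) ω) N
        simpa only [blockOsc, zero_mul] using this
    _ = _ := liminf_const _

theorem ENNReal_sum_rpow_le {q : ℝ} (hq0 : 0 < q) (hq1 : q ≤ 1) (v : ℕ → ℝ≥0∞) (n : ℕ) :
    (∑ i ∈ Finset.range n, v i) ^ q ≤ ∑ i ∈ Finset.range n, v i ^ q := by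
  induction n with
  | zero => simp [hq0]
  | succ n ih =>
    rw [Finset.sum_range_succ, Finset.sum_range_succ]
    exact (ENNReal.rpow_add_le_add_rpow _ _ hq0.le hq1).trans (add_le_add ih le_rfl)

theorem ENNReal_tsum_pow_pred_lt_top {ρ : ℝ≥0∞} (hρ : ρ < 1) : ∑' j : ℕ, ρ ^ (j - 1) < ∞ := by
  rw [tsum_eq_zero_add' ENNReal.summable]
  simp only [Nat.add_sub_cancel]
  rw [ENNReal.tsum_geometric]
  refine ENNReal.add_lt_top.2 ⟨by simp, ?_⟩
  rw [ENNReal.inv_lt_top]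
  exact tsub_pos_of_lt hρ

/-- Up to the first large jump after time `T`, the process `z` is controlled by an integrable random
variable. -/
theorem IsPureJumpLevy.exists_control [IsProbabilityMeasure P] (hz : IsPureJumpLevy P z ν)
    {T : ℝ≥0} (hT : 0 < T) {K q : ℝ} (hK : 0 < K) (hq0 : 0 < q) (hq1 : q ≤ 1)
    (hν : 0 < ν {y | K < |y|}) (hosc : ∫⁻ ω, blockOsc z T 0 ω ^ q ∂P < ∞) :
    ∃ W : Ω → ℝ≥0∞, Measurable W ∧ ∫⁻ ω, W ω ∂P < ∞ ∧ ∀ᵐ ω ∂P, T ≤ waitTime z T K ω ∧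
      ∀ s ≤ waitTime z T K ω, ‖z s ω‖ₑ ^ q ≤ W ω := by
  obtain ⟨ρ, hρ1, hρ⟩ := hz.exists_eventually_measure_pow_le hT hK hν
  set g : ℕ → Ω → ℝ≥0∞ := fun j ↦
    (eventuallyQuiet z T K j).indicator (fun ω ↦ blockOsc z T j ω ^ q) with hg
  have hgm : ∀ j, Measurable (g j) := fun j ↦
    ((hz.measurable_blockOsc T j).pow_const q).indicator (hz.measurableSet_eventuallyQuiet T K j)
  -- The oscillation of block `j` counts only if no large increment has occurred before it, which
  -- makes the expectations decay geometrically.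
  refine ⟨fun ω ↦ ∑' j, g j ω, Measurable.tsum hgm, ?_, ?_⟩
  · rw [lintegral_tsum fun j ↦ (hgm j).aemeasurable]
    refine (ENNReal.tsum_le_tsum fun j ↦
      hz.lintegral_indicator_eventuallyQuiet_le T K hq0.le hρ j).trans_lt ?_
    rw [ENNReal.tsum_mul_right]
    exact ENNReal.mul_lt_top (ENNReal_tsum_pow_pred_lt_top hρ1) hosc
  · have hnull : P (⋂ j, eventuallyQuiet z T K j) = 0 := by
      have hle : ∀ j : ℕ, P (⋂ j, eventuallyQuiet z T K j) ≤ ρ ^ j := fun j ↦ by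
        -- With exponent `0` the estimate bounds the probability of the event itself.
        have := hz.lintegral_indicator_eventuallyQuiet_le T K le_rfl hρ (j + 1)
        simp only [ENNReal.rpow_zero, lintegral_const, measure_univ, mul_one,
          Nat.add_sub_cancel] at this
        rw [lintegral_indicator_const (hz.measurableSet_eventuallyQuiet T K _), one_mul] at this
        exact (measure_mono (iInter_subset _ _)).trans this
      exact le_antisymm (ge_of_tendsto'
        (ENNReal.tendsto_pow_atTop_nhds_zero_of_lt_one hρ1) hle) zero_le
    filter_upwards [compl_mem_ae_iff.2 hnull] with ω hω
    have hex : ∃ j, ω ∉ eventuallyQuiet z T K j := by simpa using hω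
    classical
    have hj := Nat.find_spec hex
    obtain ⟨h1, h2⟩ := waitTime_mem_of_notMem_eventuallyQuiet hK (hz.cadlag ω) hj
    refine ⟨h1, fun s hs ↦ ?_⟩
    -- If `J` is the first index that is not eventually quiet, then `τ ≤ J T`, and each block before
    -- `J` is counted in the control variable.
    calc ‖z s ω‖ₑ ^ q ≤ (∑ i ∈ Finset.range (Nat.find hex), blockOsc z T i ω) ^ q :=
          ENNReal.rpow_le_rpow (enorm_le_sum_blockOsc hT (hz.cadlag ω) (hz.zero ω) _ (hs.trans h2))
            hq0.le
      _ ≤ ∑ i ∈ Finset.range (Nat.find hex), blockOsc z T i ω ^ q := ENNReal_sum_rpow_le hq0 hq1 _ _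
      _ = ∑ i ∈ Finset.range (Nat.find hex), g i ω := by
          refine Finset.sum_congr rfl fun i hi ↦ ?_
          have : ω ∈ eventuallyQuiet z T K i := not_not.1 (Nat.find_min hex (Finset.mem_range.1 hi))
          simp [hg, indicator_of_mem this]
      _ ≤ ∑' i, g i ω := ENNReal.sum_le_tsum _


/-! ### Exponential moments of exit times of Markov chains -/

theorem finsetSum_lintegral_le {α ι : Type*} [MeasurableSpace α] (μ : Measure α) (s : Finset ι)
    (f : ι → α → ℝ≥0∞) : ∑ i ∈ s, ∫⁻ a, f i a ∂μ ≤ ∫⁻ a, ∑ i ∈ s, f i a ∂μ := by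
  classical
  induction s using Finset.induction_on with
  | empty => simp
  | insert i s hi ih =>
    simp only [Finset.sum_insert hi]
    exact (add_le_add le_rfl ih).trans (le_lintegral_add _ _)

/-- `κ` is not assumed to depend measurably on the state. The inequality survives through simple
functions, because the lower integral is superadditive. -/
theorem IsMarkovChain.setLIntegral_succ_le {Ω' G : Type*} [MeasurableSpace Ω'] [MeasurableSpace G]
    {P' : Measure Ω'} {S : ℕ → Ω' → G} {κ : G → Measure G} {u : G} (hS : IsMarkovChain P' S κ u)
    (n : ℕ) {D : Set Ω'}
    (hD : MeasurableSet[⨆ (i : ℕ) (_ : i ≤ n), MeasurableSpace.comap (S i) inferInstance] D)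
    {g : G → ℝ≥0∞} (hg : Measurable g) :
    ∫⁻ ω in D, g (S (n + 1) ω) ∂P' ≤ ∫⁻ ω in D, ∫⁻ w, g w ∂(κ (S n ω)) ∂P' := by
  have hD' : MeasurableSet D :=
    (iSup₂_le fun i _ ↦ (hS.measurable i).comap_le : _ ≤ (inferInstance : MeasurableSpace Ω')) _ hD
  rw [← lintegral_map hg (hS.measurable (n + 1)), lintegral_def]
  refine iSup₂_le fun φ hφ ↦ ?_
  rw [SimpleFunc.lintegral]
  calc ∑ x ∈ φ.range, x * ((P'.restrict D).map (S (n + 1))) (φ ⁻¹' {x})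
      = ∑ x ∈ φ.range, x * ∫⁻ ω in D, κ (S n ω) (φ ⁻¹' {x}) ∂P' := by
        refine Finset.sum_congr rfl fun x _ ↦ ?_
        have hm := φ.measurableSet_fiber x
        rw [Measure.map_apply (hS.measurable _) hm,
          Measure.restrict_apply (hS.measurable _ hm), inter_comm, hS.step n _ D hm hD]
    _ ≤ ∑ x ∈ φ.range, ∫⁻ ω in D, x * κ (S n ω) (φ ⁻¹' {x}) ∂P' :=
        Finset.sum_le_sum fun x _ ↦ lintegral_const_mul_le _ _
    _ ≤ ∫⁻ ω in D, ∑ x ∈ φ.range, x * κ (S n ω) (φ ⁻¹' {x}) ∂P' := finsetSum_lintegral_le _ _ _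
    _ ≤ ∫⁻ ω in D, ∫⁻ w, g w ∂(κ (S n ω)) ∂P' := by
        refine lintegral_mono fun ω ↦ ?_
        change φ.lintegral (κ (S n ω)) ≤ _
        rw [← SimpleFunc.lintegral_eq_lintegral]
        exact lintegral_mono hφ

/-- The event that a chain stays in `A` at the times `1, …, n`. -/
def stayEvent {Ω' G : Type*} (S : ℕ → Ω' → G) (A : Set G) (n : ℕ) : Set Ω' :=
  {ω | ∀ k, 0 < k → k ≤ n → S k ω ∈ A}

theorem stayEvent_succ {Ω' G : Type*} (S : ℕ → Ω' → G) (A : Set G) (n : ℕ) :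
    stayEvent S A (n + 1) = stayEvent S A n ∩ S (n + 1) ⁻¹' A := by
  ext ω
  refine ⟨fun h ↦ ⟨fun k h0 hk ↦ h k h0 (hk.trans n.le_succ), h _ n.succ_pos le_rfl⟩,
    fun h k h0 hk ↦ ?_⟩
  rcases Nat.lt_or_eq_of_le hk with h1 | rfl
  · exact h.1 k h0 (Nat.lt_succ_iff.1 h1)
  · exact h.2

theorem measurableSet_stayEvent {Ω' G : Type*} [MeasurableSpace G] (S : ℕ → Ω' → G) {A : Set G}
    (hA : MeasurableSet A) (n : ℕ) :
    MeasurableSet[⨆ (i : ℕ) (_ : i ≤ n), MeasurableSpace.comap (S i) inferInstance]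
      (stayEvent S A n) := by
  have : stayEvent S A n = ⋂ k ∈ Finset.Icc 1 n, S k ⁻¹' A := by
    ext ω
    simp [stayEvent, Nat.succ_le_iff]
  rw [this]
  refine Finset.measurableSet_biInter _ fun k hk ↦ ?_
  exact measurable_iff_comap_le.2 (le_iSup₂_of_le (f := fun (i : ℕ) (_ : i ≤ n) ↦
    MeasurableSpace.comap (S i) inferInstance) k (Finset.mem_Icc.1 hk).2 le_rfl) hA

/-- Each step restricted to `A` costs a factor `r`, by conditioning on the past up to time `n`,
which determines `stayEvent S A n`. -/
theorem IsMarkovChain.setLIntegral_stayEvent_le {Ω' G : Type*} [MeasurableSpace Ω']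
    [MeasurableSpace G] {P' : Measure Ω'} [IsProbabilityMeasure P'] {S : ℕ → Ω' → G}
    {κ : G → Measure G} {u : G} (hS : IsMarkovChain P' S κ u) {Φ : G → ℝ≥0∞} (hΦ : Measurable Φ)
    {A : Set G} (hA : MeasurableSet A) {r : ℝ≥0∞} (hr : r ≠ ∞)
    (h : ∀ v, ∫⁻ w in A, Φ w ∂(κ v) ≤ r * Φ v) (n : ℕ) :
    ∫⁻ ω in stayEvent S A n, Φ (S n ω) ∂P' ≤ r ^ n * Φ u := by
  induction n with
  | zero =>
    refine (setLIntegral_le_lintegral _ _).trans ?_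
    rw [lintegral_congr_ae (g := fun _ ↦ Φ u) (hS.init.mono fun ω hω ↦ by simp only [hω])]
    simp
  | succ n ih =>
    rw [stayEvent_succ, inter_comm, ← Measure.restrict_restrict (hS.measurable _ hA),
      ← lintegral_indicator (hS.measurable _ hA)]
    calc ∫⁻ ω in stayEvent S A n, (S (n + 1) ⁻¹' A).indicator (fun ω ↦ Φ (S (n + 1) ω)) ω ∂P'
        = ∫⁻ ω in stayEvent S A n, A.indicator Φ (S (n + 1) ω) ∂P' := rfl
      _ ≤ ∫⁻ ω in stayEvent S A n, ∫⁻ w, A.indicator Φ w ∂(κ (S n ω)) ∂P' :=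
          hS.setLIntegral_succ_le n (measurableSet_stayEvent S hA n) (hΦ.indicator hA)
      _ ≤ ∫⁻ ω in stayEvent S A n, r * Φ (S n ω) ∂P' := by
          refine lintegral_mono fun ω ↦ ?_
          rw [lintegral_indicator hA]
          exact h _
      _ = r * ∫⁻ ω in stayEvent S A n, Φ (S n ω) ∂P' := lintegral_const_mul' _ _ hr
      _ ≤ r * (r ^ n * Φ u) := by gcongr
      _ = r ^ (n + 1) * Φ u := by ring

/-- If the chain is first close at time `N + 1`, the `N`-th term dominates; if it is never close,
every term is at least `1` and the series diverges. -/
theorem expENat_meetTime_le {Ω' : Type*} (S : ℕ → Ω' → Plane × Plane) (d : ℝ) {θ : ℝ} (hθ : 0 < θ)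
    (ω : Ω') : expENat θ (meetTime S d ω) ≤ ∑' n : ℕ,
      (stayEvent S {u | d < ‖u.1 - u.2‖} n).indicator
        (fun _ ↦ ENNReal.ofReal (Real.exp (θ * (n + 1)))) ω := by
  by_cases hall : ∀ n, ω ∈ stayEvent S {u | d < ‖u.1 - u.2‖} n
  · have : ∑' n : ℕ, (stayEvent S {u | d < ‖u.1 - u.2‖} n).indicator
        (fun _ ↦ ENNReal.ofReal (Real.exp (θ * (n + 1)))) ω = ∞ := by
      refine top_unique ?_
      rw [← ENNReal.tsum_const_eq_top_of_ne_zero (α := ℕ) (c := 1) one_ne_zero]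
      refine ENNReal.tsum_le_tsum fun n ↦ ?_
      rw [indicator_of_mem (hall n), ENNReal.one_le_ofReal, Real.one_le_exp_iff]
      positivity
    rw [this]
    exact le_top
  · push Not at hall
    classical
    obtain ⟨N, hN, hmin⟩ : ∃ N, ω ∉ stayEvent S {u | d < ‖u.1 - u.2‖} (N + 1) ∧
        ω ∈ stayEvent S {u | d < ‖u.1 - u.2‖} N := by
      have h1 := Nat.find_spec hall
      rcases hf : Nat.find hall with - | N
      · rw [hf] at h1
        exact absurd (fun k h0 hk ↦ by omega) h1
      · rw [hf] at h1
        exact ⟨N, h1, not_not.1 (Nat.find_min hall (by omega))⟩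
    have hclose : ‖(S (N + 1) ω).1 - (S (N + 1) ω).2‖ ≤ d := by
      rw [stayEvent_succ] at hN
      by_contra hcon
      exact hN ⟨hmin, not_le.1 hcon⟩
    have hle : meetTime S d ω ≤ ((N + 1 : ℕ) : ℕ∞) :=
      iInf₂_le_of_le (N + 1) ⟨N.succ_pos, hclose⟩ le_rfl
    have hne : meetTime S d ω ≠ ⊤ := ne_top_of_le_ne_top (ENat.natCast_ne_top _) hle
    have hto : (meetTime S d ω).toNat ≤ N + 1 := by
      have := ENat.toNat_le_toNat hle (ENat.natCast_ne_top _)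
      rwa [ENat.toNat_natCast] at this
    refine le_trans ?_ (ENNReal.le_tsum N)
    rw [indicator_of_mem hmin, expENat, if_neg hne]
    refine ENNReal.ofReal_le_ofReal (Real.exp_le_exp.2 ?_)
    have : ((meetTime S d ω).toNat : ℝ) ≤ N + 1 := by exact_mod_cast hto
    gcongr

/-- A chain whose exit events have geometrically small probability meets at a time with
exponential moments. -/
theorem lintegral_expENat_le {Ω' : Type*} [MeasurableSpace Ω'] {P' : Measure Ω'}
    [IsProbabilityMeasure P'] {S : ℕ → Ω' → Plane × Plane} (hS : ∀ n, Measurable (S n)) {d : ℝ}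
    {r H s : ℝ} (hr0 : 0 < r) (hr1 : r < 1) (hH : 0 ≤ H) (hs0 : 0 < s) (hs1 : s ≤ 1)
    (h : ∀ n, P' (stayEvent S {u | d < ‖u.1 - u.2‖} n) ≤ ENNReal.ofReal (r ^ n * H)) :
    ∫⁻ ω, expENat (-(s / 2) * Real.log r) (meetTime S d ω) ∂P'
      ≤ ENNReal.ofReal (r ^ (-(s / 2)) * (1 - r ^ (s / 2))⁻¹ * H ^ s) := by
  have hlog : Real.log r < 0 := Real.log_neg hr0 hr1
  have hθ : 0 < -(s / 2) * Real.log r := by nlinarith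
  have hρ1 : r ^ (s / 2) < 1 := Real.rpow_lt_one hr0.le hr1 (by positivity)
  have hρ0 : 0 < r ^ (s / 2) := Real.rpow_pos_of_pos hr0 _
  have hbad : MeasurableSet {u : Plane × Plane | d < ‖u.1 - u.2‖} :=
    measurableSet_lt measurable_const (by fun_prop)
  have hstay : ∀ n, MeasurableSet (stayEvent S {u | d < ‖u.1 - u.2‖} n) := fun n ↦
    (iSup₂_le fun i _ ↦ (hS i).comap_le : _ ≤ (inferInstance : MeasurableSpace Ω')) _
      (measurableSet_stayEvent S hbad n)
  have hterm : ∀ n : ℕ, ENNReal.ofReal (Real.exp (-(s / 2) * Real.log r * (n + 1)))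
      * P' (stayEvent S {u | d < ‖u.1 - u.2‖} n)
      ≤ ENNReal.ofReal (r ^ (-(s / 2)) * H ^ s * (r ^ (s / 2)) ^ n) := fun n ↦ by
    -- A probability bounded by `b` is also bounded by `b ^ s`, since either `b ≤ 1` or `b ^ s ≥ 1`.
    -- Half of the decay `r ^ (s * n)` then pays for the exponential weight, the other half makes
    -- the series converge.
    have hP : P' (stayEvent S {u | d < ‖u.1 - u.2‖} n) ≤ ENNReal.ofReal ((r ^ n * H) ^ s) := by
      rcases le_total (r ^ n * H) 1 with h1 | h1
      · refine (h n).trans (ENNReal.ofReal_le_ofReal ?_)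
        have h0 : 0 ≤ r ^ n * H := by positivity
        calc r ^ n * H = (r ^ n * H) ^ (1 : ℝ) := (Real.rpow_one _).symm
          _ ≤ (r ^ n * H) ^ s := Real.rpow_le_rpow_of_exponent_ge' h0 h1 hs0.le hs1
      · refine prob_le_one.trans ?_
        rw [ENNReal.one_le_ofReal]
        exact Real.one_le_rpow h1 hs0.le
    refine (mul_le_mul' le_rfl hP).trans ?_
    rw [← ENNReal.ofReal_mul (Real.exp_pos _).le]
    refine ENNReal.ofReal_le_ofReal (le_of_eq ?_)
    have e1 : Real.exp (-(s / 2) * Real.log r * (n + 1)) = r ^ (-(s / 2)) * r ^ (-(s / 2) * n) := by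
      rw [← Real.rpow_add hr0, Real.rpow_def_of_pos hr0]
      congr 1
      ring
    have e2 : (r ^ n * H) ^ s = r ^ (s * n) * H ^ s := by
      rw [Real.mul_rpow (by positivity) hH, ← Real.rpow_natCast r n, ← Real.rpow_mul hr0.le,
        mul_comm s]
    have e3 : (r ^ (s / 2)) ^ n = r ^ (-(s / 2) * n) * r ^ (s * n) := by
      rw [← Real.rpow_natCast (r ^ (s / 2)) n, ← Real.rpow_mul hr0.le, ← Real.rpow_add hr0]
      congr 1
      ring
    rw [e1, e2, e3]
    ring
  calc ∫⁻ ω, expENat (-(s / 2) * Real.log r) (meetTime S d ω) ∂P'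
      ≤ ∫⁻ ω, ∑' n : ℕ, (stayEvent S {u | d < ‖u.1 - u.2‖} n).indicator
          (fun _ ↦ ENNReal.ofReal (Real.exp (-(s / 2) * Real.log r * (n + 1)))) ω ∂P' :=
        lintegral_mono fun ω ↦ expENat_meetTime_le S d hθ ω
    _ = ∑' n : ℕ, ENNReal.ofReal (Real.exp (-(s / 2) * Real.log r * (n + 1)))
          * P' (stayEvent S {u | d < ‖u.1 - u.2‖} n) := by
        rw [lintegral_tsum fun n ↦ (measurable_const.indicator (hstay n)).aemeasurable]
        exact tsum_congr fun n ↦ lintegral_indicator_const (hstay n) _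
    _ ≤ ∑' n : ℕ, ENNReal.ofReal (r ^ (-(s / 2)) * H ^ s * (r ^ (s / 2)) ^ n) :=
        ENNReal.tsum_le_tsum hterm
    _ = ENNReal.ofReal (∑' n : ℕ, r ^ (-(s / 2)) * H ^ s * (r ^ (s / 2)) ^ n) :=
        (ENNReal.ofReal_tsum_of_nonneg (fun n ↦ by positivity)
          ((summable_geometric_of_lt_one hρ0.le hρ1).mul_left _)).symm
    _ = _ := by
        rw [tsum_mul_left, tsum_geometric_of_lt_one hρ0.le hρ1]
        congr 1
        ring

/-- The choice of `R` makes `ρ v + C ≤ (1 + ρ) / 2 * v` beyond `R`. The constant `A` is so large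
that half of the gain `A c` absorbs `ρ R + C` below `R`. The ratio `(A + (1 + ρ) / 2 * v) / (A + v)`
decreases in `v`, and `r₁` is its value at `R`. -/
theorem exists_contraction {ρ C c R : ℝ} (hρ0 : 0 ≤ ρ) (hρ1 : ρ < 1) (hC : 0 < C) (hc0 : 0 < c)
    (hc1 : c ≤ 1) (hR : R = 2 * C / (1 - ρ)) :
    ∃ A > 0, ∃ r, 0 < r ∧ r < 1 ∧ (∀ v > R, A + ρ * v + C ≤ r * (A + v)) ∧
      ∀ v, 0 ≤ v → v ≤ R → A * (1 - c) + ρ * v + C ≤ r * (A + v) := by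
  have h1ρ : 0 < 1 - ρ := by linarith
  have hR0 : 0 < R := by rw [hR]; positivity
  have hCR : C = (1 - ρ) * R / 2 := by rw [hR]; field_simp
  set A := 2 * (ρ * R + C) / c with hA
  have hA0 : 0 < A := by positivity
  have hAc : A * c = 2 * (ρ * R + C) := by rw [hA]; field_simp
  set r₁ := (A + (1 + ρ) / 2 * R) / (A + R) with hr₁
  have hAR : 0 < A + R := by positivity
  have hr₁eq : r₁ * (A + R) = A + (1 + ρ) / 2 * R := by rw [hr₁]; field_simp
  have hr₁1 : r₁ < 1 := by
    rw [hr₁, div_lt_one hAR]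
    nlinarith
  have hr₁ρ : (1 + ρ) / 2 ≤ r₁ := by
    rw [hr₁, le_div_iff₀ hAR]
    nlinarith
  refine ⟨A, hA0, max r₁ (1 - c / 2), lt_max_of_lt_right (by linarith), max_lt hr₁1 (by linarith),
    fun v hv ↦ ?_, fun v hv0 hv ↦ ?_⟩
  · have hv0 : 0 < v := hR0.trans hv
    calc A + ρ * v + C ≤ A + (1 + ρ) / 2 * v := by nlinarith
      _ ≤ r₁ * (A + v) := by nlinarith
      _ ≤ _ := mul_le_mul_of_nonneg_right (le_max_left _ _) (by positivity)
  · calc A * (1 - c) + ρ * v + C ≤ (1 - c / 2) * A := by nlinarith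
      _ ≤ (1 - c / 2) * (A + v) := by nlinarith
      _ ≤ _ := mul_le_mul_of_nonneg_right (le_max_right _ _) (by positivity)


/-! ### The transition probabilities of the coupling chain -/

/-- The integrals over `A` and its complement are opposite, so each uses at most half of the `L¹`
norm. -/
theorem two_mul_abs_setIntegral_le {α : Type*} [MeasurableSpace α] {μ : Measure α} {f : α → ℝ}
    (hf : Integrable f μ) (h0 : ∫ x, f x ∂μ = 0) {A : Set α} (hA : MeasurableSet A) :
    2 * |∫ x in A, f x ∂μ| ≤ ∫ x, |f x| ∂μ := by
  have h1 := integral_add_compl hA hf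
  have h2 := integral_add_compl hA hf.abs
  have h3 : |∫ x in A, f x ∂μ| ≤ ∫ x in A, |f x| ∂μ := abs_integral_le_integral_abs
  have h4 : |∫ x in Aᶜ, f x ∂μ| ≤ ∫ x in Aᶜ, |f x| ∂μ := abs_integral_le_integral_abs
  have h5 : ∫ x in Aᶜ, f x ∂μ = -∫ x in A, f x ∂μ := by linarith
  rw [h5, abs_neg] at h4
  linarith

/-- The total variation distance of two translates of a law is half the `L¹` distance of the
translates of its density. -/
theorem tvDist_map_add_le {μ : Measure ℝ} [IsProbabilityMeasure μ] {f : ℝ → ℝ} (hf : Measurable f)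
    (hf0 : ∀ u, 0 ≤ f u) (hμ : μ = volume.withDensity fun u ↦ ENNReal.ofReal (f u)) (a b : ℝ) :
    tvDist (μ.map fun η ↦ a + η) (μ.map fun η ↦ b + η) ≤ (∫ u, |f (u - a) - f (u - b)|) / 2 := by
  have hInt : Integrable f := by
    refine ⟨hf.aestronglyMeasurable, ?_⟩
    rw [hasFiniteIntegral_iff_ofReal (Eventually.of_forall hf0)]
    have : μ univ = ∫⁻ u, ENNReal.ofReal (f u) := by
      rw [hμ, withDensity_apply _ MeasurableSet.univ, Measure.restrict_univ]
    rw [← this, measure_univ]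
    exact ENNReal.one_lt_top
  have hInt' : ∀ c : ℝ, Integrable fun u ↦ f (u - c) := fun c ↦ hInt.comp_sub_right c
  have hreal : ∀ c : ℝ, ∀ A : Set ℝ, MeasurableSet A →
      (μ.map fun η ↦ c + η).real A = ∫ u in A, f (u - c) := fun c A hA ↦ by
    have hm : Measurable fun η : ℝ ↦ c + η := by fun_prop
    rw [measureReal_def, Measure.map_apply hm hA, hμ, withDensity_apply _ (hm hA),
      ← lintegral_indicator (hm hA),
      ← lintegral_sub_right_eq_self (μ := volume) _ c,
      integral_eq_lintegral_of_nonneg_ae (Eventually.of_forall fun u ↦ hf0 _)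
        (hInt' c).aestronglyMeasurable.restrict, ← lintegral_indicator hA]
    congr 1
    refine lintegral_congr fun u ↦ ?_
    by_cases hu : u ∈ A
    · rw [indicator_of_mem hu, indicator_of_mem (by simpa using hu)]
    · rw [indicator_of_notMem hu, indicator_of_notMem (by simpa using hu)]
  refine ciSup_le fun A ↦ ?_
  rw [hreal a A A.2, hreal b A A.2, ← integral_sub (hInt' a).integrableOn (hInt' b).integrableOn]
  have h0 : ∫ u, (f (u - a) - f (u - b)) = 0 := by
    rw [integral_sub (hInt' a) (hInt' b), integral_sub_right_eq_self f a,
      integral_sub_right_eq_self f b, sub_self]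
  have := two_mul_abs_setIntegral_le ((hInt' a).sub (hInt' b)) h0 A.2
  simp only [Pi.sub_apply] at this
  linarith

/-- Upper bounds suffice for the contraction. Stated as an inequality, the formula requires
measurability neither of the solution at `τ-` nor of `postJumpLaw`. -/
theorem lintegral_couplingTransition_le {Ω : Type*} [MeasurableSpace Ω] (P : Measure Ω)
    (z : ℝ≥0 → Ω → ℝ) (T : ℝ≥0) (K : ℝ) (X : Plane → ℝ≥0 → Ω → Plane) (Q : Kernel (ℝ × ℝ) (ℝ × ℝ))
    (u : Plane × Plane) {g : Plane × Plane → ℝ≥0∞} (hg : Measurable g) :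
    ∫⁻ w, g w ∂(couplingTransition P z T K X Q u) ≤ ∫⁻ ω, ∫⁻ ξ,
      g (!₂[ξ.1, Function.leftLim (fun t ↦ X u.1 t ω) (waitTime z T K ω) 1],
        !₂[ξ.2, Function.leftLim (fun t ↦ X u.2 t ω) (waitTime z T K ω) 1])
      ∂(Q (Function.leftLim (fun t ↦ X u.1 t ω) (waitTime z T K ω) 0,
        Function.leftLim (fun t ↦ X u.2 t ω) (waitTime z T K ω) 0)) ∂P := by
  refine (Measure.lintegral_bind_le _ _ _).trans ((lintegral_map_le _ _).trans (le_of_eq ?_))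
  refine lintegral_congr fun ω ↦ ?_
  rw [postJumpLaw, lintegral_map hg]
  refine Measurable.prodMk ?_ ?_ <;>
  · refine (WithLp.measurable_toLp 2 _).comp (measurable_pi_lambda _ fun i ↦ ?_)
    fin_cases i <;> simp <;> fun_prop

/-- The Lyapunov function of the coupling chain. -/
noncomputable def lyapunov (q : ℝ) (u : Plane × Plane) : ℝ≥0∞ :=
  (‖u.1 0‖ₑ ^ q + ‖u.1 1‖ₑ ^ q) + (‖u.2 0‖ₑ ^ q + ‖u.2 1‖ₑ ^ q)

theorem measurable_lyapunov (q : ℝ) : Measurable (lyapunov q) := by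
  unfold lyapunov
  fun_prop

theorem enorm_rpow_eq {q : ℝ} (hq : 0 ≤ q) (x : ℝ) : ‖x‖ₑ ^ q = ENNReal.ofReal (|x| ^ q) := by
  rw [Real.enorm_eq_ofReal_abs, ENNReal.ofReal_rpow_of_nonneg (abs_nonneg _) hq]

theorem lyapunov_eq {q : ℝ} (hq : 0 ≤ q) (u : Plane × Plane) : lyapunov q u
    = ENNReal.ofReal ((|u.1 0| ^ q + |u.1 1| ^ q) + (|u.2 0| ^ q + |u.2 1| ^ q)) := by
  rw [lyapunov, enorm_rpow_eq hq, enorm_rpow_eq hq, enorm_rpow_eq hq, enorm_rpow_eq hq,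
    ← ENNReal.ofReal_add (by positivity) (by positivity),
    ← ENNReal.ofReal_add (by positivity) (by positivity),
    ← ENNReal.ofReal_add (by positivity) (by positivity)]

/-! ### Moments and success probability of the maximal coupling -/

section Coupling

variable {ν : Measure ℝ} {K : ℝ} {Q : Kernel (ℝ × ℝ) (ℝ × ℝ)}

theorem IsMaximalCouplingKernel.isProbabilityMeasure (hQ : IsMaximalCouplingKernel ν K Q)
    (hK : 0 < bigJumpRate ν K) (v : ℝ × ℝ) : IsProbabilityMeasure (Q v) := by
  have := isProbabilityMeasure_bigJumpLaw hK
  refine ⟨?_⟩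
  have h := congrArg (fun μ : Measure ℝ ↦ μ univ) (hQ v.1 v.2).fst
  simp only [Measure.map_apply measurable_fst MeasurableSet.univ, preimage_univ] at h
  rw [Prod.mk.eta] at h
  rw [h, Measure.map_apply (by fun_prop) MeasurableSet.univ, preimage_univ, measure_univ]

theorem lintegral_map_add_rpow_le {μ : Measure ℝ} [IsProbabilityMeasure μ] {q : ℝ} (hq0 : 0 ≤ q)
    (hq1 : q ≤ 1) (a : ℝ) :
    ∫⁻ x, ‖x‖ₑ ^ q ∂(μ.map fun η ↦ a + η) ≤ ‖a‖ₑ ^ q + ∫⁻ η, ‖η‖ₑ ^ q ∂μ := by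
  rw [lintegral_map (by fun_prop) (by fun_prop)]
  calc ∫⁻ η, ‖a + η‖ₑ ^ q ∂μ ≤ ∫⁻ η, (‖a‖ₑ ^ q + ‖η‖ₑ ^ q) ∂μ := by
        refine lintegral_mono fun η ↦ ?_
        exact (ENNReal.rpow_le_rpow (enorm_add_le _ _) hq0).trans
          (ENNReal.rpow_add_le_add_rpow _ _ hq0 hq1)
    _ = _ := by rw [lintegral_add_left measurable_const]; simp

theorem IsMaximalCouplingKernel.lintegral_fst_le (hQ : IsMaximalCouplingKernel ν K Q)
    (hK : 0 < bigJumpRate ν K) {q : ℝ} (hq0 : 0 ≤ q) (hq1 : q ≤ 1) (a b : ℝ) :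
    ∫⁻ ξ, ‖ξ.1‖ₑ ^ q ∂(Q (a, b)) ≤ ‖a‖ₑ ^ q + ∫⁻ η, ‖η‖ₑ ^ q ∂(bigJumpLaw ν K) := by
  have := isProbabilityMeasure_bigJumpLaw hK
  rw [← lintegral_map (f := fun x : ℝ ↦ ‖x‖ₑ ^ q) (by fun_prop) measurable_fst, (hQ a b).fst]
  exact lintegral_map_add_rpow_le hq0 hq1 a

theorem IsMaximalCouplingKernel.lintegral_snd_le (hQ : IsMaximalCouplingKernel ν K Q)
    (hK : 0 < bigJumpRate ν K) {q : ℝ} (hq0 : 0 ≤ q) (hq1 : q ≤ 1) (a b : ℝ) :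
    ∫⁻ ξ, ‖ξ.2‖ₑ ^ q ∂(Q (a, b)) ≤ ‖b‖ₑ ^ q + ∫⁻ η, ‖η‖ₑ ^ q ∂(bigJumpLaw ν K) := by
  have := isProbabilityMeasure_bigJumpLaw hK
  rw [← lintegral_map (f := fun x : ℝ ↦ ‖x‖ₑ ^ q) (by fun_prop) measurable_snd, (hQ a b).snd]
  exact lintegral_map_add_rpow_le hq0 hq1 b

theorem IsMaximalCouplingKernel.measure_ne_le (hQ : IsMaximalCouplingKernel ν K Q)
    (hK : 0 < bigJumpRate ν K) {pK : ℝ → ℝ} (hp : Measurable pK) (hp0 : ∀ u, 0 ≤ pK u)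
    (hd : bigJumpLaw ν K = volume.withDensity fun u ↦ ENNReal.ofReal (pK u)) {a b β : ℝ}
    (h : ∫ u, |pK (u - a) - pK (u - b)| ≤ β) :
    Q (a, b) {ξ | ξ.1 ≠ ξ.2} ≤ ENNReal.ofReal (β / 2) := by
  have := isProbabilityMeasure_bigJumpLaw hK
  have := hQ.isProbabilityMeasure hK (a, b)
  rw [← ENNReal.ofReal_toReal (measure_ne_top (Q (a, b)) _), ← measureReal_def, (hQ a b).maximal]
  refine ENNReal.ofReal_le_ofReal ((tvDist_map_add_le hp hp0 hd a b).trans ?_)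
  linarith

end Coupling

theorem le_of_tendsto_exp_bound {l t x c : ℝ} {f : ℝ≥0 → ℝ} {τ : ℝ≥0} (hτ : 0 < τ) {y : ℝ}
    (hf : Tendsto f (𝓝[<] τ) (𝓝 y)) (htτ : t ≤ τ) (hl : 0 < l)
    (h : ∀ s < τ, |f s| ≤ Real.exp (-l * s) * |x| + c) : |y| ≤ Real.exp (-l * t) * |x| + c := by
  have : (𝓝[<] τ).NeBot := nhdsLT_neBot_of_exists_lt ⟨0, hτ⟩
  have hlim : Tendsto (fun s : ℝ≥0 ↦ Real.exp (-l * s) * |x| + c) (𝓝[<] τ)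
      (𝓝 (Real.exp (-l * τ) * |x| + c)) :=
    (Continuous.tendsto (by fun_prop) τ).mono_left nhdsWithin_le_nhds
  refine (le_of_tendsto_of_tendsto hf.abs hlim
    (eventually_nhdsWithin_of_forall fun s hs ↦ h s hs)).trans ?_
  have hexp : Real.exp (-l * τ) ≤ Real.exp (-l * t) := Real.exp_le_exp.2 (by nlinarith)
  gcongr

/-! ### A priori bounds for the solution -/

section Solution

variable {Ω : Type*} [MeasurableSpace Ω] {P : Measure Ω} {z : ℝ≥0 → Ω → ℝ}

/-- A priori bounds for the solution just before the first large jump after time `T`. -/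
theorem IsSolution.abs_leftLim_le {l₁ l₂ : ℝ} (hl₁ : 0 < l₁)
    (hl₂ : 0 < l₂) {F : Plane → Plane} {B : ℝ} (hF : ∀ x, ‖F x‖ ≤ B) (hFc : Continuous F)
    {X : Plane → ℝ≥0 → Ω → Plane} (hX : IsSolution P z l₁ l₂ F X) {T : ℝ≥0} (hT : 0 < T) {K : ℝ}
    {m : Ω → ℝ} (hm : ∀ᵐ ω ∂P, T ≤ waitTime z T K ω ∧ ∀ s ≤ waitTime z T K ω, |z s ω| ≤ m ω)
    (x : Plane) : ∀ᵐ ω ∂P,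
      |Function.leftLim (fun t ↦ X x t ω) (waitTime z T K ω) 0|
        ≤ Real.exp (-l₁ * T) * |x 0| + (B / l₁ + 2 * m ω) ∧
      |Function.leftLim (fun t ↦ X x t ω) (waitTime z T K ω) 1|
        ≤ Real.exp (-l₂ * T) * |x 1| + B / l₂ := by
  filter_upwards [hX x, hm] with ω ⟨hc, heq⟩ ⟨hτ, hzm⟩
  set τ := waitTime z T K ω with hτdef
  have hτ0 : 0 < τ := hT.trans_le hτ
  have hlim := hc.tendsto_leftLim hτ0
  have hcoord : ∀ i : Fin 2, Continuous fun y : Plane ↦ y i := fun i ↦ by fun_prop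
  have hlimi : ∀ i : Fin 2, Tendsto (fun t ↦ X x t ω i) (𝓝[<] τ)
      (𝓝 (Function.leftLim (fun t ↦ X x t ω) τ i)) := fun i ↦
    ((hcoord i).tendsto _).comp hlim
  have hFB : ∀ i : Fin 2, ∀ s, |F (X x s ω) i| ≤ B := fun i s ↦ by
    have := PiLp.norm_apply_le (F (X x s ω)) i
    rw [Real.norm_eq_abs] at this
    exact this.trans (hF _)
  have hXi : ∀ i : Fin 2, IsCadlag fun t ↦ X x t ω i := fun i ↦ hc.comp (hcoord i)
  have hFi : ∀ i : Fin 2, IsCadlag fun t ↦ F (X x t ω) i := fun i ↦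
    hc.comp ((hcoord i).comp hFc)
  constructor
  · refine le_of_tendsto_exp_bound hτ0 (hlimi 0) hτ hl₁ fun s hs ↦ ?_
    rw [← add_assoc]
    exact abs_le_of_linear_equation hl₁ (hXi 0) (hFi 0) (hFB 0) (ζ := fun t ↦ z t ω)
      (fun r hr ↦ hzm r (hr.trans hs.le)) fun r ↦ (heq r).1
  · refine le_of_tendsto_exp_bound hτ0 (hlimi 1) hτ hl₂ fun s _ ↦ ?_
    have := abs_le_of_linear_equation hl₂ (hXi 1) (hFi 1) (hFB 1) (ζ := fun _ ↦ 0) (t := s) (m := 0)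
      (x := x 1) (by simp) fun r ↦ by rw [add_zero]; exact (heq r).2
    simpa using this

end Solution

/-! ### One-step estimates for the chain -/

section Drift

variable {Ω : Type*} [MeasurableSpace Ω] {P : Measure Ω} {z : ℝ≥0 → Ω → ℝ} {ν : Measure ℝ}
  {T : ℝ≥0} {K : ℝ} {X : Plane → ℝ≥0 → Ω → Plane} {Q : Kernel (ℝ × ℝ) (ℝ × ℝ)}

theorem enorm_rpow_le_of_abs_le {q : ℝ} (hq0 : 0 ≤ q) (hq1 : q ≤ 1) {y e x c : ℝ} (he : 0 ≤ e)
    (hc : 0 ≤ c) (h : |y| ≤ e * |x| + c) :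
    ‖y‖ₑ ^ q ≤ ENNReal.ofReal (e ^ q) * ‖x‖ₑ ^ q + ENNReal.ofReal (c ^ q) := by
  rw [enorm_rpow_eq hq0, enorm_rpow_eq hq0, ← ENNReal.ofReal_mul (by positivity),
    ← Real.mul_rpow he (abs_nonneg _), ← ENNReal.ofReal_add (by positivity) (by positivity)]
  refine ENNReal.ofReal_le_ofReal ((Real.rpow_le_rpow (abs_nonneg _) h hq0).trans ?_)
  exact Real.rpow_add_le_add_rpow (by positivity) hc hq0 hq1

/-- The Lyapunov function contracts on average. -/
theorem lintegral_lyapunov_le [IsProbabilityMeasure P] (hQ : IsMaximalCouplingKernel ν K Q)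
    (hK : 0 < bigJumpRate ν K) {q : ℝ} (hq0 : 0 ≤ q) (hq1 : q ≤ 1) {e b : ℝ} (he : 0 ≤ e)
    (hb : 0 ≤ b) {m : Ω → ℝ} (hm0 : ∀ ω, 0 ≤ m ω) (u : Plane × Plane)
    (hx : ∀ x : Plane, ∀ᵐ ω ∂P,
      |Function.leftLim (fun t ↦ X x t ω) (waitTime z T K ω) 0| ≤ e * |x 0| + (b + 2 * m ω) ∧
      |Function.leftLim (fun t ↦ X x t ω) (waitTime z T K ω) 1| ≤ e * |x 1| + b) :
    ∫⁻ w, lyapunov q w ∂(couplingTransition P z T K X Q u)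
      ≤ ENNReal.ofReal (e ^ q) * lyapunov q u
        + 2 * (∫⁻ ω, ENNReal.ofReal ((b + 2 * m ω) ^ q) ∂P + ENNReal.ofReal (b ^ q)
          + ∫⁻ η, ‖η‖ₑ ^ q ∂(bigJumpLaw ν K)) := by
  refine (lintegral_couplingTransition_le P z T K X Q u (measurable_lyapunov q)).trans ?_
  set Eη := ∫⁻ η, ‖η‖ₑ ^ q ∂(bigJumpLaw ν K) with hEη
  set E := ENNReal.ofReal (e ^ q) with hE
  calc _ ≤ ∫⁻ ω, (E * lyapunov q u + 2 * (ENNReal.ofReal (b ^ q) + Eη)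
        + 2 * ENNReal.ofReal ((b + 2 * m ω) ^ q)) ∂P := by
        refine lintegral_mono_ae ?_
        filter_upwards [hx u.1, hx u.2] with ω ⟨h1, h2⟩ ⟨h3, h4⟩
        set a := Function.leftLim (fun t ↦ X u.1 t ω) (waitTime z T K ω)
        set c := Function.leftLim (fun t ↦ X u.2 t ω) (waitTime z T K ω)
        have := hQ.isProbabilityMeasure hK (a 0, c 0)
        have hm' := hm0 ω
        have h1 := enorm_rpow_le_of_abs_le hq0 hq1 he (by positivity) h1
        have h2 := enorm_rpow_le_of_abs_le hq0 hq1 he hb h2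
        have h3 := enorm_rpow_le_of_abs_le hq0 hq1 he (by positivity) h3
        have h4 := enorm_rpow_le_of_abs_le hq0 hq1 he hb h4
        have h5 := hQ.lintegral_fst_le hK hq0 hq1 (a 0) (c 0)
        have h6 := hQ.lintegral_snd_le hK hq0 hq1 (a 0) (c 0)
        have heq : ∫⁻ ξ, lyapunov q (!₂[ξ.1, a 1], !₂[ξ.2, c 1]) ∂(Q (a 0, c 0))
            = (∫⁻ ξ, ‖ξ.1‖ₑ ^ q ∂(Q (a 0, c 0)) + ‖a 1‖ₑ ^ q)
              + (∫⁻ ξ, ‖ξ.2‖ₑ ^ q ∂(Q (a 0, c 0)) + ‖c 1‖ₑ ^ q) := by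
          simp only [lyapunov, Matrix.cons_val_zero, Matrix.cons_val_one]
          rw [lintegral_add_left (by fun_prop), lintegral_add_left (by fun_prop),
            lintegral_add_left (by fun_prop)]
          simp
        rw [heq]
        refine (add_le_add (add_le_add (h5.trans (add_le_add h1 le_rfl)) h2)
          (add_le_add (h6.trans (add_le_add h3 le_rfl)) h4)).trans (le_of_eq ?_)
        simp only [lyapunov]
        ring
    _ = _ := by
        rw [lintegral_add_left measurable_const, lintegral_const_mul' _ _ ENNReal.ofNat_ne_top]
        simp only [lintegral_const, measure_univ, mul_one]
        ring

theorem couplingTransition_univ_le [IsProbabilityMeasure P] (hQ : IsMaximalCouplingKernel ν K Q)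
    (hK : 0 < bigJumpRate ν K) (u : Plane × Plane) :
    couplingTransition P z T K X Q u univ ≤ 1 := by
  have h := lintegral_couplingTransition_le P z T K X Q u (g := fun _ ↦ 1) measurable_const
  have hp := hQ.isProbabilityMeasure hK
  simpa using h

/-- The chain gets close in one step with positive probability. -/
theorem couplingTransition_bad_le [IsProbabilityMeasure P] (hQ : IsMaximalCouplingKernel ν K Q)
    (hK : 0 < bigJumpRate ν K) {d M β : ℝ} (hβ0 : 0 ≤ β) (hβ2 : β ≤ 2)
    (hov : ∀ a b : ℝ, |a| + |b| ≤ M → Q (a, b) {ξ | ξ.1 ≠ ξ.2} ≤ ENNReal.ofReal (β / 2))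
    {E : Set Ω} (hE : MeasurableSet E) (hEP : 1 / 2 ≤ P E) (u : Plane × Plane)
    (h : ∀ᵐ ω ∂P, ω ∈ E →
      |Function.leftLim (fun t ↦ X u.1 t ω) (waitTime z T K ω) 0|
        + |Function.leftLim (fun t ↦ X u.2 t ω) (waitTime z T K ω) 0| ≤ M ∧
      |Function.leftLim (fun t ↦ X u.1 t ω) (waitTime z T K ω) 1
        - Function.leftLim (fun t ↦ X u.2 t ω) (waitTime z T K ω) 1| ≤ d) :
    couplingTransition P z T K X Q u {w | d < ‖w.1 - w.2‖}
      ≤ ENNReal.ofReal (1 - (1 - β / 2) / 2) := by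
  have hbad : MeasurableSet {w : Plane × Plane | d < ‖w.1 - w.2‖} :=
    measurableSet_lt measurable_const (by fun_prop)
  rw [← lintegral_indicator_one hbad]
  refine (lintegral_couplingTransition_le P z T K X Q u
    (measurable_one.indicator hbad)).trans ?_
  -- On `E` the second coordinates are within `d`, so the pair is far apart only if the coupling
  -- fails, with probability at most `β / 2`; off `E` the trivial bound is used. The total is `1 -
  -- (1 - β / 2) P(E)`.
  calc _ ≤ ∫⁻ ω, (E.indicator (fun _ ↦ ENNReal.ofReal (β / 2)) ω + Eᶜ.indicator 1 ω) ∂P := by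
        refine lintegral_mono_ae ?_
        filter_upwards [h] with ω hω
        set a := Function.leftLim (fun t ↦ X u.1 t ω) (waitTime z T K ω)
        set c := Function.leftLim (fun t ↦ X u.2 t ω) (waitTime z T K ω)
        have := hQ.isProbabilityMeasure hK (a 0, c 0)
        by_cases hωE : ω ∈ E
        · obtain ⟨h1, h2⟩ := hω hωE
          rw [indicator_of_mem hωE, indicator_of_notMem (by simpa using hωE), add_zero]
          refine le_trans ?_ (hov _ _ h1)
          have hne : MeasurableSet {ξ : ℝ × ℝ | ξ.1 ≠ ξ.2} :=
            (measurableSet_eq_fun measurable_fst measurable_snd).compl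
          rw [← lintegral_indicator_one hne]
          refine lintegral_mono fun ξ ↦ ?_
          by_cases hξ : ξ.1 = ξ.2
          · rw [indicator_of_notMem]
            · exact zero_le
            · simp only [mem_ofPred_eq, not_lt, EuclideanSpace.norm_eq, Fin.sum_univ_two,
                PiLp.sub_apply, Matrix.cons_val_zero, Matrix.cons_val_one, hξ]
              simpa [Real.sqrt_sq_eq_abs] using h2
          · rw [indicator_of_mem (show ξ ∈ {ξ : ℝ × ℝ | ξ.1 ≠ ξ.2} from hξ)]
            exact indicator_le_self' (fun _ _ ↦ zero_le) _
        · rw [indicator_of_notMem hωE, indicator_of_mem (by simpa using hωE), zero_add]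
          calc _ ≤ ∫⁻ _, 1 ∂(Q (a 0, c 0)) := lintegral_mono fun ξ ↦
                indicator_le_self' (f := (1 : Plane × Plane → ℝ≥0∞)) (fun _ _ ↦ zero_le) _
            _ = _ := by simp
    _ = ENNReal.ofReal (β / 2) * P E + P Eᶜ := by
        rw [lintegral_add_left (measurable_const.indicator hE), lintegral_indicator_const hE,
          lintegral_indicator_one hE.compl]
    _ ≤ _ := by
        have h1 : P E = ENNReal.ofReal (P.real E) := by
          rw [measureReal_def, ENNReal.ofReal_toReal (measure_ne_top _ _)]
        have h2 : P Eᶜ = ENNReal.ofReal (1 - P.real E) := by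
          rw [← probReal_compl_eq_one_sub hE, measureReal_def,
            ENNReal.ofReal_toReal (measure_ne_top _ _)]
        have h3 : P.real E ≤ 1 := measureReal_le_one
        have h4 : 1 / 2 ≤ P.real E := by
          have := ENNReal.toReal_mono (measure_ne_top P E) hEP
          simpa [measureReal_def] using this
        rw [h1, h2, ← ENNReal.ofReal_mul (by positivity),
          ← ENNReal.ofReal_add (by positivity) (by linarith)]
        refine ENNReal.ofReal_le_ofReal ?_
        nlinarith

end Drift


/-! ### Exponential moments of the meeting time -/

section Final

variable {Ω : Type*} [MeasurableSpace Ω] {P : Measure Ω} {z : ℝ≥0 → Ω → ℝ} {ν : Measure ℝ}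

theorem IsPureJumpLevy.exists_real_control [IsProbabilityMeasure P] (hz : IsPureJumpLevy P z ν)
    {T : ℝ≥0} (hT : 0 < T) {K q : ℝ} (hK : 0 < K) (hq0 : 0 < q) (hq1 : q ≤ 1)
    (hν : 0 < ν {y | K < |y|}) (hosc : ∫⁻ ω, blockOsc z T 0 ω ^ q ∂P < ∞) :
    ∃ m : Ω → ℝ, Measurable m ∧ (∀ ω, 0 ≤ m ω) ∧ ∫⁻ ω, ENNReal.ofReal (m ω ^ q) ∂P < ∞ ∧
      ∀ᵐ ω ∂P, T ≤ waitTime z T K ω ∧ ∀ s ≤ waitTime z T K ω, |z s ω| ≤ m ω := by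
  obtain ⟨W, hWm, hW, h⟩ := hz.exists_control hT hK hq0 hq1 hν hosc
  refine ⟨fun ω ↦ (W ω ^ q⁻¹).toReal, (hWm.pow_const _).ennreal_toReal,
    fun _ ↦ ENNReal.toReal_nonneg, lt_of_le_of_lt (lintegral_mono fun ω ↦ ?_) hW, ?_⟩
  · rw [ENNReal.toReal_rpow, ← ENNReal.rpow_mul, inv_mul_cancel₀ hq0.ne', ENNReal.rpow_one]
    exact ENNReal.ofReal_toReal_le
  · filter_upwards [h, ae_lt_top hWm hW.ne] with ω ⟨h1, h2⟩ hfin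
    refine ⟨h1, fun s hs ↦ ?_⟩
    have hne : W ω ^ q⁻¹ ≠ ∞ := ENNReal.rpow_ne_top_of_nonneg (by positivity) hfin.ne
    rw [← ENNReal.ofReal_le_iff_le_toReal hne, ← Real.enorm_eq_ofReal_abs]
    calc ‖z s ω‖ₑ = (‖z s ω‖ₑ ^ q) ^ q⁻¹ := by
          rw [← ENNReal.rpow_mul, mul_inv_cancel₀ hq0.ne', ENNReal.rpow_one]
      _ ≤ W ω ^ q⁻¹ := ENNReal.rpow_le_rpow (h2 s hs) (by positivity)

theorem lintegral_add_mul_rpow_lt_top [IsFiniteMeasure P] {m : Ω → ℝ} (hm0 : ∀ ω, 0 ≤ m ω)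
    {q b : ℝ} (hq0 : 0 ≤ q) (hq1 : q ≤ 1) (hb : 0 ≤ b)
    (h : ∫⁻ ω, ENNReal.ofReal (m ω ^ q) ∂P < ∞) :
    ∫⁻ ω, ENNReal.ofReal ((b + 2 * m ω) ^ q) ∂P < ∞ := by
  calc ∫⁻ ω, ENNReal.ofReal ((b + 2 * m ω) ^ q) ∂P
      ≤ ∫⁻ ω, (ENNReal.ofReal (b ^ q) + ENNReal.ofReal (2 ^ q) * ENNReal.ofReal (m ω ^ q)) ∂P := by
        refine lintegral_mono fun ω ↦ ?_
        have := hm0 ω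
        rw [← ENNReal.ofReal_mul (by positivity), ← ENNReal.ofReal_add (by positivity)
          (by positivity), ← Real.mul_rpow two_pos.le this]
        exact ENNReal.ofReal_le_ofReal (Real.rpow_add_le_add_rpow hb (by positivity) hq0 hq1)
    _ < ∞ := by
        rw [lintegral_add_left measurable_const, lintegral_const_mul' _ _ ENNReal.ofReal_ne_top,
          lintegral_const]
        exact ENNReal.add_lt_top.2 ⟨ENNReal.mul_lt_top ENNReal.ofReal_lt_top (measure_lt_top _ _),
          ENNReal.mul_lt_top ENNReal.ofReal_lt_top h⟩

/-- Above `R` the drift of `lyapunov` outweighs the trivial bound for the mass of the bad set; below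
`R` the coupling removes a fraction `c` of the constant `A`. -/
theorem setLIntegral_couplingTransition_le [IsProbabilityMeasure P] {T : ℝ≥0} {K : ℝ}
    {X : Plane → ℝ≥0 → Ω → Plane} {Q : Kernel (ℝ × ℝ) (ℝ × ℝ)}
    (hQ : IsMaximalCouplingKernel ν K Q) (hK : 0 < bigJumpRate ν K) {q d ρ C c R A r : ℝ}
    (hq0 : 0 ≤ q) (hρ0 : 0 ≤ ρ) (hC : 0 ≤ C) (hc1 : c ≤ 1) (hA : 0 ≤ A) (hr : 0 ≤ r)
    (hV : ∀ u, ∫⁻ w, lyapunov q w ∂(couplingTransition P z T K X Q u)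
      ≤ ENNReal.ofReal ρ * lyapunov q u + ENNReal.ofReal C)
    (hbad : ∀ u, lyapunov q u ≤ ENNReal.ofReal R →
      couplingTransition P z T K X Q u {w | d < ‖w.1 - w.2‖} ≤ ENNReal.ofReal (1 - c))
    (h1 : ∀ v > R, A + ρ * v + C ≤ r * (A + v))
    (h2 : ∀ v, 0 ≤ v → v ≤ R → A * (1 - c) + ρ * v + C ≤ r * (A + v)) (u : Plane × Plane) :
    ∫⁻ w in {w | d < ‖w.1 - w.2‖}, (ENNReal.ofReal A + lyapunov q w)
        ∂(couplingTransition P z T K X Q u)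
      ≤ ENNReal.ofReal r * (ENNReal.ofReal A + lyapunov q u) := by
  rw [lintegral_add_left measurable_const, setLIntegral_const]
  have hV' := (setLIntegral_le_lintegral {w | d < ‖w.1 - w.2‖} _).trans (hV u)
  rw [lyapunov_eq hq0 u] at hV' ⊢
  set v := (|u.1 0| ^ q + |u.1 1| ^ q) + (|u.2 0| ^ q + |u.2 1| ^ q) with hv
  have hv0 : 0 ≤ v := by positivity
  rw [← ENNReal.ofReal_add hA hv0, ← ENNReal.ofReal_mul hr]
  rw [← ENNReal.ofReal_mul hρ0, ← ENNReal.ofReal_add (by positivity) hC] at hV'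
  rcases lt_or_ge R v with hRv | hRv
  · have h3 := (measure_mono (subset_univ {w : Plane × Plane | d < ‖w.1 - w.2‖})).trans
      (couplingTransition_univ_le (X := X) (z := z) (P := P) (T := T) hQ hK u)
    refine (add_le_add (mul_le_mul' le_rfl h3) hV').trans ?_
    rw [mul_one, ← ENNReal.ofReal_add hA (by positivity)]
    exact ENNReal.ofReal_le_ofReal (by linarith [h1 v hRv])
  · have h3 := hbad u (by rw [lyapunov_eq hq0 u]; exact ENNReal.ofReal_le_ofReal hRv)
    refine (add_le_add (mul_le_mul' le_rfl h3) hV').trans ?_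
    rw [← ENNReal.ofReal_mul hA, ← ENNReal.ofReal_add (mul_nonneg hA (by linarith)) (by positivity)]
    exact ENNReal.ofReal_le_ofReal (by linarith [h2 v hv0 hRv])

theorem abs_le_of_lyapunov_le {q R : ℝ} (hq0 : 0 < q) (hR : 0 ≤ R) {u : Plane × Plane}
    (h : lyapunov q u ≤ ENNReal.ofReal R) (i : Fin 2) :
    |u.1 i| ≤ R ^ q⁻¹ ∧ |u.2 i| ≤ R ^ q⁻¹ := by
  rw [lyapunov_eq hq0.le, ENNReal.ofReal_le_ofReal_iff hR] at h
  have key : ∀ y : ℝ, |y| ^ q ≤ R → |y| ≤ R ^ q⁻¹ := fun y hy ↦ by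
    rw [← Real.rpow_rpow_inv (abs_nonneg y) hq0.ne']
    exact Real.rpow_le_rpow (by positivity) hy (by positivity)
  have h0 : ∀ y : ℝ, 0 ≤ |y| ^ q := fun y ↦ by positivity
  have hi : i = 0 ∨ i = 1 := by fin_cases i <;> simp
  rcases hi with rfl | rfl
  · exact ⟨key _ (by linarith [h0 (u.1 0), h0 (u.1 1), h0 (u.2 0), h0 (u.2 1)]),
      key _ (by linarith [h0 (u.1 0), h0 (u.1 1), h0 (u.2 0), h0 (u.2 1)])⟩
  · exact ⟨key _ (by linarith [h0 (u.1 0), h0 (u.1 1), h0 (u.2 0), h0 (u.2 1)]),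
      key _ (by linarith [h0 (u.1 0), h0 (u.1 1), h0 (u.2 0), h0 (u.2 1)])⟩

theorem rpow_le_one_add_rpow {x a p : ℝ} (hx : 0 ≤ x) (ha : 0 ≤ a) (hap : a ≤ p) :
    x ^ a ≤ 1 + x ^ p := by
  rcases le_total x 1 with h | h
  · linarith [Real.rpow_le_one hx h ha, Real.rpow_nonneg hx p]
  · linarith [Real.rpow_le_rpow_of_exponent_le h hap]

/-- Subadditivity of `t ↦ t ^ s` reduces the claim to the powers `q * s ≤ p` of the two norms. -/
theorem div_rpow_le {A q s p v x y : ℝ} (hA : 0 < A) (hq : 0 ≤ q) (hs0 : 0 ≤ s) (hs1 : s ≤ 1)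
    (hqs : q * s ≤ p) (hx : 0 ≤ x) (hy : 0 ≤ y) (hv0 : 0 ≤ v) (hv : v ≤ 2 * (x ^ q + y ^ q)) :
    ((A + v) / A) ^ s ≤ (1 + 2 * (2 / A) ^ s) * (1 + x ^ p + y ^ p) := by
  have hxp : 0 ≤ x ^ p := by positivity
  have hyp : 0 ≤ y ^ p := by positivity
  have hk : 0 ≤ (2 / A) ^ s := by positivity
  have h1 : ((A + v) / A) ^ s ≤ 1 + (2 / A) ^ s * (x ^ (q * s) + y ^ (q * s)) := by
    calc ((A + v) / A) ^ s ≤ (1 + 2 / A * (x ^ q + y ^ q)) ^ s := by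
          refine Real.rpow_le_rpow (by positivity) ?_ hs0
          have : 1 + 2 / A * (x ^ q + y ^ q) = (A + 2 * (x ^ q + y ^ q)) / A := by field_simp
          rw [this]
          gcongr
      _ ≤ 1 ^ s + (2 / A * (x ^ q + y ^ q)) ^ s :=
          Real.rpow_add_le_add_rpow zero_le_one (by positivity) hs0 hs1
      _ ≤ 1 + (2 / A) ^ s * ((x ^ q) ^ s + (y ^ q) ^ s) := by
          rw [Real.one_rpow, Real.mul_rpow (by positivity) (by positivity)]
          gcongr
          exact Real.rpow_add_le_add_rpow (by positivity) (by positivity) hs0 hs1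
      _ = _ := by rw [← Real.rpow_mul hx, ← Real.rpow_mul hy]
  have h2 := rpow_le_one_add_rpow hx (mul_nonneg hq hs0) hqs
  have h3 := rpow_le_one_add_rpow hy (mul_nonneg hq hs0) hqs
  nlinarith [mul_le_mul_of_nonneg_left (add_le_add h2 h3) hk, mul_nonneg hk hxp, mul_nonneg hk hyp]

theorem lyapunov_toReal_le {q : ℝ} (hq : 0 ≤ q) (x y : Plane) :
    (|x 0| ^ q + |x 1| ^ q) + (|y 0| ^ q + |y 1| ^ q) ≤ 2 * (‖x‖ ^ q + ‖y‖ ^ q) := by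
  have key : ∀ (w : Plane) (i : Fin 2), |w i| ^ q ≤ ‖w‖ ^ q := fun w i ↦
    Real.rpow_le_rpow (abs_nonneg _) (by simpa using PiLp.norm_apply_le w i) hq
  linarith [key x 0, key x 1, key y 0, key y 1]

theorem exists_forall_ge_exp_bound {T : ℝ} (hT : 0 < T) (a b : ℝ) {d : ℝ} (hd : 0 < d) :
    ∃ l₀, ∀ l ≥ l₀, Real.exp (-l * T) * a + b / l ≤ d := by
  have h1 : Tendsto (fun l : ℝ ↦ Real.exp (-l * T) * a) atTop (𝓝 (0 * a)) := by
    refine (Real.tendsto_exp_atBot.comp ?_).mul_const a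
    exact (tendsto_neg_atTop_atBot).atBot_mul_const hT
  have h2 : Tendsto (fun l : ℝ ↦ b / l) atTop (𝓝 0) := tendsto_const_nhds.div_atTop tendsto_id
  have h3 := h1.add h2
  rw [zero_mul, zero_add] at h3
  exact eventually_atTop.1 (h3.eventually (ge_mem_nhds hd))

/-- The coupling chain is a contraction on average outside the set of close pairs, uniformly in the
drift. -/
theorem IsPureJumpLevy.exists_uniform_contraction [IsProbabilityMeasure P]
    (hz : IsPureJumpLevy P z ν) {α K l₁ : ℝ} (hα : α ∈ Ioo (0 : ℝ) 2) (hK : 0 < K) (hl₁ : 0 < l₁)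
    {T : ℝ≥0} (hT : 0 < T) (B : ℝ) :
    ∃ M₀ > 0, ∀ M ≥ M₀, ∀ (β₀ β₁ β₂ : ℝ) (L : ℝ≥0) (pK : ℝ → ℝ),
      NoiseAssumption P z ν α K pK M β₀ β₁ β₂ L →
      ∀ d > 0, ∃ l₀ ≥ l₁, ∀ l₂ > l₀, ∃ A > 0, ∃ r, 0 < r ∧ r < 1 ∧
        ∀ F : Plane → Plane, (∀ x, ‖F x‖ ≤ B) → LipschitzWith L F →
        ∀ X : Plane → ℝ≥0 → Ω → Plane, IsSolution P z l₁ l₂ F X →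
        ∀ Q : Kernel (ℝ × ℝ) (ℝ × ℝ), IsMaximalCouplingKernel ν K Q → ∀ u,
        ∫⁻ w in {w | d < ‖w.1 - w.2‖}, (ENNReal.ofReal A + lyapunov (α / 2) w)
            ∂(couplingTransition P z T K X Q u)
          ≤ ENNReal.ofReal r * (ENNReal.ofReal A + lyapunov (α / 2) u) := by
  -- `M₀` precedes the noise assumption in the statement, but its moment, rate and jump-law
  -- information involves only `z`, `ν`, `α` and `K`. Any admissible choice of the other parameters
  -- supplies it; if there is none, nothing is to be shown.
  by_cases hex : ∃ (M β₀ β₁ β₂ : ℝ) (L : ℝ≥0) (pK : ℝ → ℝ),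
      NoiseAssumption P z ν α K pK M β₀ β₁ β₂ L
  swap
  · exact ⟨1, one_pos, fun M _ β₀ β₁ β₂ L pK hN ↦ absurd ⟨M, β₀, β₁, β₂, L, pK, hN⟩ hex⟩
  obtain ⟨M', β₀', β₁', β₂', L', pK', hN'⟩ := hex
  set q := α / 2 with hq
  have hq0 : 0 < q := half_pos hα.1
  have hq1 : q ≤ 1 := by rw [hq]; linarith [hα.2]
  have hqα : q ∈ Ioo 0 α := ⟨hq0, half_lt_self hα.1⟩
  have hrate := hN'.rate_pos
  have hmom : ∫⁻ ω, ENNReal.ofReal (|stochConv z l₁ T ω| ^ q) ∂P < ∞ :=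
    (le_iSup (fun t : ℝ≥0 ↦ ∫⁻ ω, ENNReal.ofReal (|stochConv z l₁ t ω| ^ q) ∂P) T).trans_lt
      (hN'.moments l₁ hl₁ q hqα)
  have hosc := hz.lintegral_blockOsc_lt_top hl₁ hT hq0 hmom
  have hη := hz.lintegral_bigJumpLaw_lt_top hT hq0 hrate hosc
  obtain ⟨m, hmm, hm0, hmq, hm⟩ := hz.exists_real_control hT hK hq0 hq1
    (measure_lt_abs_pos hrate hN'.density) hosc
  -- `B` is fixed before a drift is given and could be negative; the absolute value keeps the
  -- constants nonnegative.
  set b := |B| / l₁ with hb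
  have hb0 : 0 ≤ b := by positivity
  set e := Real.exp (-l₁ * T) with he
  have hT0 : (0 : ℝ) < T := hT
  have he1 : e < 1 := Real.exp_lt_one_iff.2 (by nlinarith)
  have hρ1 : e ^ q < 1 := Real.rpow_lt_one (Real.exp_pos _).le he1 hq0
  have hbm := lintegral_add_mul_rpow_lt_top hm0 hq0.le hq1 hb0 hmq
  set C' : ℝ≥0∞ := 2 * (∫⁻ ω, ENNReal.ofReal ((b + 2 * m ω) ^ q) ∂P + ENNReal.ofReal (b ^ q)
    + ∫⁻ η, ‖η‖ₑ ^ q ∂(bigJumpLaw ν K)) with hC'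
  have hC'fin : C' ≠ ∞ := ENNReal.mul_ne_top ENNReal.ofNat_ne_top
    (ENNReal.add_ne_top.2 ⟨ENNReal.add_ne_top.2 ⟨hbm.ne, ENNReal.ofReal_ne_top⟩, hη.ne⟩)
  set C := C'.toReal + 1 with hC
  have hC0 : 0 < C := by positivity
  have hC'C : C' ≤ ENNReal.ofReal C := by
    rw [← ENNReal.ofReal_toReal hC'fin]
    exact ENNReal.ofReal_le_ofReal (by rw [hC]; linarith)
  -- Neither `R` nor the level `n` below involves `β₀` or `l₂`, so `M₀` can be fixed first.
  set R := 2 * C / (1 - e ^ q) with hR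
  have hR0 : 0 ≤ R := div_nonneg (by positivity) (by linarith)
  obtain ⟨n, hn⟩ := exists_nat_half_le (P := P) (X := fun ω ↦ ENNReal.ofReal (m ω))
    fun _ ↦ ENNReal.ofReal_ne_top
  set E : Set Ω := {ω | m ω ≤ n} with hE
  have hEm : MeasurableSet E := measurableSet_le hmm measurable_const
  have hEP : 1 / 2 ≤ P E := (hn n le_rfl).trans (measure_mono fun ω hω ↦ by
    have h : ENNReal.ofReal (m ω) ≤ n := hω
    rw [← ENNReal.ofReal_natCast, ENNReal.ofReal_le_ofReal_iff n.cast_nonneg] at h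
    exact h)
  -- The two first coordinates start within `R ^ q⁻¹`, and on `E` each gains at most `b + 2 * n`
  -- before the jump.
  refine ⟨2 * R ^ q⁻¹ + 2 * b + 4 * n + 1, by positivity, fun M hM β₀ β₁ β₂ L pK hN d hd ↦ ?_⟩
  -- This makes the sum of the moduli of the two second coordinates before the jump at most `d`.
  obtain ⟨l₀, hl₀⟩ := exists_forall_ge_exp_bound hT0 (2 * R ^ q⁻¹) (2 * |B|) hd
  refine ⟨max l₁ l₀, le_max_left _ _, fun l₂ hl₂ ↦ ?_⟩
  have hl₂1 : l₁ < l₂ := (le_max_left _ _).trans_lt hl₂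
  have hl₂0 : 0 < l₂ := hl₁.trans hl₂1
  have hdl := hl₀ l₂ ((le_max_right _ _).trans hl₂.le)
  obtain ⟨hβ0, hβ2⟩ := hN.β₀_mem
  -- `c` is the probability `1/2` of a moderate noise times the success probability `1 - β₀ / 2` of
  -- the coupling.
  obtain ⟨A, hA, r, hr0, hr1, h1, h2⟩ := exists_contraction (ρ := e ^ q) (C := C)
    (c := (1 - β₀ / 2) / 2) (R := R) (Real.rpow_nonneg (Real.exp_pos _).le _) hρ1 hC0
    (by linarith) (by linarith) hR
  refine ⟨A, hA, r, hr0, hr1, fun F hF hFL X hX Q hQ u ↦ ?_⟩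
  have hB0 : 0 ≤ B := (norm_nonneg _).trans (hF 0)
  have hx := fun x ↦ hX.abs_leftLim_le hl₁ hl₂0 hF hFL.continuous hT hm x
  rw [← abs_of_nonneg hB0, ← hb] at hx
  have hexp : Real.exp (-l₂ * T) ≤ e := Real.exp_le_exp.2 (by nlinarith)
  have hbl : |B| / l₂ ≤ b := by rw [hb]; gcongr
  refine setLIntegral_couplingTransition_le hQ hrate hq0.le
    (Real.rpow_nonneg (Real.exp_pos _).le _) hC0.le (c := (1 - β₀ / 2) / 2) (by linarith) hA.le
    hr0.le (fun v ↦ ?_) (fun v hv ↦ ?_) h1 h2 u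
  · refine (lintegral_lyapunov_le hQ hrate hq0.le hq1 (Real.exp_pos _).le hb0 hm0 v
      fun x ↦ ?_).trans (add_le_add le_rfl hC'C)
    filter_upwards [hx x] with ω hω
    refine ⟨hω.1, hω.2.trans (add_le_add ?_ hbl)⟩
    exact mul_le_mul_of_nonneg_right hexp (abs_nonneg _)
  · refine couplingTransition_bad_le hQ hrate hβ0.le hβ2.le (fun a c hac ↦
      hQ.measure_ne_le hrate hN.density_measurable hN.density_nonneg hN.density
        (hN.overlap a c hac)) hEm hEP v ?_
    filter_upwards [hx v.1, hx v.2] with ω ⟨h3, h4⟩ ⟨h5, h6⟩ hωE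
    have hmn : m ω ≤ n := hωE
    obtain ⟨h7, h8⟩ := abs_le_of_lyapunov_le hq0 hR0 hv 0
    obtain ⟨h9, h10⟩ := abs_le_of_lyapunov_le hq0 hR0 hv 1
    have hle : ∀ {y : ℝ}, |y| ≤ R ^ q⁻¹ → e * |y| ≤ R ^ q⁻¹ := fun {y} hy ↦
      (mul_le_of_le_one_left (abs_nonneg _) he1.le).trans hy
    refine ⟨by linarith [hle h7, hle h8], (abs_sub _ _).trans ?_⟩
    have e1 := mul_le_mul_of_nonneg_left h9 (Real.exp_pos (-l₂ * T)).le
    have e2 := mul_le_mul_of_nonneg_left h10 (Real.exp_pos (-l₂ * T)).le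
    have e3 : Real.exp (-l₂ * T) * (2 * R ^ q⁻¹) + 2 * |B| / l₂
        = Real.exp (-l₂ * T) * R ^ q⁻¹ + Real.exp (-l₂ * T) * R ^ q⁻¹ + (|B| / l₂ + |B| / l₂) := by
      ring
    linarith

end Final

end LevyCoupling

theorem theorem4p2 {Ω : Type*} [MeasurableSpace Ω] (P : Measure Ω) [IsProbabilityMeasure P]
    (z : ℝ≥0 → Ω → ℝ) (ν : Measure ℝ) (hz : LevyCoupling.IsPureJumpLevy P z ν)
    (α : ℝ) (hα : α ∈ Ioo (0 : ℝ) 2) (K : ℝ) (hK : 0 < K)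
    (l₁ : ℝ) (hl₁ : 0 < l₁) (T : ℝ≥0) (hT : 0 < T) (B : ℝ) :
    ∃ M₀ > 0, ∀ M ≥ M₀, ∀ (β₀ β₁ β₂ : ℝ) (L : ℝ≥0) (pK : ℝ → ℝ),
      LevyCoupling.NoiseAssumption P z ν α K pK M β₀ β₁ β₂ L →
      ∀ d > 0, ∃ l₀ ≥ l₁, ∀ l₂ > l₀, ∀ p ∈ Ioo 0 α, ∃ θ > 0, ∃ C > 0,
        ∀ F : LevyCoupling.Plane → LevyCoupling.Plane, (∀ x, ‖F x‖ ≤ B) → LipschitzWith L F →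
        ∀ X : LevyCoupling.Plane → ℝ≥0 → Ω → LevyCoupling.Plane,
        LevyCoupling.IsSolution P z l₁ l₂ F X →
        ∀ Q : Kernel (ℝ × ℝ) (ℝ × ℝ), LevyCoupling.IsMaximalCouplingKernel ν K Q →
        ∀ (x y : LevyCoupling.Plane) (Ω' : Type*) [MeasurableSpace Ω'] (P' : Measure Ω')
          [IsProbabilityMeasure P'] (S : ℕ → Ω' → LevyCoupling.Plane × LevyCoupling.Plane),
        LevyCoupling.IsMarkovChain P' S (LevyCoupling.couplingTransition P z T K X Q) (x, y) →
        ∫⁻ ω, LevyCoupling.expENat θ (LevyCoupling.meetTime S d ω) ∂P'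
          ≤ ENNReal.ofReal (C * (1 + ‖x‖ ^ p + ‖y‖ ^ p)) := by
  obtain ⟨M₀, hM₀, h⟩ := hz.exists_uniform_contraction hα hK hl₁ hT B
  refine ⟨M₀, hM₀, fun M hM β₀ β₁ β₂ L pK hN d hd ↦ ?_⟩
  obtain ⟨l₀, hl₀, h⟩ := h M hM β₀ β₁ β₂ L pK hN d hd
  refine ⟨l₀, hl₀, fun l₂ hl₂ p hp ↦ ?_⟩
  obtain ⟨A, hA, r, hr0, hr1, h⟩ := h l₂ hl₂
  set q := α / 2 with hq
  have hq0 : 0 < q := half_pos hα.1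
  -- For `p < q` this exponent lowers the growth from `q` to `p`; for `p ≥ q` the power `q` is
  -- already dominated by `1 + |x|^p`.
  set s := min 1 (p / q) with hs
  have hs0 : 0 < s := lt_min one_pos (div_pos hp.1 hq0)
  have hs1 : s ≤ 1 := min_le_left _ _
  have hqs : q * s ≤ p := by
    calc q * s ≤ q * (p / q) := mul_le_mul_of_nonneg_left (min_le_right _ _) hq0.le
      _ = p := by field_simp
  have hρ1 : r ^ (s / 2) < 1 := Real.rpow_lt_one hr0.le hr1 (by positivity)
  have hD : 0 < r ^ (-(s / 2)) * (1 - r ^ (s / 2))⁻¹ :=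
    mul_pos (Real.rpow_pos_of_pos hr0 _) (inv_pos.2 (by linarith))
  have hlog : Real.log r < 0 := Real.log_neg hr0 hr1
  refine ⟨-(s / 2) * Real.log r, by nlinarith, r ^ (-(s / 2)) * (1 - r ^ (s / 2))⁻¹
    * (1 + 2 * (2 / A) ^ s), by positivity, fun F hF hFL X hX Q hQ x y Ω' _ P' _ S hS ↦ ?_⟩
  have hcontr := h F hF hFL X hX Q hQ
  set v := (|x 0| ^ q + |x 1| ^ q) + (|y 0| ^ q + |y 1| ^ q) with hv
  have hv0 : 0 ≤ v := by positivity
  have hbad : MeasurableSet {u : LevyCoupling.Plane × LevyCoupling.Plane | d < ‖u.1 - u.2‖} :=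
    measurableSet_lt measurable_const (by fun_prop)
  have hstay : ∀ n, P' (LevyCoupling.stayEvent S {u | d < ‖u.1 - u.2‖} n)
      ≤ ENNReal.ofReal (r ^ n * ((A + v) / A)) := fun n ↦ by
    have h1 := hS.setLIntegral_stayEvent_le
      (Φ := fun w ↦ ENNReal.ofReal A + LevyCoupling.lyapunov q w)
      (measurable_const.add (LevyCoupling.measurable_lyapunov q)) hbad ENNReal.ofReal_ne_top
      hcontr n
    beta_reduce at h1
    rw [LevyCoupling.lyapunov_eq hq0.le (x, y)] at h1
    -- The summand `A` bounds the iterated function from below, which turns the contraction into a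
    -- bound for the probability.
    have h2 : ENNReal.ofReal A * P' (LevyCoupling.stayEvent S {u | d < ‖u.1 - u.2‖} n)
        ≤ ENNReal.ofReal (r ^ n * (A + v)) := by
      rw [← setLIntegral_const]
      refine (lintegral_mono fun ω ↦ le_self_add).trans (h1.trans (le_of_eq ?_))
      rw [← ENNReal.ofReal_add hA.le hv0, ← ENNReal.ofReal_pow hr0.le,
        ← ENNReal.ofReal_mul (by positivity)]
    rw [mul_comm, ← ENNReal.le_div_iff_mul_le (Or.inl (by simpa using hA))
      (Or.inl ENNReal.ofReal_ne_top), ← ENNReal.ofReal_div_of_pos hA, mul_div_assoc] at h2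
    exact h2
  refine (LevyCoupling.lintegral_expENat_le hS.measurable hr0 hr1 (by positivity) hs0 hs1
    hstay).trans (ENNReal.ofReal_le_ofReal ?_)
  rw [mul_assoc (r ^ (-(s / 2)) * (1 - r ^ (s / 2))⁻¹)]
  exact mul_le_mul_of_nonneg_left (LevyCoupling.div_rpow_le hA hq0.le hs0.le hs1 hqs (norm_nonneg x)
    (norm_nonneg y) hv0 (LevyCoupling.lyapunov_toReal_le hq0.le x y)) hD.le
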